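/- **Theorem 1.5.** There exist a Loch Ness monster $S$ (a connected orientable surface without boundary, of infinite genus and with exactly one end), an orientation of $S$, a family $\{M_\lambda\}_{\lambda\in[2,\infty)}$ of translation surface structures on $S$, and two multicurves $\alpha,\beta$ in $S$ (locally finite collections of pairwise disjoint, pairwise non-isotopic essential simple closed curves) such that the mapping class $f=T_\alpha T_\beta\in\mathrm{Mod}(S)$, where $T_\alpha$ and $T_\beta$ are the right multitwists along $\alpha$ and $\beta$ (a right Dehn twist along every curve of the collection), has the following properties. Here $\mathrm{Mod}(S)$ is the group of isotopy classes of orientation preserving homeomorphisms of $S$. 1. For every integer $k\ge 1$, $f^k$ does not fix the isotopy class of any essential simple closed curve in $S$. 2. For every $\lambda\ge 2$, let $\mathrm{Aff}(M_\lambda)$ be the group of affine automorphisms of $M_\lambda$, that is, the homeomorphisms of $S$ that preserve the set of conical singularities of $M_\lambda$ and are affine, with a constant invertible linear part (the derivative), in the charts of $M_\lambda$. The natural map $\tau_\lambda$ that sends an affine automorphism to its mapping class (orientation reversing classes being allowed in the target for orientation reversing automorphisms) is injective, $f$ lies in its image, and the derivative $D\tau_\lambda^{-1}(f)$ lies in $\mathrm{SL}(2,\mathbb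 R)$; its class in $\mathrm{PSL}(2,\mathbb R)$ is parabolic if $\lambda=2$ and hyperbolic if $\lambda>2$. -/

import Mathlib

open Set Filter Topology TopologicalSpace

noncomputable section

namespace FlatSurf

/-! ### Orientations of topological surfaces -/

/-- A map `g` between open subsets of the plane that is a homeomorphism near `z` preserves the
orientation at `z`: the image under `g` of every small positively oriented circle around `z` winds
exactly once, positively, around `g z`. (The function `θ` is a continuous choice of argument.) -/
def PreservesOrientationAt (g : ℂ → ℂ) (z : ℂ) : Prop :=
  ∀ᶠ r : ℝ in 𝓝[>] 0, ∃ θ : ℝ → ℝ, Continuous θ ∧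
    (∀ t : ℝ, g (z + r * Complex.exp (t * Complex.I)) - g z =
      ‖g (z + r * Complex.exp (t * Complex.I)) - g z‖ * Complex.exp (θ t * Complex.I)) ∧
    θ (2 * Real.pi) = θ 0 + 2 * Real.pi

/-- An orientation of a topological surface, given by an atlas of planar charts all of whose
transition maps preserve the orientation of the plane. -/
structure SurfaceOrientation (S : Type*) [TopologicalSpace S] where
  charts : Set (OpenPartialHomeomorph S ℂ)
  cover : ∀ x : S, ∃ e ∈ charts, x ∈ e.source
  compatible : ∀ e ∈ charts, ∀ e' ∈ charts, ∀ x ∈ e.source ∩ e'.source,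
    PreservesOrientationAt (fun z => e' (e.symm z)) (e x)

/-- A homeomorphism of an oriented surface is orientation preserving: it is so in all charts. -/
def IsOrientationPreserving {S : Type*} [TopologicalSpace S] (O : SurfaceOrientation S)
    (φ : S ≃ₜ S) : Prop :=
  ∀ e ∈ O.charts, ∀ e' ∈ O.charts, ∀ x ∈ e.source, φ x ∈ e'.source →
    PreservesOrientationAt (fun z => e' (φ (e.symm z))) (e x)

/-! ### Simple closed curves -/

/-- Parametrized simple closed curves. -/
structure SimpleClosedCurve (S : Type*) [TopologicalSpace S] where
  toMap : C(Circle, S)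
  injective : Function.Injective toMap

namespace SimpleClosedCurve

variable {S : Type*} [TopologicalSpace S]

/-- The curve as a subset of the surface. -/
def image (c : SimpleClosedCurve S) : Set S := range c.toMap

/-- The image of a simple closed curve under a homeomorphism. -/
def map (φ : S ≃ₜ S) (c : SimpleClosedCurve S) : SimpleClosedCurve S where
  toMap := (φ : C(S, S)).comp c.toMap
  injective := φ.injective.comp c.injective

/-- Two (unparametrized, unoriented) simple closed curves are isotopic: the first one can be moved
to the second one through simple closed curves. -/
def Isotopic (c c' : SimpleClosedCurve S) : Prop :=
  ∃ H : C(unitInterval × Circle, S),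
    (∀ t, Function.Injective fun z => H (t, z)) ∧
    (∀ z, H (0, z) = c.toMap z) ∧
    range (fun z => H (1, z)) = c'.image

/-- Essential simple closed curves: those that are not homotopic to a point. (Curves around a
puncture have to be excluded as well on surfaces that have punctures, that is, isolated planar
ends. This notion is only used on surfaces of infinite genus with exactly one end, which have
none.) -/
def IsEssential (c : SimpleClosedCurve S) : Prop := ¬ c.toMap.Nullhomotopic

end SimpleClosedCurve

/-! ### The Loch Ness monster -/

/-- An end of `S`: a compatible choice of a connected component of the complement of each compact
set, i.e. a point of the inverse limit of the `π₀(S ∖ K)`, `K` compact. -/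
def IsEnd {S : Type*} [TopologicalSpace S] (e : Compacts S → Set S) : Prop :=
  (∀ K : Compacts S, ∃ x ∈ (K : Set S)ᶜ, e K = connectedComponentIn (K : Set S)ᶜ x) ∧
  ∀ K L : Compacts S, K ≤ L → e L ⊆ e K

/-- The genus is at least `n`: there are `n` pairwise disjoint simple closed curves whose union
does not separate the surface. -/
def GenusAtLeast (S : Type*) [TopologicalSpace S] (n : ℕ) : Prop :=
  ∃ c : Fin n → SimpleClosedCurve S,
    (Pairwise fun i j => Disjoint (c i).image (c j).image) ∧ IsConnected (⋃ i, (c i).image)ᶜ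

/-- A Loch Ness monster: a connected orientable surface without boundary, of infinite genus and
with exactly one end. -/
structure IsLochNessMonster (S : Type*) [TopologicalSpace S] : Prop where
  t2 : T2Space S
  secondCountable : SecondCountableTopology S
  connected : ConnectedSpace S
  locallyEuclidean : ∀ x : S, ∃ e : OpenPartialHomeomorph S ℂ, x ∈ e.source
  orientable : Nonempty (SurfaceOrientation S)
  infiniteGenus : ∀ n : ℕ, GenusAtLeast S n
  oneEnd : ∃! e : Compacts S → Set S, IsEnd e

/-! ### Mapping classes -/

section MappingClass

variable (S : Type*) [TopologicalSpace S]

/-- The homeomorphisms of `S` that are isotopic to the identity, an isotopy being a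
level-preserving homeomorphism of `[0,1] × S`. -/
def isotopicToId : Subgroup (S ≃ₜ S) where
  carrier := {φ | ∃ Φ : (unitInterval × S) ≃ₜ (unitInterval × S),
    (∀ p, (Φ p).1 = p.1) ∧ (∀ x, (Φ (0, x)).2 = x) ∧ ∀ x, (Φ (1, x)).2 = φ x}
  one_mem' := ⟨1, fun _ => rfl, fun _ => rfl, fun _ => rfl⟩
  mul_mem' := by
    rintro φ ψ ⟨Φ, h1, h2, h3⟩ ⟨Ψ, k1, k2, k3⟩
    have kk : ∀ p, Ψ p = (p.1, (Ψ p).2) := fun p => Prod.ext (k1 p) rfl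
    refine ⟨Φ * Ψ, fun p => ?_, fun x => ?_, fun x => ?_⟩
    · rw [Homeomorph.mul_apply, h1, k1]
    · rw [Homeomorph.mul_apply, kk, k2, h2]
    · rw [Homeomorph.mul_apply, kk, k3, h3]; rfl
  inv_mem' := by
    rintro φ ⟨Φ, h1, h2, h3⟩
    refine ⟨Φ.symm, fun p => ?_, fun x => ?_, fun x => ?_⟩
    · conv_rhs => rw [← Φ.apply_symm_apply p, h1]
    · have : Φ (0, x) = (0, x) := Prod.ext (h1 _) (h2 _)
      rw [← this, Φ.symm_apply_apply]
    · have : Φ (1, φ.symm x) = (1, x) := Prod.ext (h1 _) (by rw [h3]; simp)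
      rw [← this, Φ.symm_apply_apply]; rfl

instance : (isotopicToId S).Normal where
  conj_mem := by
    rintro φ ⟨Φ, h1, h2, h3⟩ g
    let G : (unitInterval × S) ≃ₜ (unitInterval × S) := (Homeomorph.refl _).prodCongr g
    have hG : ∀ p, G p = (p.1, g p.2) := fun p => rfl
    have hG' : ∀ p, G.symm p = (p.1, g.symm p.2) := fun p => rfl
    refine ⟨(G.symm.trans Φ).trans G, fun p => ?_, fun x => ?_, fun x => ?_⟩
    · simp [hG, hG', h1]
    · simp [hG, hG', h2]
    · simp [hG, hG', h3]

/-- The group of all homeomorphisms of `S` modulo isotopy. The mapping class group `Mod(S)` consists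
of the orientation preserving classes in it. -/
abbrev MappingClass : Type _ := (S ≃ₜ S) ⧸ isotopicToId S

variable {S}

/-- The class `f` is represented by an orientation preserving homeomorphism, i.e. `f ∈ Mod(S)`. -/
def MappingClass.OrientationPreserving (O : SurfaceOrientation S) (f : MappingClass S) : Prop :=
  ∃ φ : S ≃ₜ S, QuotientGroup.mk φ = f ∧ IsOrientationPreserving O φ

/-- The mapping class `f` fixes the isotopy class of the simple closed curve `c`. -/
def MappingClass.Fixes (f : MappingClass S) (c : SimpleClosedCurve S) : Prop :=
  ∃ φ : S ≃ₜ S, QuotientGroup.mk φ = f ∧ (c.map φ).Isotopic c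

end MappingClass

/-! ### Multicurves and multitwists -/

section Multicurve

variable {S : Type*} [TopologicalSpace S] {ι : Type*}

/-- A multicurve: a locally finite collection of pairwise disjoint and pairwise non-isotopic
essential simple closed curves. -/
structure IsMulticurve (c : ι → SimpleClosedCurve S) : Prop where
  essential : ∀ i, (c i).IsEssential
  disjoint : Pairwise fun i j => Disjoint (c i).image (c j).image
  nonIsotopic : Pairwise fun i j => ¬ (c i).Isotopic (c j)
  locallyFinite : LocallyFinite fun i => (c i).image

/-- The closed annulus `j : S¹ × [0,1] → S` is positively oriented, where the universal cover
`ℝ × [0,1]` of the annulus, with coordinates `(x, y)`, carries the orientation of the plane. -/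
def IsPositiveAnnulus (O : SurfaceOrientation S) (j : C(Circle × unitInterval, S)) : Prop :=
  ∀ z : ℂ, 0 < z.im → z.im < 1 → ∀ e ∈ O.charts,
    j (Circle.exp (2 * Real.pi * z.re), projIcc 0 1 zero_le_one z.im) ∈ e.source →
    PreservesOrientationAt
      (fun w => e (j (Circle.exp (2 * Real.pi * w.re), projIcc 0 1 zero_le_one w.im))) z

/-- `T` is a right multitwist along the curves `c i`: there are pairwise disjoint closed annuli,
forming a locally finite family, with core curves `c i`, such that `T` is the identity outside the
annuli and is the right Dehn twist `(x, y) ↦ (x + y, y)` on each of them (an arc that crosses the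
annulus turns to the right). -/
def IsRightMultitwist (O : SurfaceOrientation S) (c : ι → SimpleClosedCurve S) (T : S ≃ₜ S) :
    Prop :=
  ∃ j : ι → C(Circle × unitInterval, S),
    (∀ i, Function.Injective (j i)) ∧
    (Pairwise fun i k => Disjoint (range (j i)) (range (j k))) ∧
    (LocallyFinite fun i => range (j i)) ∧
    (∀ i, (c i).image = j i '' {p | (p.2 : ℝ) = 1 / 2}) ∧
    (∀ i, IsPositiveAnnulus O (j i)) ∧
    (∀ i z t, T (j i (z, t)) = j i (z * Circle.exp (2 * Real.pi * (t : ℝ)), t)) ∧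
    ∀ x, (∀ i, x ∉ range (j i)) → T x = x

end Multicurve

/-! ### Translation surface structures and affine automorphisms -/

/-- A real `2 × 2` matrix acting on the plane. -/
def planeMap (A : Matrix (Fin 2) (Fin 2) ℝ) (z : ℂ) : ℂ :=
  ⟨A 0 0 * z.re + A 0 1 * z.im, A 1 0 * z.re + A 1 1 * z.im⟩

/-- A translation surface structure on `S`: a discrete set `sing` of conical singularities, and an
atlas of planar charts on its complement whose transition maps are translations (on each connected
component of the overlap). A conical singularity of angle `2πm` is a point `p` with a coordinate
`ψ`, centred at `p`, such that the charts near `p` are `ψ ^ m` up to translation. -/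
structure TranslationStructure (S : Type*) [TopologicalSpace S] where
  sing : Set S
  charts : Set (OpenPartialHomeomorph S ℂ)
  discrete : DiscreteTopology sing
  source_subset : ∀ e ∈ charts, e.source ⊆ singᶜ
  cover : ∀ x ∈ singᶜ, ∃ e ∈ charts, x ∈ e.source
  translation : ∀ e ∈ charts, ∀ e' ∈ charts, ∀ x ∈ e.source ∩ e'.source,
    ∃ c : ℂ, ∀ᶠ y in 𝓝 x, e' y = e y + c
  conical : ∀ p ∈ sing, ∃ (m : ℕ) (ψ : OpenPartialHomeomorph S ℂ),
    1 ≤ m ∧ p ∈ ψ.source ∧ ψ p = 0 ∧ ψ.source ∩ sing = {p} ∧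
    ∀ e ∈ charts, ∀ x ∈ ψ.source ∩ e.source, ∃ c : ℂ, ∀ᶠ y in 𝓝 x, e y = ψ y ^ m + c

namespace TranslationStructure

variable {S : Type*} [TopologicalSpace S] (M : TranslationStructure S)

/-- The homeomorphism `φ` preserves the set of singularities and is affine with linear part `A` in
the charts of `M`. -/
def HasDerivative (φ : S ≃ₜ S) (A : Matrix (Fin 2) (Fin 2) ℝ) : Prop :=
  φ '' M.sing = M.sing ∧
  ∀ e ∈ M.charts, ∀ e' ∈ M.charts, ∀ x ∈ e.source, φ x ∈ e'.source →
    ∃ c : ℂ, ∀ᶠ y in 𝓝 x, e' (φ y) = planeMap A (e y) + c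

/-- The group `Aff(M)` of affine automorphisms of `M`. -/
def Aff : Subgroup (S ≃ₜ S) where
  carrier := {φ | ∃ A : GL (Fin 2) ℝ, M.HasDerivative φ A}
  one_mem' := by
    refine ⟨1, image_id _, fun e he e' he' x hx hx' => ?_⟩
    obtain ⟨c, hc⟩ := M.translation e he e' he' x ⟨hx, hx'⟩
    refine ⟨c, hc.mono fun y hy => ?_⟩
    simpa [planeMap] using hy
  mul_mem' := by
    rintro φ ψ ⟨A, hA, hA'⟩ ⟨B, hB, hB'⟩
    refine ⟨A * B, ?_, fun e he e' he' x hx hx' => ?_⟩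
    · have : ((φ * ψ : S ≃ₜ S) : S → S) = φ ∘ ψ := rfl
      rw [this, image_comp, hB, hA]
    · have hs : ψ x ∈ M.singᶜ := by
        intro h
        rw [← hB] at h
        obtain ⟨w, hw, hwx⟩ := h
        exact M.source_subset e he hx (ψ.injective hwx ▸ hw)
      obtain ⟨d, hd, hxd⟩ := M.cover _ hs
      obtain ⟨c, hc⟩ := hB' e he d hd x hx hxd
      obtain ⟨c', hc'⟩ := hA' d hd e' he' (ψ x) hxd hx'
      refine ⟨planeMap A c + c', ?_⟩
      filter_upwards [hc, ψ.continuous.continuousAt.eventually hc'] with y h1 h2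
      rw [Homeomorph.mul_apply, h2, h1]
      apply Complex.ext <;>
        simp [planeMap, Matrix.mul_apply, Fin.sum_univ_two] <;> ring
  inv_mem' := by
    rintro φ ⟨A, hA, hA'⟩
    refine ⟨A⁻¹, ?_, fun e he e' he' x hx hx' => ?_⟩
    · conv_lhs => rw [← hA]
      exact φ.symm_image_image _
    · have hx0 : φ (φ.symm x) = x := φ.apply_symm_apply x
      obtain ⟨c, hc⟩ := hA' e' he' e he (φ.symm x) hx' (by rwa [hx0])
      refine ⟨-planeMap (A⁻¹ : GL (Fin 2) ℝ) c, ?_⟩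
      have key := φ.symm.continuous.continuousAt.eventually hc
      filter_upwards [key] with y hy
      rw [φ.apply_symm_apply] at hy
      have hinv : ((A⁻¹ : GL (Fin 2) ℝ) : Matrix (Fin 2) (Fin 2) ℝ) * A = 1 := by
        rw [← Units.val_mul, inv_mul_cancel, Units.val_one]
      have hcomp : ∀ z, planeMap (A⁻¹ : GL (Fin 2) ℝ) (planeMap A z) = z := by
        intro z
        have : planeMap (((A⁻¹ : GL (Fin 2) ℝ) : Matrix (Fin 2) (Fin 2) ℝ) * A) z = z := by
          rw [hinv]; simp [planeMap]
        refine Eq.trans ?_ this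
        apply Complex.ext <;>
          simp only [planeMap, Matrix.mul_apply, Fin.sum_univ_two] <;> ring
      have hadd : ∀ z w, planeMap (A⁻¹ : GL (Fin 2) ℝ) (z + w) =
          planeMap (A⁻¹ : GL (Fin 2) ℝ) z + planeMap (A⁻¹ : GL (Fin 2) ℝ) w := by
        intro z w
        apply Complex.ext <;>
          simp only [planeMap, Complex.add_re, Complex.add_im] <;> ring
      rw [hy, hadd, hcomp, add_neg_cancel_right]
      rfl

/-- The natural map that sends an affine automorphism to its mapping class. -/
def toMappingClass : M.Aff →* MappingClass S :=
  (QuotientGroup.mk' (isotopicToId S)).comp M.Aff.subtype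

end TranslationStructure

end FlatSurf

end

/-!
# Affine multitwists on an infinite staircase

The surface is an infinite staircase of squares `Q n`, `n ∈ ℤ`, with the vertices removed: the
pairs `Q (2k), Q (2k + 1)` form the horizontal cylinders, and the pairs `Q (2k - 1), Q (2k)` the
vertical ones. It is encoded as two copies of a planar staircase region, glued along their open
squares by translations. Infinitely many squares meet at every vertex, so that the vertices are
not points of the surface, and none of the translation structures has singularities. The
multicurves consist of the cores of the horizontal and of the vertical cylinders. A reflection of
the surface exchanges the two families, which leaves only the horizontal one to be studied.

*The topology.* Functions to the circle that wind once when a row (or a column) of squares is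
crossed detect the homotopy classes of the cores (`isMulticurve_core`). Cutting along finitely
many cores leaves the surface connected (`isConnected_compl_cores`), so the genus is infinite; the
complement of a large compact block is connected through the corners of the squares
(`connectedComponentIn_compl_block`), so there is one end.

*The affine representatives.* Let `r + r⁻¹ = l`. Stretch the squares so that `Q n` becomes a
rectangle whose sides are powers of `r`, in such a way that every cylinder has circumference `l`
times its height: the condition is that the heights of the cylinders, as a function `w` on `ℤ`,
satisfy `w (n - 1) + w (n + 1) = l * w n`, which is solved by the powers of `r`. Then the shear
with matrix `(1, l; 0, 1)` is one full turn on every horizontal cylinder, and the conjugate by the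
reflection of its inverse is the shear `(1, 0; -l, 1)` on every vertical cylinder. Their product
has the derivative `(1 - l², l; -l, 1)` (`hasDerivative_affineProduct`), of trace `2 - l²`, which
is parabolic for `l = 2` and hyperbolic for `l > 2`. Both the affine twists and the Dehn
multitwists preserve the horizontal circles, act on them by increasing maps, and turn every
cylinder equally often; a straight line isotopy on the circles therefore joins them
(`mk_twist_eq`), and the product of the multitwists is represented by the affine product for every
`l` (`mk_affineProduct`).

*No power fixes a curve.* For `l = 2` all squares are unit squares, and the affine product
reverses the direction `(1, 1)`. It maps the diagonals of the squares in this direction to each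
other, without periodic ones: it shifts their indices (`affineProduct_diagonal`). The diagonals
cut the surface into two strips, which are contractible. A curve meets only finitely many
diagonals, and a high power of the affine product moves it off all of these. If a power of the
mapping class fixes the curve, then the curve is homotopic, up to a reparametrization, to its
image under such a high power. Contract the two strips along segments to a common point, up to a
time that depends continuously on the point: time zero on the diagonals that the curve meets, and
time one on all others. The two contractions agree on the diagonals at these times. The map
obtained at the end is thus well defined and continuous; it moves the curve by a homotopy, as the
curve avoids the diagonals with time one, and it is homotopic to a constant along the image curve,
which avoids those with time zero. Hence the curve is null-homotopic (`nullhomotopic_of_avoids`,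
`not_fixes`).

*Injectivity.* Let an affine automorphism be isotopic to the identity. Along the image of a
horizontal circle, the logarithm of a row function is periodic, by homotopy invariance, and
monotone, because the image is straight; hence it is constant (`rowFun_image_leaf`). So the
horizontal direction is preserved, and, since the images of the circles cross the same columns as
the circles themselves, every horizontal cylinder is (`rowFun_image_ne_one`). By reflection the
same holds for the vertical ones. The automorphism thus maps every square to itself by an affine
map with increasing coordinates that does not expand; as the same is true of the inverse, it is
the identity on the squares, which are dense (`toMappingClass_injective`).
-/

noncomputable section

namespace FlatSurf

/-! ### The staircase surface -/

namespace Staircase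

/-- The `k`-th open row of the planar staircase, made of two adjacent unit squares. -/
def row (k : ℤ) : Set (ℝ × ℝ) := Ioo (k : ℝ) (k + 2) ×ˢ Ioo (k : ℝ) (k + 1)

/-- The `k`-th open column of the planar staircase, made of two adjacent unit squares. -/
def col (k : ℤ) : Set (ℝ × ℝ) := Ioo (k : ℝ) (k + 1) ×ˢ Ioo (k - 1 : ℝ) (k + 1)

/-- The open planar staircase. -/
def stair : Set (ℝ × ℝ) := ⋃ k, row k ∪ col k

lemma mem_row {k : ℤ} {z : ℝ × ℝ} :
    z ∈ row k ↔ (k < z.1 ∧ z.1 < k + 2) ∧ (k < z.2 ∧ z.2 < k + 1) := by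
  simp [row]

lemma mem_col {k : ℤ} {z : ℝ × ℝ} :
    z ∈ col k ↔ (k < z.1 ∧ z.1 < k + 1) ∧ (k - 1 < z.2 ∧ z.2 < k + 1) := by
  simp [col]

lemma mem_stair {z : ℝ × ℝ} : z ∈ stair ↔ ∃ k, z ∈ row k ∨ z ∈ col k := by
  simp [stair]

lemma row_subset_stair (k : ℤ) : row k ⊆ stair := fun _ h => mem_stair.2 ⟨k, .inl h⟩

lemma col_subset_stair (k : ℤ) : col k ⊆ stair := fun _ h => mem_stair.2 ⟨k, .inr h⟩

lemma isOpen_row (k : ℤ) : IsOpen (row k) := isOpen_Ioo.prod isOpen_Ioo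

lemma isOpen_col (k : ℤ) : IsOpen (col k) := isOpen_Ioo.prod isOpen_Ioo

lemma isOpen_stair : IsOpen stair :=
  isOpen_iUnion fun k => (isOpen_row k).union (isOpen_col k)

lemma int_eq_of_mem_Ioo {k l : ℤ} {y : ℝ} (h1 : k < y) (h2 : y < k + 1) (h3 : l < y)
    (h4 : y < l + 1) : k = l := by
  have a : (k : ℝ) < l + 1 := h1.trans h4
  have b : (l : ℝ) < k + 1 := h3.trans h2
  norm_cast at a b
  omega

lemma not_mem_Ioo_int {k l : ℤ} (h1 : (k : ℝ) < l) (h2 : (l : ℝ) < k + 1) : False := by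
  norm_cast at h1 h2
  omega

lemma row_unique {k l : ℤ} {z : ℝ × ℝ} (h : z ∈ row k) (h' : z ∈ row l) : k = l := by
  rw [mem_row] at h h'
  exact int_eq_of_mem_Ioo h.2.1 h.2.2 h'.2.1 h'.2.2

lemma col_unique {k l : ℤ} {z : ℝ × ℝ} (h : z ∈ col k) (h' : z ∈ col l) : k = l := by
  rw [mem_col] at h h'
  exact int_eq_of_mem_Ioo h.1.1 h.1.2 h'.1.1 h'.1.2

/-- The points `z` and `z'` of two copies of the staircase are identified: they lie in the interior
of unit squares that correspond to each other. The left square of the row `k` is the right square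
of the row `-k` of the other copy, and conversely. -/
def Glued (z z' : ℝ × ℝ) : Prop :=
  ∃ k : ℤ, (z ∈ row k ∩ col k ∧ z' = (z.1 + (1 - 2 * k), z.2 - 2 * k)) ∨
    (z ∈ row k ∩ col (k + 1) ∧ z' = (z.1 - (1 + 2 * k), z.2 - 2 * k))

lemma Glued.symm {z z' : ℝ × ℝ} (h : Glued z z') : Glued z' z := by
  obtain ⟨k, ⟨⟨h1, h2⟩, rfl⟩ | ⟨⟨h1, h2⟩, rfl⟩⟩ := h <;>
  rw [mem_row] at h1 <;> rw [mem_col] at h2 <;> push_cast at h2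
  · refine ⟨-k, .inr ⟨⟨?_, ?_⟩, ?_⟩⟩
    · rw [mem_row]; push_cast
      exact ⟨⟨by linarith, by linarith⟩, by linarith, by linarith⟩
    · rw [mem_col]; push_cast
      exact ⟨⟨by linarith, by linarith⟩, by linarith, by linarith⟩
    · ext <;> push_cast <;> ring
  · refine ⟨-k, .inl ⟨⟨?_, ?_⟩, ?_⟩⟩
    · rw [mem_row]; push_cast
      exact ⟨⟨by linarith, by linarith⟩, by linarith, by linarith⟩
    · rw [mem_col]; push_cast
      exact ⟨⟨by linarith, by linarith⟩, by linarith, by linarith⟩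
    · ext <;> push_cast <;> ring

lemma Glued.unique {z z₁ z₂ : ℝ × ℝ} (h : Glued z z₁) (h' : Glued z z₂) : z₁ = z₂ := by
  obtain ⟨k, ⟨⟨h1, h2⟩, rfl⟩ | ⟨⟨h1, h2⟩, rfl⟩⟩ := h <;>
  obtain ⟨l, ⟨⟨g1, g2⟩, rfl⟩ | ⟨⟨g1, g2⟩, rfl⟩⟩ := h' <;>
  obtain rfl := row_unique h1 g1
  · rfl
  · have := col_unique h2 g2; omega
  · have := col_unique h2 g2; omega
  · rfl

lemma Glued.mem_stair {z z' : ℝ × ℝ} (h : Glued z z') : z ∈ stair := by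
  obtain ⟨k, ⟨⟨h1, h2⟩, rfl⟩ | ⟨⟨h1, h2⟩, rfl⟩⟩ := h <;> exact row_subset_stair _ h1

lemma Glued.mem_stair' {z z' : ℝ × ℝ} (h : Glued z z') : z' ∈ stair := h.symm.mem_stair

/-- The identifications of the two copies of the staircase. -/
def setoid : Setoid (Bool × stair) where
  r p q := (p.1 = q.1 ∧ (p.2 : ℝ × ℝ) = q.2) ∨ (p.1 ≠ q.1 ∧ Glued p.2 q.2)
  iseqv := by
    refine ⟨fun p => .inl ⟨rfl, rfl⟩, ?_, ?_⟩
    · rintro p q (⟨h1, h2⟩ | ⟨h1, h2⟩)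
      · exact .inl ⟨h1.symm, h2.symm⟩
      · exact .inr ⟨h1.symm, h2.symm⟩
    · rintro ⟨b, z⟩ ⟨b', z'⟩ ⟨b'', z''⟩ (⟨h1, h2⟩ | ⟨h1, h2⟩) (⟨h3, h4⟩ | ⟨h3, h4⟩) <;>
      simp only at h1 h2 h3 h4 ⊢
      · exact .inl ⟨h1.trans h3, h2.trans h4⟩
      · rw [h1, h2]; exact .inr ⟨h3, h4⟩
      · rw [← h3, ← h4]; exact .inr ⟨h1, h2⟩
      · refine .inl ⟨?_, h2.symm.unique h4⟩
        revert h1 h3; cases b <;> cases b' <;> cases b'' <;> simp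

/-- The staircase surface: two copies of the planar staircase, glued along the interiors of their
unit squares. -/
def Surface : Type := Quotient setoid

instance : TopologicalSpace Surface := inferInstanceAs (TopologicalSpace (Quotient setoid))

/-- The projection of the two copies of the staircase to the surface. -/
def toSurface : Bool × stair → Surface := Quotient.mk setoid

lemma toSurface_eq_iff {p q : Bool × stair} : toSurface p = toSurface q ↔
    (p.1 = q.1 ∧ (p.2 : ℝ × ℝ) = q.2) ∨ (p.1 ≠ q.1 ∧ Glued p.2 q.2) := Quotient.eq

lemma half_mem_stair : ((1 / 2, 1 / 2) : ℝ × ℝ) ∈ stair :=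
  row_subset_stair 0 (by rw [mem_row]; norm_num)

open Classical in
/-- The point of the surface with coordinates `z` in the copy `b` of the planar staircase (a
junk point when `z` is not in the staircase). -/
def pt (b : Bool) (z : ℝ × ℝ) : Surface :=
  toSurface (b, if h : z ∈ stair then ⟨z, h⟩ else ⟨(1 / 2, 1 / 2), half_mem_stair⟩)

lemma pt_coe (b : Bool) (z : stair) : pt b z = toSurface (b, z) := by
  simp [pt]

lemma pt_eq_iff {b b' : Bool} {z z' : ℝ × ℝ} (hz : z ∈ stair) (hz' : z' ∈ stair) :
    pt b z = pt b' z' ↔ (b = b' ∧ z = z') ∨ (b ≠ b' ∧ Glued z z') := by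
  lift z to stair using hz
  lift z' to stair using hz'
  rw [pt_coe, pt_coe, toSurface_eq_iff]

lemma Glued.pt_eq {z z' : ℝ × ℝ} (h : Glued z z') (b : Bool) : pt b z = pt (!b) z' :=
  (pt_eq_iff h.mem_stair h.mem_stair').2 (.inr ⟨by cases b <;> simp, h⟩)

lemma pt_left {b : Bool} {k : ℤ} {z : ℝ × ℝ} (h : z ∈ row k ∩ col k) :
    pt b z = pt (!b) (z.1 + (1 - 2 * k), z.2 - 2 * k) :=
  Glued.pt_eq ⟨k, .inl ⟨h, rfl⟩⟩ b

lemma pt_right {b : Bool} {k : ℤ} {z : ℝ × ℝ} (h : z ∈ row k ∩ col (k + 1)) :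
    pt b z = pt (!b) (z.1 - (1 + 2 * k), z.2 - 2 * k) :=
  Glued.pt_eq ⟨k, .inr ⟨h, rfl⟩⟩ b

lemma pt_injOn (b : Bool) : InjOn (pt b) stair := by
  intro z hz z' hz' h
  rw [pt_eq_iff hz hz'] at h
  simpa using h

lemma exists_pt (p : Surface) : ∃ b, ∃ z ∈ stair, p = pt b z := by
  induction p using Quotient.inductionOn with
  | h q => exact ⟨q.1, q.2, q.2.2, (pt_coe _ _).symm⟩

lemma continuous_toSurface : Continuous toSurface :=
  continuous_quotient_mk'

lemma continuousOn_pt (b : Bool) : ContinuousOn (pt b) stair := by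
  rw [continuousOn_iff_continuous_domRestrict]
  have : stair.domRestrict (pt b) = fun z => toSurface (b, z) :=
    funext fun z => pt_coe b z
  rw [this]
  exact continuous_toSurface.comp (by fun_prop)

/-- The gluing map is a translation on every square, hence open. -/
lemma isOpen_glued_image {U : Set (ℝ × ℝ)} (hU : IsOpen U) :
    IsOpen {z' | ∃ z ∈ U, Glued z z'} := by
  have : {z' | ∃ z ∈ U, Glued z z'} = ⋃ k : ℤ,
      ((row k ∩ col k) ∩ (fun z : ℝ × ℝ => (z.1 + (1 - 2 * k), z.2 - 2 * k)) ⁻¹' U) ∪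
      ((row k ∩ col (k + 1)) ∩ (fun z : ℝ × ℝ => (z.1 - (1 + 2 * k), z.2 - 2 * k)) ⁻¹' U) := by
    ext z'
    simp only [mem_ofPred_eq, mem_iUnion, mem_union, mem_inter_iff, mem_preimage]
    constructor
    · rintro ⟨z, hz, h⟩
      obtain ⟨k, ⟨h1, rfl⟩ | ⟨h1, rfl⟩⟩ := h.symm
      · exact ⟨k, .inl ⟨h1, hz⟩⟩
      · exact ⟨k, .inr ⟨h1, hz⟩⟩
    · rintro ⟨k, ⟨h1, h2⟩ | ⟨h1, h2⟩⟩
      · exact ⟨_, h2, Glued.symm ⟨k, .inl ⟨h1, rfl⟩⟩⟩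
      · exact ⟨_, h2, Glued.symm ⟨k, .inr ⟨h1, rfl⟩⟩⟩
  rw [this]
  refine isOpen_iUnion fun k => .union ?_ ?_
  · exact ((isOpen_row k).inter (isOpen_col k)).inter (hU.preimage (by fun_prop))
  · exact ((isOpen_row k).inter (isOpen_col (k + 1))).inter (hU.preimage (by fun_prop))

lemma isOpen_image_pt (b : Bool) {U : Set (ℝ × ℝ)} (hU : IsOpen U) (hs : U ⊆ stair) :
    IsOpen (pt b '' U) := by
  change IsOpen (toSurface ⁻¹' (pt b '' U))
  have : toSurface ⁻¹' (pt b '' U) =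
      ({b} ×ˢ (Subtype.val ⁻¹' U)) ∪
        ({!b} ×ˢ (Subtype.val ⁻¹' {z' | ∃ z ∈ U, Glued z z'})) := by
    ext ⟨c, z⟩
    simp only [mem_preimage, ← pt_coe, mem_image, mem_union, mem_prod, mem_singleton_iff,
      mem_ofPred_eq]
    constructor
    · rintro ⟨w, hw, h⟩
      rw [pt_eq_iff (hs hw) z.2] at h
      obtain ⟨rfl, rfl⟩ | ⟨h1, h2⟩ := h
      · exact .inl ⟨rfl, hw⟩
      · exact .inr ⟨by revert h1; cases b <;> cases c <;> simp, w, hw, h2⟩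
    · rintro (⟨rfl, h⟩ | ⟨rfl, w, hw, h⟩)
      · exact ⟨z, h, rfl⟩
      · exact ⟨w, hw, h.pt_eq b⟩
  rw [this]
  exact ((isOpen_discrete _).prod (hU.preimage continuous_subtype_val)).union
    ((isOpen_discrete _).prod ((isOpen_glued_image hU).preimage continuous_subtype_val))

/-- Neighbourhoods in the surface are planar neighbourhoods. -/
lemma nhds_pt (b : Bool) {z : ℝ × ℝ} (hz : z ∈ stair) : 𝓝 (pt b z) = map (pt b) (𝓝 z) := by
  apply le_antisymm
  · intro s hs
    obtain ⟨U, hU, hUo, hzU⟩ := mem_nhds_iff.1 (inter_mem hs (isOpen_stair.mem_nhds hz))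
    refine mem_of_superset ((isOpen_image_pt b hUo fun w hw => (hU hw).2).mem_nhds ⟨z, hzU, rfl⟩) ?_
    rintro _ ⟨w, hw, rfl⟩
    exact (hU hw).1
  · exact (continuousOn_pt b).continuousAt (isOpen_stair.mem_nhds hz)

lemma continuousAt_pt_iff {Y : Type*} [TopologicalSpace Y] {F : Surface → Y} {b : Bool}
    {z : ℝ × ℝ} (hz : z ∈ stair) :
    ContinuousAt F (pt b z) ↔ ContinuousAt (fun w => F (pt b w)) z := by
  rw [ContinuousAt, nhds_pt b hz, tendsto_map'_iff]; rfl

lemma nhds_prod_pt {Y : Type*} [TopologicalSpace Y] (y : Y) (b : Bool) {z : ℝ × ℝ}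
    (hz : z ∈ stair) :
    𝓝 (y, pt b z) = map (fun q : Y × (ℝ × ℝ) => (q.1, pt b q.2)) (𝓝 (y, z)) := by
  rw [nhds_prod_eq, nhds_pt b hz, nhds_prod_eq (x := y)]
  conv_lhs => rw [← Filter.map_id (f := 𝓝 y)]
  rw [Filter.prod_map_map_eq']
  rfl

lemma eventually_stair {z : ℝ × ℝ} (hz : z ∈ stair) : ∀ᶠ w in 𝓝 z, w ∈ stair :=
  isOpen_stair.mem_nhds hz

/-- A function that is given on both copies of the staircase, and respects the gluing, is
continuous if it is so on both copies. -/
lemma continuous_of_pt {Y : Type*} [TopologicalSpace Y] {F : Surface → Y}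
    (h : ∀ b, ContinuousOn (fun w => F (pt b w)) stair) : Continuous F := by
  rw [continuous_iff_continuousAt]
  intro p
  obtain ⟨b, z, hz, rfl⟩ := exists_pt p
  exact (continuousAt_pt_iff hz).2 ((h b).continuousAt (isOpen_stair.mem_nhds hz))

/-- Define a function on the surface from a function on the two copies of the staircase. -/
lemma exists_lift {Y : Type*} (G : Bool → ℝ × ℝ → Y)
    (hG : ∀ b z z', Glued z z' → G b z = G (!b) z') :
    ∃ F : Surface → Y, ∀ b, ∀ z ∈ stair, F (pt b z) = G b z := by
  refine ⟨Quotient.lift (fun q => G q.1 q.2) ?_, fun b z hz => ?_⟩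
  · rintro ⟨b, z⟩ ⟨b', z'⟩ (⟨h1, h2⟩ | ⟨h1, h2⟩)
    · simp only at h1 h2
      simp [h1, h2]
    · simp only at h1 h2 ⊢
      rw [hG b _ _ h2]
      congr 1
      revert h1; cases b <;> cases b' <;> simp
  · lift z to stair using hz
    rw [pt_coe]
    rfl

lemma isOpen_range_pt (b : Bool) : IsOpen (pt b '' stair) :=
  isOpen_image_pt b isOpen_stair Subset.rfl

/-- The copy `b` of the planar staircase, as an open subset of the surface. -/
def planar (b : Bool) : OpenPartialHomeomorph (ℝ × ℝ) Surface :=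
  OpenPartialHomeomorph.ofContinuousOpenRestrict ((pt_injOn b).toPartialEquiv _ _)
    (continuousOn_pt b)
    (by
      intro U hU
      have : (stair.domRestrict (pt b)) '' U = pt b '' (Subtype.val '' U) := by
        rw [image_image]; rfl
      change IsOpen ((stair.domRestrict (pt b)) '' U)
      rw [this]
      refine isOpen_image_pt b ?_ ?_
      · exact isOpen_stair.isOpenMap_subtype_val _ hU
      · rintro _ ⟨w, -, rfl⟩; exact w.2) isOpen_stair

lemma planar_target (b : Bool) : (planar b).target = pt b '' stair := rfl

lemma planar_symm_pt (b : Bool) {z : ℝ × ℝ} (hz : z ∈ stair) : (planar b).symm (pt b z) = z :=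
  (planar b).left_inv hz

/-! ### Topology of the staircase surface -/

lemma isPreconnected_row (k : ℤ) : IsPreconnected (row k) :=
  isPreconnected_Ioo.prod isPreconnected_Ioo

lemma isPreconnected_col (k : ℤ) : IsPreconnected (col k) :=
  isPreconnected_Ioo.prod isPreconnected_Ioo

lemma isPreconnected_stair : IsPreconnected stair := by
  refine IsPreconnected.iUnion_of_chain (fun k => ?_) fun k => ?_
  · refine IsPreconnected.union ((k + 1 / 2, k + 1 / 2) : ℝ × ℝ) ?_ ?_ (isPreconnected_row k)
      (isPreconnected_col k)
    · rw [mem_row]; constructor <;> constructor <;> linarith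
    · rw [mem_col]; constructor <;> constructor <;> linarith
  · refine ⟨(k + 3 / 2, k + 1 / 2), .inl ?_, .inr ?_⟩
    · rw [mem_row]; constructor <;> constructor <;> linarith
    · rw [mem_col, Order.succ_eq_add_one]; push_cast
      constructor <;> constructor <;> linarith

lemma half_mem_square : ((1 / 2, 1 / 2) : ℝ × ℝ) ∈ row 0 ∩ col 0 :=
  ⟨by rw [mem_row]; norm_num, by rw [mem_col]; norm_num⟩

instance : ConnectedSpace Surface where
  toNonempty := ⟨pt false (1 / 2, 1 / 2)⟩
  isPreconnected_univ := by
    have h : (univ : Set Surface) = pt false '' stair ∪ pt true '' stair := by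
      refine (eq_univ_of_forall fun p => ?_).symm
      obtain ⟨b, z, hz, rfl⟩ := exists_pt p
      cases b
      · exact .inl ⟨z, hz, rfl⟩
      · exact .inr ⟨z, hz, rfl⟩
    rw [h]
    refine IsPreconnected.union (pt false (1 / 2, 1 / 2)) ⟨_, half_mem_stair, rfl⟩ ?_
      (isPreconnected_stair.image _ (continuousOn_pt _))
      (isPreconnected_stair.image _ (continuousOn_pt _))
    have := pt_left (b := false) half_mem_square
    rw [this]
    exact ⟨_, Glued.mem_stair' ⟨0, .inl ⟨half_mem_square, rfl⟩⟩, rfl⟩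

instance : SecondCountableTopology Surface := by
  refine IsQuotientMap.secondCountableTopology (π := toSurface) isQuotientMap_quotient_mk' ?_
  intro U hU
  have : toSurface '' U =
      ⋃ b, pt b '' (Subtype.val '' {z : stair | (b, z) ∈ U}) := by
    ext p
    simp only [mem_image, mem_iUnion]
    constructor
    · rintro ⟨⟨b, z⟩, h, rfl⟩
      exact ⟨b, z, ⟨z, h, rfl⟩, pt_coe b z⟩
    · rintro ⟨b, _, ⟨z, h, rfl⟩, rfl⟩
      exact ⟨(b, z), h, (pt_coe b z).symm⟩
  rw [this]
  refine isOpen_iUnion fun b => isOpen_image_pt b ?_ ?_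
  · exact isOpen_stair.isOpenMap_subtype_val _ (hU.preimage (by fun_prop))
  · rintro _ ⟨w, -, rfl⟩; exact w.2

/-- The sign that distinguishes the two copies of the staircase. -/
def sign (b : Bool) : ℝ := if b then -1 else 1

lemma sign_not (b : Bool) : sign (!b) = -sign b := by cases b <;> simp [sign]

/-- The points of the staircase: those in the left or right square of a row, and those in the open
vertical or horizontal edges between adjacent squares. -/
lemma stair_cases {z : ℝ × ℝ} (hz : z ∈ stair) :
    (∃ k, z ∈ row k ∩ col k) ∨ (∃ k, z ∈ row k ∩ col (k + 1)) ∨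
    (∃ k : ℤ, z.1 = k + 1 ∧ k < z.2 ∧ z.2 < k + 1) ∨
    ∃ k : ℤ, z.2 = k ∧ k < z.1 ∧ z.1 < k + 1 := by
  obtain ⟨k, h | h⟩ := mem_stair.1 hz
  · have h' := mem_row.1 h
    rcases lt_trichotomy z.1 (k + 1) with h1 | h1 | h1
    · exact .inl ⟨k, h, mem_col.2 ⟨⟨h'.1.1, h1⟩, by linarith, by linarith⟩⟩
    · exact .inr (.inr (.inl ⟨k, h1, h'.2⟩))
    · refine .inr (.inl ⟨k, h, mem_col.2 ?_⟩)
      push_cast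
      exact ⟨⟨h1, by linarith⟩, by linarith, by linarith⟩
  · have h' := mem_col.1 h
    rcases lt_trichotomy z.2 k with h1 | h1 | h1
    · refine .inr (.inl ⟨k - 1, mem_row.2 ?_, by simpa using h⟩)
      push_cast
      exact ⟨⟨by linarith, by linarith⟩, by linarith, by linarith⟩
    · exact .inr (.inr (.inr ⟨k, h1, h'.1⟩))
    · exact .inl ⟨k, mem_row.2 ⟨⟨h'.1.1, by linarith⟩, by linarith, by linarith⟩, h⟩

lemma exists_int_of_exp_eq_neg {s t : ℝ}
    (h : Complex.exp (Real.pi * s * Complex.I) = -Complex.exp (Real.pi * t * Complex.I)) :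
    ∃ n : ℤ, s = t + (2 * n + 1) := by
  have h2 : -Complex.exp (Real.pi * t * Complex.I) =
      Complex.exp (Real.pi * t * Complex.I + Real.pi * Complex.I) := by
    rw [Complex.exp_add, Complex.exp_pi_mul_I]; ring
  rw [h2, Complex.exp_eq_exp_iff_exists_int] at h
  obtain ⟨n, hn⟩ := h
  refine ⟨n, ?_⟩
  have := congrArg Complex.im hn
  simp at this
  have hpi := Real.pi_pos
  have h3 : Real.pi * (s - t - (2 * n + 1)) = 0 := by linarith
  rcases mul_eq_zero.1 h3 with h4 | h4 <;> linarith

lemma exp_sub_odd (s : ℝ) {t : ℝ} (n : ℤ) (ht : t = s + (2 * n + 1)) :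
    Complex.exp (Real.pi * t * Complex.I) = -Complex.exp (Real.pi * s * Complex.I) := by
  have : (Real.pi * t * Complex.I : ℂ) =
      (Real.pi * s * Complex.I + Real.pi * Complex.I) + n * (2 * Real.pi * Complex.I) := by
    rw [ht]; push_cast; ring
  rw [this, Complex.exp_add, Complex.exp_add, Complex.exp_pi_mul_I,
    Complex.exp_int_mul_two_pi_mul_I]
  ring

/-- The staircase surface covers the torus `ℝ² / {(a, b) ∈ ℤ² : a + b even}`; the pullbacks to the
surface of two functions that separate the points of this torus. -/
lemma exists_torus_coordinates : ∃ F : Surface → ℂ × ℂ, Continuous F ∧ ∀ b, ∀ z ∈ stair,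
    F (pt b z) = (sign b * Complex.exp (Real.pi * (z.1 + z.2 : ℝ) * Complex.I),
      sign b * Complex.exp (Real.pi * (z.1 - z.2 : ℝ) * Complex.I)) := by
  obtain ⟨F, hF⟩ := exists_lift (fun b z =>
    ((sign b * Complex.exp (Real.pi * (z.1 + z.2 : ℝ) * Complex.I),
      sign b * Complex.exp (Real.pi * (z.1 - z.2 : ℝ) * Complex.I)) : ℂ × ℂ)) (by
    rintro b z z' ⟨k, ⟨-, rfl⟩ | ⟨-, rfl⟩⟩
    · have h1 := exp_sub_odd (z.1 + z.2) (t := (z.1 + (1 - 2 * k)) + (z.2 - 2 * k)) (-2 * k)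
        (by push_cast; ring)
      have h2 := exp_sub_odd (z.1 - z.2) (t := (z.1 + (1 - 2 * k)) - (z.2 - 2 * k)) 0
        (by push_cast; ring)
      simp only [h1, h2, sign_not, Complex.ofReal_neg, neg_mul_neg]
    · have h1 := exp_sub_odd (z.1 + z.2) (t := (z.1 - (1 + 2 * k)) + (z.2 - 2 * k)) (-2 * k - 1)
        (by push_cast; ring)
      have h2 := exp_sub_odd (z.1 - z.2) (t := (z.1 - (1 + 2 * k)) - (z.2 - 2 * k)) (-1)
        (by push_cast; ring)
      simp only [h1, h2, sign_not, Complex.ofReal_neg, neg_mul_neg])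
  refine ⟨F, continuous_of_pt fun b => ?_, hF⟩
  refine ContinuousOn.congr ?_ fun z hz => hF b z hz
  fun_prop

instance : T2Space Surface where
  t2 := by
    -- two points in the same copy of the staircase are separated there
    have same : ∀ b, ∀ z ∈ stair, ∀ z' ∈ stair, pt b z ≠ pt b z' → ∃ u v : Set Surface,
        IsOpen u ∧ IsOpen v ∧ pt b z ∈ u ∧ pt b z' ∈ v ∧ Disjoint u v := by
      intro b z hz z' hz' hne
      obtain ⟨u, v, hu, hv, hzu, hzv, huv⟩ := t2_separation fun h : z = z' => hne (h ▸ rfl)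
      refine ⟨_, _, isOpen_image_pt b (hu.inter isOpen_stair) inter_subset_right,
        isOpen_image_pt b (hv.inter isOpen_stair) inter_subset_right, ⟨z, ⟨hzu, hz⟩, rfl⟩,
        ⟨z', ⟨hzv, hz'⟩, rfl⟩, ?_⟩
      rw [Set.disjoint_left]
      rintro _ ⟨w, hw, rfl⟩ ⟨w', hw', h⟩
      obtain rfl := pt_injOn b hw'.2 hw.2 h
      exact Set.disjoint_left.1 huv hw.1 hw'.1
    have square : ∀ b, ∀ z, ((∃ k, z ∈ row k ∩ col k) ∨ ∃ k, z ∈ row k ∩ col (k + 1)) →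
        ∃ w ∈ stair, pt b z = pt (!b) w := by
      rintro b z (⟨k, h⟩ | ⟨k, h⟩)
      · exact ⟨_, Glued.mem_stair' ⟨k, .inl ⟨h, rfl⟩⟩, pt_left h⟩
      · exact ⟨_, Glued.mem_stair' ⟨k, .inr ⟨h, rfl⟩⟩, pt_right h⟩
    intro p q hpq
    obtain ⟨b, z, hz, rfl⟩ := exists_pt p
    obtain ⟨b', z', hz', rfl⟩ := exists_pt q
    by_cases hb : b = b'
    · subst hb; exact same b z hz z' hz' hpq
    obtain rfl : b' = !b := by revert hb; cases b <;> cases b' <;> simp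
    by_cases hsq : (∃ k, z ∈ row k ∩ col k) ∨ ∃ k, z ∈ row k ∩ col (k + 1)
    · obtain ⟨w, hw, h⟩ := square b z hsq
      rw [h] at hpq ⊢
      exact same _ w hw z' hz' hpq
    by_cases hsq' : (∃ k, z' ∈ row k ∩ col k) ∨ ∃ k, z' ∈ row k ∩ col (k + 1)
    · obtain ⟨w, hw, h⟩ := square (!b) z' hsq'
      rw [Bool.not_not] at h
      rw [h] at hpq ⊢
      exact same _ z hz w hw hpq
    obtain ⟨F, hF, hF'⟩ := exists_torus_coordinates
    refine separated_by_continuous hF fun h => ?_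
    rw [hF' b z hz, hF' _ z' hz', sign_not, Prod.mk.injEq] at h
    have hs : (sign b : ℂ) ≠ 0 := by cases b <;> simp [sign]
    obtain ⟨h1, h2⟩ := h
    rw [Complex.ofReal_neg, neg_mul_comm, mul_right_inj' hs] at h1 h2
    obtain ⟨n, hn⟩ := exists_int_of_exp_eq_neg h1
    obtain ⟨m, hm⟩ := exists_int_of_exp_eq_neg h2
    have hy : z.2 = z'.2 + (n - m : ℤ) := by push_cast; linarith
    have hx : z.1 = z'.1 + (n + m + 1 : ℤ) := by push_cast; linarith
    rw [not_or] at hsq hsq'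
    obtain ⟨k, e1, e2, e3⟩ | ⟨k, e1, e2, e3⟩ :=
      ((stair_cases hz).resolve_left hsq.1).resolve_left hsq.2 <;>
    obtain ⟨l, g1, g2, g3⟩ | ⟨l, g1, g2, g3⟩ :=
      ((stair_cases hz').resolve_left hsq'.1).resolve_left hsq'.2
    · have hk : k = l + (n - m) := int_eq_of_mem_Ioo (y := z.2) e2 e3
        (by rw [hy]; push_cast; linarith) (by rw [hy]; push_cast; linarith)
      have : (k : ℝ) + 1 = l + 1 + (n + m + 1 : ℤ) := by rw [← e1, hx, g1]
      norm_cast at this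
      omega
    · rw [hy, g1] at e2 e3
      exact not_mem_Ioo_int (k := k) (l := l + (n - m)) (by exact_mod_cast e2)
        (by exact_mod_cast e3)
    · have : z'.2 = (k - (n - m) : ℤ) := by push_cast at hy ⊢; linarith
      rw [this] at g2 g3
      exact not_mem_Ioo_int g2 g3
    · have hk : k = l + (n + m + 1) := int_eq_of_mem_Ioo (y := z.1) e2 e3
        (by rw [hx]; push_cast; linarith) (by rw [hx]; push_cast; linarith)
      have : (k : ℝ) = l + (n - m : ℤ) := by rw [← e1, hy, g1]
      norm_cast at this
      omega

/-! ### Horizontal cylinders -/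

/-- The row `k` of the copy `b` closes up to an annulus; this is its parametrization, of period `2`
in the first coordinate, with second coordinate in `(0, 1)`. -/
def cyl (b : Bool) (k : ℤ) (w : ℝ × ℝ) : Surface :=
  if w.1 = 2 * ⌊w.1 / 2⌋ then pt (!b) (-k + 1, -k + w.2)
  else pt b (k + (w.1 - 2 * ⌊w.1 / 2⌋), k + w.2)

lemma mem_row_add {k : ℤ} {x y : ℝ} :
    (k + x, k + y) ∈ row k ↔ (0 < x ∧ x < 2) ∧ 0 < y ∧ y < 1 := by
  simp [mem_row]

lemma cyl_eq (b : Bool) (k m : ℤ) {x y : ℝ} (h1 : 2 * m < x) (h2 : x < 2 * m + 2) :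
    cyl b k (x, y) = pt b (k + (x - 2 * m), k + y) := by
  have : ⌊x / 2⌋ = m := Int.floor_eq_iff.2 ⟨by linarith, by linarith⟩
  simp only [cyl, this]
  rw [if_neg h1.ne']

lemma cyl_eq' (b : Bool) (k m : ℤ) {x y : ℝ} (h1 : 2 * m + 1 < x) (h2 : x < 2 * m + 3)
    (h0 : 0 < y) (h3 : y < 1) :
    cyl b k (x, y) = pt (!b) (-k + (x - 1 - 2 * m), -k + y) := by
  rcases lt_trichotomy x (2 * m + 2) with h | h | h
  · rw [cyl_eq b k m (by linarith) h, pt_right (k := k)]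
    · congr 2 <;> ring
    · refine ⟨?_, ?_⟩
      · simp only [mem_row]
        exact ⟨⟨by linarith, by linarith⟩, by linarith, by linarith⟩
      · simp only [mem_col]; push_cast
        exact ⟨⟨by linarith, by linarith⟩, by linarith, by linarith⟩
  · have hf : ⌊x / 2⌋ = m + 1 := Int.floor_eq_iff.2 ⟨by push_cast; linarith, by push_cast; linarith⟩
    simp only [cyl, hf]
    rw [if_pos (by push_cast; linarith)]
    congr 2
    linarith
  · rw [cyl_eq b k (m + 1) (by push_cast; linarith) (by push_cast; linarith), pt_left (k := k)]
    · congr 2 <;> push_cast <;> ring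
    · refine ⟨?_, ?_⟩
      · simp only [mem_row]; push_cast
        exact ⟨⟨by linarith, by linarith⟩, by linarith, by linarith⟩
      · simp only [mem_col]; push_cast
        exact ⟨⟨by linarith, by linarith⟩, by linarith, by linarith⟩

/-- Every real lies in one of the open intervals on which `cyl` is given by a single formula. -/
lemma exists_int_Ioo (x : ℝ) :
    (∃ m : ℤ, 2 * m < x ∧ x < 2 * m + 2) ∨ ∃ m : ℤ, 2 * m + 1 < x ∧ x < 2 * m + 3 := by
  have h1 := Int.floor_le (x / 2)
  have h2 := Int.lt_floor_add_one (x / 2)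
  rcases h1.lt_or_eq with h | h
  · exact .inl ⟨⌊x / 2⌋, by linarith, by linarith⟩
  · exact .inr ⟨⌊x / 2⌋ - 1, by push_cast; linarith, by push_cast; linarith⟩

lemma cyl_add_int (b : Bool) (k m : ℤ) (x y : ℝ) : cyl b k (x + 2 * m, y) = cyl b k (x, y) := by
  have : ⌊(x + 2 * m) / 2⌋ = ⌊x / 2⌋ + m := by
    rw [← Int.floor_add_intCast]; congr 1; ring
  simp only [cyl, this]
  push_cast
  congr 1
  · rw [eq_iff_iff]; constructor <;> intro h <;> linarith
  · congr 2; ring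

lemma cyl_not (b : Bool) (k : ℤ) {x y : ℝ} (h0 : 0 < y) (h3 : y < 1) :
    cyl (!b) (-k) (x, y) = cyl b k (x + 1, y) := by
  rcases exists_int_Ioo x with ⟨m, h1, h2⟩ | ⟨m, h1, h2⟩
  · rw [cyl_eq _ _ m h1 h2, cyl_eq' b k m (by linarith) (by linarith) h0 h3]
    congr 2 <;> push_cast <;> ring
  · rw [cyl_eq' _ _ m h1 h2 h0 h3, cyl_eq b k (m + 1) (by push_cast; linarith)
      (by push_cast; linarith), Bool.not_not]
    congr 2 <;> push_cast <;> ring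

lemma pt_eq_cyl (b : Bool) {k : ℤ} {z : ℝ × ℝ} (h : z ∈ row k) :
    pt b z = cyl b k (z.1 - k, z.2 - k) := by
  rw [mem_row] at h
  rw [cyl_eq b k 0 (by push_cast; linarith) (by push_cast; linarith)]
  congr 1
  ext <;> push_cast <;> ring

/-- The points on the open horizontal edges of the squares. -/
def IsEdge (p : Surface) : Prop :=
  ∃ b, ∃ j : ℤ, ∃ x : ℝ, j < x ∧ x < j + 1 ∧ p = pt b (x, j)

lemma edge_mem_stair {j : ℤ} {x : ℝ} (h1 : j < x) (h2 : x < j + 1) : (x, (j : ℝ)) ∈ stair :=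
  col_subset_stair j (mem_col.2 ⟨⟨h1, h2⟩, by simp, by simp⟩)

lemma pt_cases {z : ℝ × ℝ} (hz : z ∈ stair) :
    (∃ k, z ∈ row k) ∨ ∃ j : ℤ, z.2 = j ∧ j < z.1 ∧ z.1 < j + 1 := by
  rcases stair_cases hz with ⟨k, h⟩ | ⟨k, h⟩ | ⟨k, h1, h2⟩ | h
  · exact .inl ⟨k, h.1⟩
  · exact .inl ⟨k, h.1⟩
  · exact .inl ⟨k, mem_row.2 ⟨⟨by linarith, by linarith⟩, h2⟩⟩
  · exact .inr h

lemma cyl_or_edge (p : Surface) :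
    (∃ k : ℤ, ∃ x y : ℝ, 0 < y ∧ y < 1 ∧ p = cyl false k (x, y)) ∨ IsEdge p := by
  obtain ⟨b, z, hz, rfl⟩ := exists_pt p
  rcases pt_cases hz with ⟨k, h⟩ | ⟨j, h1, h2, h3⟩
  · left
    have h' := mem_row.1 h
    have e := pt_eq_cyl b h
    cases b
    · exact ⟨k, _, _, by linarith, by linarith, e⟩
    · have := cyl_not false (-k) (x := z.1 - k) (y := z.2 - k) (by linarith) (by linarith)
      rw [neg_neg] at this
      exact ⟨-k, _, _, by linarith, by linarith, e.trans this⟩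
  · refine .inr ⟨b, j, z.1, h2, h3, ?_⟩
    rw [← h1]

lemma cyl_image_mem (b : Bool) (k : ℤ) {x y : ℝ} (h0 : 0 < y) (h3 : y < 1) :
    (∃ z ∈ row k, cyl b k (x, y) = pt b z) ∨ ∃ z ∈ row (-k), cyl b k (x, y) = pt (!b) z := by
  rcases exists_int_Ioo x with ⟨m, h1, h2⟩ | ⟨m, h1, h2⟩
  · refine .inl ⟨_, ?_, cyl_eq b k m h1 h2⟩
    simp only [mem_row]
    exact ⟨⟨by linarith, by linarith⟩, by linarith, by linarith⟩
  · refine .inr ⟨_, ?_, cyl_eq' b k m h1 h2 h0 h3⟩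
    simp only [mem_row]; push_cast
    exact ⟨⟨by linarith, by linarith⟩, by linarith, by linarith⟩

lemma not_isEdge_of_row (b : Bool) {k : ℤ} {z : ℝ × ℝ} (h : z ∈ row k) : ¬ IsEdge (pt b z) := by
  rintro ⟨c, j, x, h1, h2, h3⟩
  have key : ∀ {l : ℤ} {u : ℝ × ℝ}, u ∈ row l → u ≠ (x, (j : ℝ)) := by
    rintro l u hu rfl
    have := (mem_row.1 hu).2
    exact not_mem_Ioo_int this.1 this.2
  rw [pt_eq_iff (row_subset_stair k h) (edge_mem_stair h1 h2)] at h3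
  rcases h3 with ⟨-, h3⟩ | ⟨-, h3⟩
  · exact key h h3
  · obtain ⟨l, ⟨⟨g, -⟩, -⟩ | ⟨⟨g, -⟩, -⟩⟩ := h3.symm <;> exact key g rfl

lemma not_isEdge_cyl (b : Bool) (k : ℤ) {x y : ℝ} (h0 : 0 < y) (h3 : y < 1) :
    ¬ IsEdge (cyl b k (x, y)) := by
  rcases cyl_image_mem b k (x := x) h0 h3 with ⟨z, hz, h⟩ | ⟨z, hz, h⟩ <;> rw [h] <;>
    exact not_isEdge_of_row _ hz

lemma continuousAt_cyl (b : Bool) (k : ℤ) {x y : ℝ} (h0 : 0 < y) (h3 : y < 1) :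
    ContinuousAt (cyl b k) (x, y) := by
  rcases exists_int_Ioo x with ⟨m, h1, h2⟩ | ⟨m, h1, h2⟩
  · have e : cyl b k =ᶠ[𝓝 (x, y)] fun w => pt b (k + (w.1 - 2 * m), k + w.2) := by
      filter_upwards [(isOpen_Ioo.prod isOpen_univ).mem_nhds
        (show (x, y) ∈ Ioo (2 * m : ℝ) (2 * m + 2) ×ˢ univ from ⟨⟨h1, h2⟩, trivial⟩)] with w hw
      exact cyl_eq b k m hw.1.1 hw.1.2
    rw [continuousAt_congr e]
    refine ContinuousAt.comp (g := pt b)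
      ((continuousOn_pt b).continuousAt (isOpen_stair.mem_nhds ?_))
      (by fun_prop)
    exact row_subset_stair k (mem_row_add.2 ⟨⟨by linarith, by linarith⟩, h0, h3⟩)
  · have e : cyl b k =ᶠ[𝓝 (x, y)] fun w => pt (!b) (-k + (w.1 - 1 - 2 * m), -k + w.2) := by
      filter_upwards [(isOpen_Ioo.prod isOpen_Ioo).mem_nhds
        (show (x, y) ∈ Ioo (2 * m + 1 : ℝ) (2 * m + 3) ×ˢ Ioo (0 : ℝ) 1 from
          ⟨⟨h1, h2⟩, h0, h3⟩)] with w hw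
      exact cyl_eq' b k m hw.1.1 hw.1.2 hw.2.1 hw.2.2
    rw [continuousAt_congr e]
    refine ContinuousAt.comp (g := pt !b)
      ((continuousOn_pt _).continuousAt (isOpen_stair.mem_nhds ?_)) (by fun_prop)
    have := (mem_row_add (k := -k) (x := x - 1 - 2 * m) (y := y)).2
      ⟨⟨by linarith, by linarith⟩, h0, h3⟩
    push_cast at this
    exact row_subset_stair _ this

/-- The parametrization of a cylinder is a local homeomorphism. -/
lemma nhds_cyl (b : Bool) (k : ℤ) {x y : ℝ} (h0 : 0 < y) (h3 : y < 1) :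
    𝓝 (cyl b k (x, y)) = map (cyl b k) (𝓝 (x, y)) := by
  refine le_antisymm ?_ (continuousAt_cyl b k h0 h3)
  have tr : ∀ c d : ℝ, map (fun w : ℝ × ℝ => (w.1 + c, w.2 + d)) (𝓝 (x, y)) =
      𝓝 (x + c, y + d) := fun c d =>
    ((Homeomorph.addRight c).prodCongr (Homeomorph.addRight d)).map_nhds_eq (x, y)
  rcases exists_int_Ioo x with ⟨m, h1, h2⟩ | ⟨m, h1, h2⟩
  · have e : cyl b k =ᶠ[𝓝 (x, y)] fun w => pt b (w.1 + (k - 2 * m), w.2 + k) := by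
      filter_upwards [(isOpen_Ioo.prod isOpen_univ).mem_nhds
        (show (x, y) ∈ Ioo (2 * m : ℝ) (2 * m + 2) ×ˢ univ from ⟨⟨h1, h2⟩, trivial⟩)] with w hw
      rw [cyl_eq b k m hw.1.1 hw.1.2]
      congr 2 <;> ring
    rw [map_congr e, e.self_of_nhds, nhds_pt]
    · rw [← tr, map_map]; rfl
    · refine row_subset_stair k (mem_row.2 ?_)
      exact ⟨⟨by linarith, by linarith⟩, by linarith, by linarith⟩
  · have e : cyl b k =ᶠ[𝓝 (x, y)] fun w => pt (!b) (w.1 + (-k - 1 - 2 * m), w.2 + -k) := by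
      filter_upwards [(isOpen_Ioo.prod isOpen_Ioo).mem_nhds
        (show (x, y) ∈ Ioo (2 * m + 1 : ℝ) (2 * m + 3) ×ˢ Ioo (0 : ℝ) 1 from
          ⟨⟨h1, h2⟩, h0, h3⟩)] with w hw
      rw [cyl_eq' b k m hw.1.1 hw.1.2 hw.2.1 hw.2.2]
      congr 2 <;> ring
    rw [map_congr e, e.self_of_nhds, nhds_pt]
    · rw [← tr, map_map]; rfl
    · refine row_subset_stair (-k) (mem_row.2 ?_)
      push_cast
      exact ⟨⟨by linarith, by linarith⟩, by linarith, by linarith⟩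

lemma nhds_prod_cyl {Y : Type*} [TopologicalSpace Y] (s : Y) (b : Bool) (k : ℤ) {x y : ℝ}
    (h0 : 0 < y) (h3 : y < 1) :
    𝓝 (s, cyl b k (x, y)) =
      map (fun q : Y × (ℝ × ℝ) => (q.1, cyl b k q.2)) (𝓝 (s, (x, y))) := by
  rw [nhds_prod_eq, nhds_cyl b k h0 h3, nhds_prod_eq (x := s)]
  conv_lhs => rw [← Filter.map_id (f := 𝓝 s)]
  rw [Filter.prod_map_map_eq']
  rfl

/-! ### Row and column functions -/

/-- Truncation of a real number to `[0, 1]`. -/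
def clamp (t : ℝ) : ℝ := max 0 (min 1 t)

lemma continuous_clamp : Continuous clamp := by unfold clamp; fun_prop

lemma monotone_clamp : Monotone clamp := fun s t h => by unfold clamp; gcongr

lemma clamp_of_le_zero {t : ℝ} (h : t ≤ 0) : clamp t = 0 := by
  unfold clamp; exact max_eq_left ((min_le_right _ _).trans h)

lemma clamp_of_one_le {t : ℝ} (h : 1 ≤ t) : clamp t = 1 := by
  unfold clamp; rw [min_eq_left h]; simp

lemma clamp_of_mem {t : ℝ} (h : 0 ≤ t) (h' : t ≤ 1) : clamp t = t := by
  unfold clamp; rw [min_eq_right h', max_eq_right h]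

/-- The map from the line to the circle that wraps `[0, 1]` once around the circle and is constant
on the two complementary half lines. -/
def wrap (t : ℝ) : Circle := Circle.exp (2 * Real.pi * clamp t)

lemma continuous_wrap : Continuous wrap :=
  Circle.exp.continuous.comp (continuous_const.mul continuous_clamp)

lemma wrap_of_le_zero {t : ℝ} (h : t ≤ 0) : wrap t = 1 := by
  simp [wrap, clamp_of_le_zero h]

lemma wrap_of_one_le {t : ℝ} (h : 1 ≤ t) : wrap t = 1 := by
  simp [wrap, clamp_of_one_le h]

lemma wrap_ne_one {t : ℝ} (h : 0 < t) (h' : t < 1) : wrap t ≠ 1 := by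
  rw [wrap, clamp_of_mem h.le h'.le, Ne, Circle.exp_eq_one]
  rintro ⟨n, hn⟩
  have hpi := Real.pi_pos
  have : t = n := by
    have : 2 * Real.pi * (t - n) = 0 := by linarith
    rcases mul_eq_zero.1 this with h | h <;> linarith
  rw [this] at h h'
  norm_cast at h h'
  omega

/-- The wrapping map based at `j` is trivial on the unit intervals other than `[j, j + 1]`. -/
lemma wrap_sub_of_ne {k j : ℤ} {t : ℝ} (h1 : k ≤ t) (h2 : t ≤ k + 1) (h : k ≠ j) :
    wrap (t - j) = 1 := by
  rcases lt_or_gt_of_ne h with h | h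
  · apply wrap_of_le_zero
    have : (k : ℝ) + 1 ≤ j := by exact_mod_cast h
    linarith
  · apply wrap_of_one_le
    have : (j : ℝ) + 1 ≤ k := by exact_mod_cast h
    linarith

/-- The index in the copy `b` of the `k`-th row of the copy `false`. -/
def rowIdx (b : Bool) (k : ℤ) : ℤ := if b then -k else k

/-- The index in the copy `b` of the `k`-th column of the copy `false`. -/
def colIdx (b : Bool) (k : ℤ) : ℤ := if b then 1 - k else k

lemma rowIdx_not (b : Bool) (k : ℤ) : rowIdx (!b) k = -rowIdx b k := by
  cases b <;> simp [rowIdx]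

lemma colIdx_not (b : Bool) (k : ℤ) : colIdx (!b) k = 1 - colIdx b k := by
  cases b <;> simp [colIdx]

lemma exists_rowFun (k : ℤ) : ∃ F : Surface → Circle, ∀ b, ∀ z ∈ stair,
    F (pt b z) = wrap (z.2 - rowIdx b k) := by
  refine exists_lift (fun b z => wrap (z.2 - rowIdx b k)) fun b z z' h => ?_
  have main : ∀ l : ℤ, z ∈ row l → z'.2 = z.2 - 2 * l →
      wrap (z.2 - rowIdx b k) = wrap (z'.2 - rowIdx (!b) k) := by
    intro l hl h'
    have hl := (mem_row.1 hl).2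
    rw [rowIdx_not, h']
    by_cases e : l = rowIdx b k
    · rw [← e]; push_cast; congr 1; ring
    · rw [wrap_sub_of_ne hl.1.le hl.2.le e, wrap_sub_of_ne (k := -l)]
      · push_cast; linarith
      · push_cast; linarith
      · omega
  obtain ⟨l, ⟨h1, rfl⟩ | ⟨h1, rfl⟩⟩ := h
  · exact main l h1.1 rfl
  · exact main l h1.1 rfl

lemma exists_colFun (k : ℤ) : ∃ F : Surface → Circle, ∀ b, ∀ z ∈ stair,
    F (pt b z) = wrap (z.1 - colIdx b k) := by
  refine exists_lift (fun b z => wrap (z.1 - colIdx b k)) fun b z z' h => ?_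
  have main : ∀ l : ℤ, z ∈ col l → z'.1 = z.1 + (1 - 2 * l) →
      wrap (z.1 - colIdx b k) = wrap (z'.1 - colIdx (!b) k) := by
    intro l hl h'
    have hl := (mem_col.1 hl).1
    rw [colIdx_not, h']
    by_cases e : l = colIdx b k
    · rw [← e]; push_cast; congr 1; ring
    · rw [wrap_sub_of_ne hl.1.le hl.2.le e, wrap_sub_of_ne (k := 1 - l)]
      · push_cast; linarith
      · push_cast; linarith
      · omega
  obtain ⟨l, ⟨h1, rfl⟩ | ⟨h1, rfl⟩⟩ := h
  · exact main l h1.2 rfl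
  · exact main (l + 1) h1.2 (by push_cast; ring)

/-- The map to the circle that collapses the complement of the `k`-th horizontal cylinder to a
point, and winds once around the circle across the cylinder. -/
def rowFun (k : ℤ) : Surface → Circle := (exists_rowFun k).choose

/-- The map to the circle that collapses the complement of the `k`-th vertical cylinder to a
point, and winds once around the circle across the cylinder. -/
def colFun (k : ℤ) : Surface → Circle := (exists_colFun k).choose

lemma rowFun_pt (k : ℤ) (b : Bool) {z : ℝ × ℝ} (hz : z ∈ stair) :
    rowFun k (pt b z) = wrap (z.2 - rowIdx b k) := (exists_rowFun k).choose_spec b z hz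

lemma colFun_pt (k : ℤ) (b : Bool) {z : ℝ × ℝ} (hz : z ∈ stair) :
    colFun k (pt b z) = wrap (z.1 - colIdx b k) := (exists_colFun k).choose_spec b z hz

lemma continuous_rowFun (k : ℤ) : Continuous (rowFun k) :=
  continuous_of_pt fun b => ContinuousOn.congr
    (continuous_wrap.comp (by fun_prop : Continuous fun z : ℝ × ℝ => z.2 - rowIdx b k)).continuousOn
    fun _ hz => rowFun_pt k b hz

lemma continuous_colFun (k : ℤ) : Continuous (colFun k) :=
  continuous_of_pt fun b => ContinuousOn.congr
    (continuous_wrap.comp (by fun_prop : Continuous fun z : ℝ × ℝ => z.1 - colIdx b k)).continuousOn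
    fun _ hz => colFun_pt k b hz

lemma rowFun_cyl (j k : ℤ) {x y : ℝ} (h0 : 0 < y) (h3 : y < 1) :
    rowFun j (cyl false k (x, y)) = if j = k then wrap y else 1 := by
  rcases exists_int_Ioo x with ⟨m, h1, h2⟩ | ⟨m, h1, h2⟩
  · rw [cyl_eq _ _ m h1 h2, rowFun_pt]
    · dsimp only
      split_ifs with h
      · subst h; simp [rowIdx]
      · exact wrap_sub_of_ne (k := k) (by linarith) (by linarith) (by simp [rowIdx]; omega)
    · exact row_subset_stair k (mem_row_add.2 ⟨⟨by linarith, by linarith⟩, h0, h3⟩)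
  · rw [cyl_eq' _ _ m h1 h2 h0 h3, rowFun_pt]
    · dsimp only
      split_ifs with h
      · subst h; simp [rowIdx]
      · exact wrap_sub_of_ne (k := -k) (by push_cast; linarith) (by push_cast; linarith)
          (by simp [rowIdx]; omega)
    · refine row_subset_stair (-k) (mem_row.2 ?_)
      push_cast
      exact ⟨⟨by linarith, by linarith⟩, by linarith, by linarith⟩

lemma rowFun_edge (j : ℤ) {p : Surface} (h : IsEdge p) : rowFun j p = 1 := by
  obtain ⟨b, i, x, h1, h2, rfl⟩ := h
  rw [rowFun_pt j b (edge_mem_stair h1 h2)]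
  dsimp only
  rcases le_or_gt i (rowIdx b j) with h | h
  · apply wrap_of_le_zero
    have : (i : ℝ) ≤ rowIdx b j := by exact_mod_cast h
    linarith
  · apply wrap_of_one_le
    have : (rowIdx b j : ℝ) + 1 ≤ i := by exact_mod_cast h
    linarith

lemma clamp_injOn_wrap {s t : ℝ} (hs : 0 < s) (hs' : s < 1) (ht : 0 < t) (ht' : t < 1)
    (h : wrap s = wrap t) : s = t := by
  rw [wrap, wrap, clamp_of_mem hs.le hs'.le, clamp_of_mem ht.le ht'.le, Circle.exp_eq_exp] at h
  obtain ⟨n, hn⟩ := h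
  have hpi := Real.pi_pos
  have e : s = t + n := by
    have : 2 * Real.pi * (s - (t + n)) = 0 := by linarith
    rcases mul_eq_zero.1 this with h | h <;> linarith
  have h1 : (n : ℝ) < 1 := by linarith
  have h2 : (-1 : ℝ) < n := by linarith
  norm_cast at h1 h2
  have : n = 0 := by omega
  simp [e, this]

lemma cyl_inj {k k' : ℤ} {x y x' y' : ℝ} (h0 : 0 < y) (h1 : y < 1) (h0' : 0 < y') (h1' : y' < 1)
    (h : cyl false k (x, y) = cyl false k' (x', y')) :
    k = k' ∧ y = y' ∧ ∃ m : ℤ, x' = x + 2 * m := by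
  have e1 := rowFun_cyl k k (x := x) h0 h1
  rw [if_pos rfl, h, rowFun_cyl k k' h0' h1'] at e1
  obtain rfl : k = k' := by
    by_contra hk
    rw [if_neg hk] at e1
    exact wrap_ne_one h0 h1 e1.symm
  rw [if_pos rfl] at e1
  obtain rfl := clamp_injOn_wrap h0' h1' h0 h1 e1
  refine ⟨rfl, rfl, ?_⟩
  -- translate so that one of the two formulas applies to both points
  have red : ∀ t : ℝ, ∃ m : ℤ, 0 ≤ t + 2 * m ∧ t + 2 * m < 2 := fun t =>
    ⟨-⌊t / 2⌋, by push_cast; linarith [Int.floor_le (t / 2)],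
      by push_cast; linarith [Int.lt_floor_add_one (t / 2)]⟩
  obtain ⟨m, hm, hm'⟩ := red x
  obtain ⟨n, hn, hn'⟩ := red x'
  rw [← cyl_add_int _ _ m x, ← cyl_add_int _ _ n x'] at h
  suffices x + 2 * m = x' + 2 * n from ⟨m - n, by push_cast; linarith⟩
  have inA : ∀ t : ℝ, 0 < t → t < 2 → ((k : ℝ) + (t - 2 * (0 : ℤ)), k + y') ∈ stair :=
    fun t h1 h2 => row_subset_stair k (mem_row.2 ⟨⟨by push_cast; linarith, by push_cast; linarith⟩,
      by linarith, by linarith⟩)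
  have inB : ((-k : ℝ) + (0 - 1 - 2 * ((-1 : ℤ) : ℝ)), -k + y') ∈ stair := by
    refine row_subset_stair (-k) (mem_row.2 ?_)
    push_cast
    exact ⟨⟨by linarith, by linarith⟩, by linarith, by linarith⟩
  -- the points with first coordinate zero are on the edges missing from the copy `false`
  have zero : ∀ t : ℝ, 0 < t → t < 2 → cyl false k (t, y') ≠ cyl false k (0, y') := by
    intro t h1 h2 h
    rw [cyl_eq _ _ 0 (by simpa using h1) (by simpa using h2),
      cyl_eq' _ _ (-1) (by norm_num) (by norm_num) h0' h1', pt_eq_iff (inA t h1 h2) inB] at h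
    obtain ⟨h, -⟩ | ⟨-, h⟩ := h
    · simp at h
    · obtain ⟨l, ⟨⟨-, g⟩, -⟩ | ⟨⟨-, g⟩, -⟩⟩ := h.symm
      all_goals
        have := (mem_col.1 g).1
        push_cast at this
      · exact not_mem_Ioo_int (k := l) (l := -k + 1) (by push_cast; linarith)
          (by push_cast; linarith)
      · exact not_mem_Ioo_int (k := l + 1) (l := -k + 1) (by push_cast; linarith)
          (by push_cast; linarith)
  rcases hm.eq_or_lt with e | e <;> rcases hn.eq_or_lt with e' | e'
  · rw [← e, ← e']
  · rw [← e] at h; exact absurd h.symm (zero _ e' hn')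
  · rw [← e'] at h; exact absurd h (zero _ e hm')
  · rw [cyl_eq _ _ 0 (by simpa using e) (by simpa using hm'),
      cyl_eq _ _ 0 (by simpa using e') (by simpa using hn')] at h
    have := pt_injOn false (inA _ e hm') (inA _ e' hn') h
    simp only [Prod.mk.injEq] at this
    linarith [this.1]

/-! ### The reflection that exchanges rows and columns -/

/-- The reflection that exchanges the rows and the columns of the copy `b`. -/
def reflMap (b : Bool) (z : ℝ × ℝ) : ℝ × ℝ := if b then (z.2, z.1 - 1) else (z.2 + 1, z.1)

lemma reflMap_not (b : Bool) (z : ℝ × ℝ) : reflMap (!b) (reflMap b z) = z := by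
  cases b <;> simp [reflMap]

lemma reflMap_not' (b : Bool) (z : ℝ × ℝ) : reflMap b (reflMap (!b) z) = z := by
  cases b <;> simp [reflMap]

lemma continuous_reflMap (b : Bool) : Continuous (reflMap b) := by
  cases b
  · exact (by fun_prop : Continuous fun z : ℝ × ℝ => (z.2 + 1, z.1))
  · exact (by fun_prop : Continuous fun z : ℝ × ℝ => (z.2, z.1 - 1))

lemma reflMap_row {b : Bool} {k : ℤ} {z : ℝ × ℝ} (h : z ∈ row k) :
    reflMap b z ∈ col (if b then k else k + 1) := by
  rw [mem_row] at h
  cases b <;> simp [reflMap, mem_col] <;> refine ⟨⟨?_, ?_⟩, ?_, ?_⟩ <;> linarith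

lemma reflMap_col {b : Bool} {k : ℤ} {z : ℝ × ℝ} (h : z ∈ col k) :
    reflMap b z ∈ row (if b then k - 1 else k) := by
  rw [mem_col] at h
  cases b <;> simp [reflMap, mem_row] <;> refine ⟨⟨?_, ?_⟩, ?_, ?_⟩ <;> linarith

lemma reflMap_mem {b : Bool} {z : ℝ × ℝ} (h : z ∈ stair) : reflMap b z ∈ stair := by
  obtain ⟨k, h | h⟩ := mem_stair.1 h
  · exact col_subset_stair _ (reflMap_row h)
  · exact row_subset_stair _ (reflMap_col h)

lemma Glued.refl {z z' : ℝ × ℝ} (h : Glued z z') (b : Bool) :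
    Glued (reflMap b z) (reflMap (!b) z') := by
  obtain ⟨k, ⟨⟨h1, h2⟩, rfl⟩ | ⟨⟨h1, h2⟩, rfl⟩⟩ := h
  · have h1 := reflMap_row (b := b) h1
    have h2 := reflMap_col (b := b) h2
    cases b
    · exact ⟨k, .inr ⟨⟨h2, h1⟩, by ext <;> simp [reflMap] <;> ring⟩⟩
    · refine ⟨k - 1, .inr ⟨⟨h2, by simpa using h1⟩, ?_⟩⟩
      ext <;> simp [reflMap] <;> ring
  · have h1 := reflMap_row (b := b) h1
    have h2 := reflMap_col (b := b) h2
    cases b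
    · refine ⟨k + 1, .inl ⟨⟨h2, h1⟩, ?_⟩⟩
      ext <;> simp [reflMap] <;> ring
    · refine ⟨k, .inl ⟨⟨by simpa using h2, h1⟩, ?_⟩⟩
      ext <;> simp [reflMap] <;> ring

lemma exists_reflection (c : Bool) : ∃ F : Surface → Surface, ∀ b, ∀ z ∈ stair,
    F (pt b z) = pt b (reflMap (xor c b) z) := by
  refine exists_lift (fun b z => pt b (reflMap (xor c b) z)) fun b z z' h => ?_
  have : (xor c !b) = !(xor c b) := by cases b <;> cases c <;> rfl
  rw [this]
  exact (h.refl _).pt_eq b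

/-- The reflection of the staircase surface that exchanges its horizontal and its vertical
cylinders. -/
def reflection : Surface ≃ₜ Surface where
  toFun := (exists_reflection false).choose
  invFun := (exists_reflection true).choose
  left_inv p := by
    obtain ⟨b, z, hz, rfl⟩ := exists_pt p
    rw [(exists_reflection false).choose_spec b z hz, Bool.false_xor,
      (exists_reflection true).choose_spec b _ (reflMap_mem hz), Bool.true_xor, reflMap_not]
  right_inv p := by
    obtain ⟨b, z, hz, rfl⟩ := exists_pt p
    rw [(exists_reflection true).choose_spec b z hz, Bool.true_xor,
      (exists_reflection false).choose_spec b _ (reflMap_mem hz), Bool.false_xor, reflMap_not']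
  continuous_toFun := continuous_of_pt fun b => ContinuousOn.congr
    ((continuousOn_pt b).comp (continuous_reflMap _).continuousOn fun _ hz => reflMap_mem hz)
    fun z hz => (exists_reflection false).choose_spec b z hz
  continuous_invFun := continuous_of_pt fun b => ContinuousOn.congr
    ((continuousOn_pt b).comp (continuous_reflMap _).continuousOn fun _ hz => reflMap_mem hz)
    fun z hz => (exists_reflection true).choose_spec b z hz

lemma reflection_pt (b : Bool) {z : ℝ × ℝ} (hz : z ∈ stair) :
    reflection (pt b z) = pt b (reflMap b z) := by
  have := (exists_reflection false).choose_spec b z hz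
  rwa [Bool.false_xor] at this

lemma reflection_symm_pt (b : Bool) {z : ℝ × ℝ} (hz : z ∈ stair) :
    reflection.symm (pt b z) = pt b (reflMap (!b) z) := by
  have := (exists_reflection true).choose_spec b z hz
  rwa [Bool.true_xor] at this

/-! ### Twists along the horizontal cylinders -/

/-- A continuous family, parametrized by `Y`, of homeomorphisms of the closed horizontal cylinders
that preserve the horizontal circles and are the identity on the boundary. The homeomorphism of the
cylinder `k` with parameter `s` lifts to `(x, y) ↦ (toFun s k x y, y)`; it turns the upper boundary
by `turns` full turns relative to the lower one. -/
structure LeafMap (Y : Type*) [TopologicalSpace Y] where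
  toFun : Y → ℤ → ℝ → ℝ → ℝ
  turns : ℤ
  continuous_toFun : ∀ k, Continuous fun q : Y × (ℝ × ℝ) => toFun q.1 k q.2.1 q.2.2
  strictMono : ∀ s k y, StrictMono fun x => toFun s k x y
  add_two : ∀ s k x y, toFun s k (x + 2) y = toFun s k x y + 2
  bot : ∀ s k x, toFun s k x 0 = x
  top : ∀ s k x, toFun s k x 1 = x + 2 * turns

/-- The inverses of a continuous family of increasing bijections of the line form a continuous
family. -/
lemma continuous_inverse_family {Z : Type*} [TopologicalSpace Z] {F G : Z → ℝ → ℝ}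
    (hF : Continuous fun q : Z × ℝ => F q.1 q.2) (hmono : ∀ z, StrictMono (F z))
    (hG : ∀ z v, F z (G z v) = v) : Continuous fun q : Z × ℝ => G q.1 q.2 := by
  rw [continuous_iff_continuousAt]
  rintro ⟨z₀, v₀⟩
  rw [ContinuousAt, tendsto_order]
  have hc : ∀ x : ℝ, Continuous fun q : Z × ℝ => F q.1 x := fun x =>
    hF.comp (by fun_prop : Continuous fun q : Z × ℝ => (q.1, x))
  constructor
  · intro a ha
    have h : F z₀ a < v₀ := by rw [← hG z₀ v₀]; exact hmono z₀ ha
    filter_upwards [(isOpen_lt (hc a) continuous_snd).mem_nhds h] with q hq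
    exact (hmono q.1).lt_iff_lt.1 (by rw [hG]; exact hq)
  · intro a ha
    have h : v₀ < F z₀ a := by
      conv_lhs => rw [← hG z₀ v₀]
      exact hmono z₀ ha
    filter_upwards [(isOpen_lt continuous_snd (hc a)).mem_nhds h] with q hq
    exact (hmono q.1).lt_iff_lt.1 (by rw [hG]; exact hq)

lemma add_two_mul_int {f : ℝ → ℝ} (h : ∀ x, f (x + 2) = f x + 2) (x : ℝ) (m : ℤ) :
    f (x + 2 * m) = f x + 2 * m := by
  have hp : Function.Periodic (fun x => f x - x) 2 := fun x => by simp only [h]; ring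
  have := hp.int_mul m x
  rw [mul_comm] at this
  linarith

lemma surjective_of_add_two {f : ℝ → ℝ} (hf : Continuous f) (h : ∀ x, f (x + 2) = f x + 2) :
    Function.Surjective f := by
  intro v
  refine mem_range_of_exists_le_of_exists_ge hf ⟨0 + 2 * ⌊(v - f 0) / 2⌋, ?_⟩
    ⟨0 + 2 * ⌈(v - f 0) / 2⌉, ?_⟩ <;> rw [add_two_mul_int h]
  · linarith [Int.floor_le ((v - f 0) / 2)]
  · linarith [Int.le_ceil ((v - f 0) / 2)]

open Classical in
/-- The self-map of the surface that is `(x, y) ↦ (φ k x y, y)` on the `k`-th horizontal cylinder,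
and the identity on the horizontal edges. -/
def leafwise (φ : ℤ → ℝ → ℝ → ℝ) (p : Surface) : Surface :=
  if h : ∃ q : ℤ × ℝ × ℝ, 0 < q.2.2 ∧ q.2.2 < 1 ∧ p = cyl false q.1 q.2 then
    cyl false h.choose.1 (φ h.choose.1 h.choose.2.1 h.choose.2.2, h.choose.2.2)
  else p

lemma leafwise_cyl {φ : ℤ → ℝ → ℝ → ℝ} (hφ : ∀ k x y, φ k (x + 2) y = φ k x y + 2) (k : ℤ)
    {x y : ℝ} (h0 : 0 < y) (h1 : y < 1) :
    leafwise φ (cyl false k (x, y)) = cyl false k (φ k x y, y) := by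
  have h : ∃ q : ℤ × ℝ × ℝ, 0 < q.2.2 ∧ q.2.2 < 1 ∧ cyl false k (x, y) = cyl false q.1 q.2 :=
    ⟨(k, x, y), h0, h1, rfl⟩
  rw [leafwise, dif_pos h]
  obtain ⟨g0, g1, g2⟩ := h.choose_spec
  obtain ⟨e1, e2, m, e3⟩ := cyl_inj h0 h1 g0 g1 g2
  rw [e3, ← e2, ← e1, add_two_mul_int (f := fun x => φ k x y) fun x => hφ k x y, cyl_add_int]

lemma leafwise_edge (φ : ℤ → ℝ → ℝ → ℝ) {p : Surface} (hp : IsEdge p) : leafwise φ p = p := by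
  rw [leafwise, dif_neg]
  rintro ⟨q, h0, h1, rfl⟩
  exact not_isEdge_cyl false q.1 h0 h1 hp

/-- The expression of a leafwise map in the cylinder coordinates of the copy `b`. -/
def leafCopy (b : Bool) (φ : ℤ → ℝ → ℝ → ℝ) (k : ℤ) (x y : ℝ) : ℝ :=
  if b then φ (-k) (x + 1) y - 1 else φ k x y

lemma leafwise_cyl_copy {φ : ℤ → ℝ → ℝ → ℝ} (hφ : ∀ k x y, φ k (x + 2) y = φ k x y + 2) (b : Bool)
    (k : ℤ) {x y : ℝ} (h0 : 0 < y) (h1 : y < 1) :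
    leafwise φ (cyl b k (x, y)) = cyl b k (leafCopy b φ k x y, y) := by
  cases b
  · exact leafwise_cyl hφ k h0 h1
  · have e : ∀ t, cyl true k (t, y) = cyl false (-k) (t + 1, y) := fun t => by
      simpa using cyl_not false (-k) (x := t) h0 h1
    rw [e, e, leafwise_cyl hφ _ h0 h1]
    simp [leafCopy]

namespace LeafMap

variable {Y : Type*} [TopologicalSpace Y] (L : LeafMap Y)

lemma continuous_slice (s : Y) (k : ℤ) (y : ℝ) : Continuous fun x => L.toFun s k x y :=
  (L.continuous_toFun k).comp (by fun_prop : Continuous fun x : ℝ => (s, (x, y)))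

lemma exists_inverse (s : Y) (k : ℤ) (x y : ℝ) : ∃ v, L.toFun s k v y = x :=
  surjective_of_add_two (L.continuous_slice s k y) (fun x => L.add_two s k x y) x

/-- The inverse family of leafwise homeomorphisms. -/
def symm : LeafMap Y where
  toFun s k x y := (L.exists_inverse s k x y).choose
  turns := -L.turns
  continuous_toFun k := by
    have h := continuous_inverse_family (Z := Y × ℝ) (F := fun z x => L.toFun z.1 k x z.2)
      (G := fun z x => (L.exists_inverse z.1 k x z.2).choose)
      ((L.continuous_toFun k).comp
        (by fun_prop : Continuous fun q : (Y × ℝ) × ℝ => (q.1.1, (q.2, q.1.2))))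
      (fun z => L.strictMono z.1 k z.2) fun z v => (L.exists_inverse z.1 k v z.2).choose_spec
    exact h.comp (by fun_prop : Continuous fun q : Y × (ℝ × ℝ) => ((q.1, q.2.2), q.2.1))
  strictMono s k y a b hab := by
    rw [← (L.strictMono s k y).lt_iff_lt]
    simpa only [(L.exists_inverse s k _ y).choose_spec] using hab
  add_two s k x y := by
    apply (L.strictMono s k y).injective
    simp only [L.add_two, (L.exists_inverse s k _ y).choose_spec]
  bot s k x := by
    have := (L.exists_inverse s k x 0).choose_spec
    rwa [L.bot] at this
  top s k x := by
    have := (L.exists_inverse s k x 1).choose_spec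
    rw [L.top] at this
    push_cast
    linarith

lemma toFun_symm (s : Y) (k : ℤ) (x y : ℝ) : L.toFun s k (L.symm.toFun s k x y) y = x :=
  (L.exists_inverse s k x y).choose_spec

lemma symm_toFun (s : Y) (k : ℤ) (x y : ℝ) : L.symm.toFun s k (L.toFun s k x y) y = x :=
  (L.strictMono s k y).injective (L.toFun_symm _ _ _ _)

/-- The first coordinate of the leafwise map near the open edge at the bottom of the row `j` of the
copy `b`, in planar coordinates. -/
def edgeCoord (b : Bool) (j : ℤ) (s : Y) (z : ℝ × ℝ) : ℝ :=
  if (j : ℝ) ≤ z.2 then j + leafCopy b (L.toFun s) j (z.1 - j) (z.2 - j)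
  else j - 1 + leafCopy b (L.toFun s) (j - 1) (z.1 - j + 1) (z.2 - j + 1) - 2 * L.turns

lemma continuous_leafCopy (b : Bool) (k : ℤ) :
    Continuous fun q : Y × (ℝ × ℝ) => leafCopy b (L.toFun q.1) k q.2.1 q.2.2 := by
  cases b
  · exact L.continuous_toFun k
  · have : Continuous fun q : Y × (ℝ × ℝ) => L.toFun q.1 (-k) (q.2.1 + 1) q.2.2 :=
      (L.continuous_toFun (-k)).comp
        (by fun_prop : Continuous fun q : Y × (ℝ × ℝ) => (q.1, (q.2.1 + 1, q.2.2)))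
    exact this.sub continuous_const

lemma leafCopy_bot (b : Bool) (s : Y) (k : ℤ) (x : ℝ) : leafCopy b (L.toFun s) k x 0 = x := by
  cases b <;> simp [leafCopy, L.bot]

lemma leafCopy_top (b : Bool) (s : Y) (k : ℤ) (x : ℝ) :
    leafCopy b (L.toFun s) k x 1 = x + 2 * L.turns := by
  cases b <;> simp [leafCopy, L.top]; ring

lemma continuous_edgeCoord (b : Bool) (j : ℤ) :
    Continuous fun q : Y × (ℝ × ℝ) => L.edgeCoord b j q.1 q.2 := by
  refine Continuous.if_le ?_ ?_ continuous_const (by fun_prop) ?_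
  · exact continuous_const.add ((L.continuous_leafCopy b j).comp
      (by fun_prop : Continuous fun q : Y × (ℝ × ℝ) => (q.1, (q.2.1 - j, q.2.2 - j))))
  · exact (continuous_const.add ((L.continuous_leafCopy b (j - 1)).comp
      (by fun_prop : Continuous fun q : Y × (ℝ × ℝ) =>
        (q.1, (q.2.1 - j + 1, q.2.2 - j + 1))))).sub continuous_const
  · intro q hq
    rw [← hq, sub_self, zero_add, leafCopy_bot, leafCopy_top]
    ring

lemma edgeCoord_edge (b : Bool) (j : ℤ) (s : Y) (x : ℝ) : L.edgeCoord b j s (x, j) = x := by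
  rw [edgeCoord, if_pos le_rfl]
  simp [leafCopy_bot]

/-- Near the horizontal edges, a leafwise map is a planar map that preserves the second
coordinate. -/
lemma eventually_leafwise_edge (b : Bool) {j : ℤ} {x : ℝ} (h1 : j < x) (h2 : x < j + 1) (s : Y) :
    ∀ᶠ q : Y × (ℝ × ℝ) in 𝓝 (s, (x, (j : ℝ))),
      leafwise (L.toFun q.1) (pt b q.2) = pt b (L.edgeCoord b j q.1 q.2, q.2.2) := by
  have hc := (L.continuous_edgeCoord b j).continuousAt (x := (s, (x, (j : ℝ))))
  have hq2 : ContinuousAt (fun q : Y × (ℝ × ℝ) => q.2.2) (s, (x, (j : ℝ))) := by fun_prop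
  have hq1 : ContinuousAt (fun q : Y × (ℝ × ℝ) => q.2.1) (s, (x, (j : ℝ))) := by fun_prop
  have he := L.edgeCoord_edge b j s x
  filter_upwards [hc.eventually (Ioo_mem_nhds (h1.trans_eq he.symm) (he.trans_lt h2)),
    hq1.eventually (Ioo_mem_nhds h1 h2),
    hq2.eventually (Ioo_mem_nhds (show (j : ℝ) - 1 < j by linarith)
      (show (j : ℝ) < j + 1 by linarith))] with q hq hqx hqy
  obtain ⟨s, u, v⟩ := q
  simp only at hq hqx hqy
  dsimp only
  rcases lt_trichotomy (j : ℝ) v with h | h | h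
  · rw [edgeCoord, if_pos h.le] at hq ⊢
    dsimp only at hq ⊢
    rw [pt_eq_cyl b (k := j) (mem_row.2 ⟨⟨by linarith, by linarith⟩, h, hqy.2⟩),
      leafwise_cyl_copy (L.add_two s) b j (by linarith) (by linarith),
      cyl_eq b j 0 (by push_cast; linarith) (by push_cast; linarith)]
    congr 2 <;> push_cast <;> ring
  · rw [← h, edgeCoord_edge, leafwise_edge]
    exact ⟨b, j, u, hqx.1, hqx.2, rfl⟩
  · rw [edgeCoord, if_neg h.not_ge] at hq ⊢
    dsimp only at hq ⊢
    have e : ((u, v) : ℝ × ℝ).1 - ((j - 1 : ℤ) : ℝ) = u - j + 1 := by push_cast; ring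
    have e' : ((u, v) : ℝ × ℝ).2 - ((j - 1 : ℤ) : ℝ) = v - j + 1 := by push_cast; ring
    rw [pt_eq_cyl b (k := j - 1) (mem_row.2 (by
        push_cast; exact ⟨⟨by linarith, by linarith⟩, by linarith, by linarith⟩)), e, e',
      leafwise_cyl_copy (L.add_two s) b _ (by linarith) (by linarith),
      cyl_eq b _ L.turns (by linarith) (by linarith)]
    congr 2 <;> push_cast <;> ring

lemma continuous_leafwise :
    Continuous fun q : Y × Surface => leafwise (L.toFun q.1) q.2 := by
  rw [continuous_iff_continuousAt]
  rintro ⟨s, p⟩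
  rcases cyl_or_edge p with ⟨k, x, y, h0, h1, rfl⟩ | ⟨b, j, x, h1, h2, rfl⟩
  · rw [ContinuousAt, nhds_prod_cyl s false k h0 h1, tendsto_map'_iff]
    dsimp only
    rw [leafwise_cyl (L.add_two s) k h0 h1]
    have hev : ∀ᶠ q : Y × (ℝ × ℝ) in 𝓝 (s, (x, y)),
        cyl false k (L.toFun q.1 k q.2.1 q.2.2, q.2.2) =
          leafwise (L.toFun q.1) (cyl false k q.2) := by
      have hq2 : ContinuousAt (fun q : Y × (ℝ × ℝ) => q.2.2) (s, (x, y)) := by fun_prop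
      filter_upwards [hq2.eventually (Ioo_mem_nhds h0 h1)] with q hq
      exact (leafwise_cyl (L.add_two q.1) k hq.1 hq.2).symm
    refine Tendsto.congr' hev ?_
    refine (continuousAt_cyl false k h0 h1).tendsto.comp ?_
    have : Continuous fun q : Y × (ℝ × ℝ) => (L.toFun q.1 k q.2.1 q.2.2, q.2.2) :=
      (L.continuous_toFun k).prodMk (by fun_prop)
    exact this.tendsto (s, (x, y))
  · have hst := edge_mem_stair h1 h2
    rw [ContinuousAt, nhds_prod_pt s b hst, tendsto_map'_iff]
    dsimp only
    rw [leafwise_edge _ ⟨b, j, x, h1, h2, rfl⟩]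
    refine Tendsto.congr' (EventuallyEq.symm (L.eventually_leafwise_edge b h1 h2 s)) ?_
    refine Tendsto.comp (y := 𝓝 (x, (j : ℝ)))
      ((continuousOn_pt b).continuousAt (isOpen_stair.mem_nhds hst)) ?_
    have : Continuous fun q : Y × (ℝ × ℝ) => (L.edgeCoord b j q.1 q.2, q.2.2) :=
      (L.continuous_edgeCoord b j).prodMk (by fun_prop)
    have := this.tendsto (s, (x, (j : ℝ)))
    rwa [L.edgeCoord_edge] at this

lemma leafwise_symm_leafwise (s : Y) (p : Surface) :
    leafwise (L.symm.toFun s) (leafwise (L.toFun s) p) = p := by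
  rcases cyl_or_edge p with ⟨k, x, y, h0, h1, rfl⟩ | hp
  · rw [leafwise_cyl (L.add_two s) k h0 h1, leafwise_cyl (L.symm.add_two s) k h0 h1, L.symm_toFun]
  · rw [leafwise_edge _ hp, leafwise_edge _ hp]

lemma leafwise_leafwise_symm (s : Y) (p : Surface) :
    leafwise (L.toFun s) (leafwise (L.symm.toFun s) p) = p := by
  rcases cyl_or_edge p with ⟨k, x, y, h0, h1, rfl⟩ | hp
  · rw [leafwise_cyl (L.symm.add_two s) k h0 h1, leafwise_cyl (L.add_two s) k h0 h1, L.toFun_symm]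
  · rw [leafwise_edge _ hp, leafwise_edge _ hp]

/-- The homeomorphism of the surface with parameter `s` in a leafwise family. -/
def twist (s : Y) : Surface ≃ₜ Surface where
  toFun := leafwise (L.toFun s)
  invFun := leafwise (L.symm.toFun s)
  left_inv := L.leafwise_symm_leafwise s
  right_inv := L.leafwise_leafwise_symm s
  continuous_toFun := L.continuous_leafwise.comp
    (by fun_prop : Continuous fun p : Surface => (s, p))
  continuous_invFun := L.symm.continuous_leafwise.comp
    (by fun_prop : Continuous fun p : Surface => (s, p))

lemma twist_apply (s : Y) (p : Surface) : L.twist s p = leafwise (L.toFun s) p := rfl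

lemma twist_cyl (s : Y) (k : ℤ) {x y : ℝ} (h0 : 0 < y) (h1 : y < 1) :
    L.twist s (cyl false k (x, y)) = cyl false k (L.toFun s k x y, y) :=
  leafwise_cyl (L.add_two s) k h0 h1

lemma twist_edge (s : Y) {p : Surface} (hp : IsEdge p) : L.twist s p = p := leafwise_edge _ hp

/-- The members of a leafwise family over the unit interval are isotopic. -/
lemma mk_twist_zero_eq_one (L : LeafMap unitInterval) :
    (QuotientGroup.mk (L.twist 0) : MappingClass Surface) = QuotientGroup.mk (L.twist 1) := by
  rw [QuotientGroup.eq]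
  let Ψ : (unitInterval × Surface) ≃ₜ (unitInterval × Surface) :=
    { toFun := fun q => (q.1, L.twist q.1 q.2)
      invFun := fun q => (q.1, (L.twist q.1).symm q.2)
      left_inv := fun q => by simp
      right_inv := fun q => by simp
      continuous_toFun := continuous_fst.prodMk L.continuous_leafwise
      continuous_invFun := continuous_fst.prodMk L.symm.continuous_leafwise }
  refine ⟨Ψ.trans ((Homeomorph.refl _).prodCongr (L.twist 0).symm), fun p => rfl, fun x => ?_,
    fun x => rfl⟩
  exact (L.twist 0).symm_apply_apply x

/-- The straight line between two leafwise maps with the same number of turns. -/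
def line (L L' : LeafMap Unit) (h : L.turns = L'.turns) : LeafMap unitInterval where
  toFun s k x y := (1 - s) * L.toFun () k x y + s * L'.toFun () k x y
  turns := L.turns
  continuous_toFun k := by
    have hp : Continuous fun q : unitInterval × (ℝ × ℝ) => ((() : Unit), q.2) := by fun_prop
    have h1 := (L.continuous_toFun k).comp hp
    have h2 := (L'.continuous_toFun k).comp hp
    have h3 : Continuous fun q : unitInterval × (ℝ × ℝ) => (q.1 : ℝ) := by fun_prop
    exact ((continuous_const.sub h3).mul h1).add (h3.mul h2)
  strictMono s k y a b hab := by
    have h1 := L.strictMono () k y hab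
    have h2 := L'.strictMono () k y hab
    have hs := s.2.1
    have hs' := s.2.2
    dsimp only at h1 h2 ⊢
    rcases hs.eq_or_lt with e | e
    · rw [← e]; simpa using h1
    · nlinarith
  add_two s k x y := by rw [L.add_two, L'.add_two]; ring
  bot s k x := by rw [L.bot, L'.bot]; ring
  top s k x := by rw [L.top, L'.top, h]; ring

/-- The isotopy class of a leafwise map depends only on its number of turns. -/
lemma mk_twist_eq (L L' : LeafMap Unit) (h : L.turns = L'.turns) :
    (QuotientGroup.mk (L.twist ()) : MappingClass Surface) = QuotientGroup.mk (L'.twist ()) := by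
  have e0 : (line L L' h).twist 0 = L.twist () := by
    ext p; simp [twist_apply, line]
  have e1 : (line L L' h).twist 1 = L'.twist () := by
    ext p; simp [twist_apply, line]
  rw [← e0, ← e1, mk_twist_zero_eq_one]

end LeafMap

end Staircase

/-! ### Derivatives in translation structures -/

lemma planeMap_add (A : Matrix (Fin 2) (Fin 2) ℝ) (z w : ℂ) :
    planeMap A (z + w) = planeMap A z + planeMap A w := by
  apply Complex.ext <;> simp only [planeMap, Complex.add_re, Complex.add_im] <;> ring

lemma planeMap_mul (A B : Matrix (Fin 2) (Fin 2) ℝ) (z : ℂ) :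
    planeMap (A * B) z = planeMap A (planeMap B z) := by
  apply Complex.ext <;> simp only [planeMap, Matrix.mul_apply, Fin.sum_univ_two] <;> ring

lemma planeMap_one (z : ℂ) : planeMap 1 z = z := by
  apply Complex.ext <;> simp [planeMap]

namespace TranslationStructure

variable {S : Type*} [TopologicalSpace S] {M : TranslationStructure S}

/-- A homeomorphism has derivative `A` if it does so in one pair of charts at every regular
point. -/
lemma hasDerivative_of_local {φ : S ≃ₜ S} {A : Matrix (Fin 2) (Fin 2) ℝ} (hs : φ '' M.sing = M.sing)
    (h : ∀ x ∈ M.singᶜ, ∃ e ∈ M.charts, ∃ e' ∈ M.charts, x ∈ e.source ∧ φ x ∈ e'.source ∧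
      ∃ c : ℂ, ∀ᶠ y in 𝓝 x, e' (φ y) = planeMap A (e y) + c) : M.HasDerivative φ A := by
  refine ⟨hs, fun d hd d' hd' x hx hx' => ?_⟩
  obtain ⟨e, he, e', he', hxe, hxe', c, hc⟩ := h x (M.source_subset d hd hx)
  obtain ⟨c₁, h₁⟩ := M.translation d hd e he x ⟨hx, hxe⟩
  obtain ⟨c₂, h₂⟩ := M.translation e' he' d' hd' (φ x) ⟨hxe', hx'⟩
  refine ⟨planeMap A c₁ + c + c₂, ?_⟩
  filter_upwards [hc, h₁, φ.continuous.continuousAt.eventually h₂] with y h3 h4 h5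
  rw [h5, h3, h4, planeMap_add]
  ring

lemma HasDerivative.mul {φ ψ : S ≃ₜ S} {A B : Matrix (Fin 2) (Fin 2) ℝ}
    (hφ : M.HasDerivative φ A) (hψ : M.HasDerivative ψ B) : M.HasDerivative (φ * ψ) (A * B) := by
  have hs : ((φ * ψ : S ≃ₜ S) : S → S) = φ ∘ ψ := rfl
  have hsing : (φ * ψ : S ≃ₜ S) '' M.sing = M.sing := by rw [hs, image_comp, hψ.1, hφ.1]
  have hreg : ∀ x ∈ M.singᶜ, ∀ θ : S ≃ₜ S, θ '' M.sing = M.sing → θ x ∈ M.singᶜ := by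
    intro x hx θ hθ h
    rw [← hθ] at h
    obtain ⟨w, hw, hwx⟩ := h
    exact hx (θ.injective hwx ▸ hw)
  refine hasDerivative_of_local hsing fun x hx => ?_
  obtain ⟨e, he, hxe⟩ := M.cover x hx
  obtain ⟨d, hd, hxd⟩ := M.cover _ (hreg x hx ψ hψ.1)
  obtain ⟨e', he', hxe'⟩ := M.cover _ (hreg x hx _ hsing)
  obtain ⟨c, hc⟩ := hψ.2 e he d hd x hxe hxd
  obtain ⟨c', hc'⟩ := hφ.2 d hd e' he' (ψ x) hxd hxe'
  refine ⟨e, he, e', he', hxe, hxe', planeMap A c + c', ?_⟩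
  filter_upwards [hc, ψ.continuous.continuousAt.eventually hc'] with y h1 h2
  rw [Homeomorph.mul_apply, h2, h1, planeMap_add, planeMap_mul]
  ring

lemma HasDerivative.inv {φ : S ≃ₜ S} {A B : Matrix (Fin 2) (Fin 2) ℝ}
    (hφ : M.HasDerivative φ A) (hBA : B * A = 1) : M.HasDerivative φ⁻¹ B := by
  refine ⟨?_, fun e he e' he' x hx hx' => ?_⟩
  · conv_lhs => rw [← hφ.1]
    exact φ.symm_image_image _
  · have hx0 : φ (φ.symm x) = x := φ.apply_symm_apply x
    obtain ⟨c, hc⟩ := hφ.2 e' he' e he (φ.symm x) hx' (by rwa [hx0])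
    refine ⟨-planeMap B c, ?_⟩
    filter_upwards [φ.symm.continuous.continuousAt.eventually hc] with y hy
    rw [φ.apply_symm_apply] at hy
    rw [hy, planeMap_add, ← planeMap_mul, hBA, planeMap_one, add_neg_cancel_right]
    rfl

end TranslationStructure

/-! ### Piecewise linear functions -/

/-- The sums of a two-sided sequence, normalized to vanish at `0`. -/
def cum (v : ℤ → ℝ) : ℤ → ℝ
  | Int.ofNat n => ∑ i ∈ Finset.range n, v i
  | Int.negSucc n => -∑ i ∈ Finset.range (n + 1), v (-(i + 1 : ℤ))

lemma cum_zero (v : ℤ → ℝ) : cum v 0 = 0 := by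
  change ∑ i ∈ Finset.range 0, v i = 0
  simp

lemma cum_add_one (v : ℤ → ℝ) (k : ℤ) : cum v (k + 1) = cum v k + v k := by
  rcases k with n | n
  · change ∑ i ∈ Finset.range (n + 1), v i = _
    rw [Finset.sum_range_succ]; rfl
  · rcases n with _ | n
    · change cum v 0 = _
      rw [cum_zero]
      simp [cum]
    · change -∑ i ∈ Finset.range (n + 1), v (-(i + 1 : ℤ)) =
        -∑ i ∈ Finset.range (n + 1 + 1), v (-(i + 1 : ℤ)) + _
      rw [Finset.sum_range_succ _ (n + 1)]
      have : (Int.negSucc (n + 1)) = -(((n + 1 : ℕ) : ℤ) + 1) := by omega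
      rw [this]
      ring

lemma int_fun_ext {f g : ℤ → ℝ} (h0 : f 0 = g 0) (h : ∀ k, f (k + 1) - f k = g (k + 1) - g k)
    (k : ℤ) : f k = g k := by
  induction k using Int.induction_on with
  | zero => exact h0
  | succ n ih => have := h n; linarith
  | pred n ih => have := h (-n - 1); rw [sub_add_cancel] at this; linarith

/-- The piecewise linear function that vanishes at `0` and has slope `v k` on `[k, k + 1]`. -/
def pl (v : ℤ → ℝ) (x : ℝ) : ℝ := cum v ⌊x⌋ + v ⌊x⌋ * (x - ⌊x⌋)

lemma pl_eq (v : ℤ → ℝ) {k : ℤ} {x : ℝ} (h1 : k ≤ x) (h2 : x ≤ k + 1) :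
    pl v x = cum v k + v k * (x - k) := by
  rcases h2.lt_or_eq with h | h
  · have : ⌊x⌋ = k := Int.floor_eq_iff.2 ⟨h1, h⟩
    rw [pl, this]
  · have : ⌊x⌋ = k + 1 := by rw [h]; exact_mod_cast Int.floor_intCast (R := ℝ) (k + 1)
    rw [pl, this, cum_add_one, h]
    push_cast
    ring

lemma pl_int (v : ℤ → ℝ) (k : ℤ) : pl v k = cum v k := by
  rw [pl_eq v le_rfl (by linarith)]; simp

lemma continuous_pl (v : ℤ → ℝ) : Continuous (pl v) := by
  rw [continuous_iff_continuousAt]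
  intro x
  have e : pl v =ᶠ[𝓝 x] fun t =>
      cum v ⌊x⌋ + v (⌊x⌋ - 1) * min 0 (t - ⌊x⌋) + v ⌊x⌋ * max 0 (t - ⌊x⌋) := by
    have h1 : (⌊x⌋ : ℝ) - 1 < x := by linarith [Int.floor_le x]
    filter_upwards [Ioo_mem_nhds h1 (Int.lt_floor_add_one x)] with t ht
    rcases le_total (⌊x⌋ : ℝ) t with h | h
    · rw [pl_eq v h ht.2.le, min_eq_left (by linarith), max_eq_right (by linarith)]
      ring
    · rw [pl_eq v (k := ⌊x⌋ - 1) (by push_cast; exact ht.1.le) (by push_cast; linarith),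
        min_eq_right (by linarith), max_eq_left (by linarith)]
      have := cum_add_one v (⌊x⌋ - 1)
      rw [sub_add_cancel] at this
      rw [this]
      push_cast
      ring
  rw [continuousAt_congr e]
  fun_prop

lemma strictMono_pl {v : ℤ → ℝ} (hv : ∀ k, 0 < v k) : StrictMono (pl v) := by
  intro a b hab
  have hm : Monotone (cum v) := monotone_int_of_le_succ fun k => by
    rw [cum_add_one]; linarith [hv k]
  rcases (Int.floor_mono hab.le).eq_or_lt with h | h
  · rw [pl, pl, h]
    nlinarith [hv ⌊b⌋]
  · have h1 : pl v a < cum v (⌊a⌋ + 1) := by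
      rw [pl, cum_add_one]
      nlinarith [hv ⌊a⌋, Int.lt_floor_add_one a]
    have h2 : cum v (⌊a⌋ + 1) ≤ cum v ⌊b⌋ := hm h
    have h3 : cum v ⌊b⌋ ≤ pl v b := by
      rw [pl]
      nlinarith [hv ⌊b⌋, Int.floor_le b]
    linarith

lemma pl_shift (v : ℤ → ℝ) (k : ℤ) (x : ℝ) :
    pl (fun j => v (j + k)) x = pl v (x + k) - pl v k := by
  have hc : ∀ m, cum (fun j => v (j + k)) m = cum v (m + k) - cum v k := by
    apply int_fun_ext
    · rw [cum_zero, zero_add, sub_self]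
    · intro m
      rw [cum_add_one, add_right_comm, cum_add_one]
      ring
  rw [pl_int, pl_eq v (k := ⌊x⌋ + k) (by push_cast; linarith [Int.floor_le x])
    (by push_cast; linarith [Int.lt_floor_add_one x]), pl, hc]
  push_cast
  ring

lemma pl_smul (c : ℝ) (v : ℤ → ℝ) (x : ℝ) : pl (fun j => c * v j) x = c * pl v x := by
  have hc : ∀ m, cum (fun j => c * v j) m = c * cum v m := by
    apply int_fun_ext
    · rw [cum_zero, cum_zero, mul_zero]
    · intro m
      rw [cum_add_one, cum_add_one]
      ring
  rw [pl, pl, hc]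
  ring

lemma isOpenEmbedding_pl {v : ℤ → ℝ} (hv : ∀ k, 0 < v k) : IsOpenEmbedding (pl v) := by
  have hm := strictMono_pl hv
  have hc := continuous_pl v
  refine .of_continuous_injective_isOpenMap hc hm.injective ?_
  rw [isOpenMap_iff_nhds_le]
  intro x s hs
  obtain ⟨a, b, hab, hs⟩ := mem_nhds_iff_exists_Ioo_subset.1 (mem_map.1 hs)
  obtain ⟨a', ha', hax⟩ := exists_between hab.1
  obtain ⟨b', hxb, hb'⟩ := exists_between hab.2
  refine mem_of_superset (Icc_mem_nhds (hm hax) (hm hxb)) ?_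
  refine (intermediate_value_Icc (hax.trans hxb).le hc.continuousOn).trans ?_
  rintro _ ⟨t, ht, rfl⟩
  exact hs ⟨ha'.trans_le ht.1, ht.2.trans_lt hb'⟩

namespace Staircase

/-! ### The translation structures -/

/-- The eigenfunction of the adjacency operator of the line, in the labelling of the cylinders by
the copy `b`: the squares of the row `k` have height `weight r b (2 * k + 1)`, those of the column
`k` have width `weight r b (2 * k)`. -/
def weight (r : ℝ) (b : Bool) (n : ℤ) : ℝ := if b then r ^ (2 - n) else r ^ n

lemma weight_pos {r : ℝ} (hr : 0 < r) (b : Bool) (n : ℤ) : 0 < weight r b n := by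
  cases b <;> simp [weight] <;> positivity

lemma weight_not (r : ℝ) (b : Bool) (n : ℤ) : weight r (!b) n = weight r b (2 - n) := by
  cases b <;> simp [weight]

lemma weight_add {r : ℝ} (hr : 0 < r) (b : Bool) (n : ℤ) :
    weight r b (n - 1) + weight r b (n + 1) = (r + r⁻¹) * weight r b n := by
  have h := hr.ne'
  cases b <;> simp only [weight, Bool.false_eq_true, if_false, if_true]
  · rw [zpow_sub_one₀ h, zpow_add_one₀ h]; ring
  · rw [show 2 - (n - 1) = (2 - n) + 1 by ring, show 2 - (n + 1) = (2 - n) - 1 by ring,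
      zpow_sub_one₀ h, zpow_add_one₀ h]; ring

/-- The horizontal coordinate on the copy `b`. -/
def xCoord (r : ℝ) (b : Bool) : ℝ → ℝ := pl fun k => weight r b (2 * k)

/-- The vertical coordinate on the copy `b`. -/
def yCoord (r : ℝ) (b : Bool) : ℝ → ℝ := pl fun k => weight r b (2 * k + 1)

/-- The horizontal coordinate on the universal cover of the cylinder `k` of the copy `b`. -/
def cylCoord (r : ℝ) (b : Bool) (k : ℤ) : ℝ → ℝ :=
  pl fun j => if Even j then weight r b (2 * k) else weight r b (2 * k + 2)

lemma isOpenEmbedding_coord {r : ℝ} (hr : 0 < r) (b : Bool) :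
    IsOpenEmbedding fun z : ℝ × ℝ => (⟨xCoord r b z.1, yCoord r b z.2⟩ : ℂ) :=
  Complex.equivRealProdCLM.symm.toHomeomorph.isOpenEmbedding.comp
    ((isOpenEmbedding_pl fun k => weight_pos hr b (2 * k)).prodMap
      (isOpenEmbedding_pl fun k => weight_pos hr b (2 * k + 1)))

lemma cylCoord_eq_left (r : ℝ) (b : Bool) (k : ℤ) {x : ℝ} (h0 : 0 ≤ x) (h1 : x ≤ 1) :
    cylCoord r b k x = weight r b (2 * k) * x := by
  rw [cylCoord, pl_eq _ (k := 0) (by simpa using h0) (by simpa using h1), cum_zero]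
  simp

lemma cylCoord_one (r : ℝ) (b : Bool) (k : ℤ) : cylCoord r b k 1 = weight r b (2 * k) := by
  rw [cylCoord_eq_left r b k zero_le_one le_rfl, mul_one]

lemma cylCoord_eq_right (r : ℝ) (b : Bool) (k : ℤ) {x : ℝ} (h0 : 1 ≤ x) (h1 : x ≤ 2) :
    cylCoord r b k x = weight r b (2 * k) + weight r b (2 * k + 2) * (x - 1) := by
  have h := cylCoord_one r b k
  have e := pl_int (fun j => if Even j then weight r b (2 * k) else weight r b (2 * k + 2)) 1
  rw [Int.cast_one] at e
  rw [cylCoord, e] at h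
  rw [cylCoord, pl_eq _ (k := 1) (by simpa using h0) (by push_cast; linarith), h]
  simp

lemma cylCoord_add_two {r : ℝ} (hr : 0 < r) (b : Bool) (k : ℤ) (x : ℝ) :
    cylCoord r b k (x + 2) = cylCoord r b k x + (r + r⁻¹) * weight r b (2 * k + 1) := by
  have h := pl_shift (fun j => if Even j then weight r b (2 * k) else weight r b (2 * k + 2)) 2 x
  have e : (fun j : ℤ => if Even (j + 2) then weight r b (2 * k) else weight r b (2 * k + 2)) =
      fun j => if Even j then weight r b (2 * k) else weight r b (2 * k + 2) := by
    funext j; simp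
  rw [e] at h
  have h2 := cylCoord_eq_right r b k one_le_two le_rfl
  have h3 := weight_add hr b (2 * k + 1)
  rw [show 2 * k + 1 - 1 = 2 * k by ring, show 2 * k + 1 + 1 = 2 * k + 2 by ring] at h3
  unfold cylCoord at h2 ⊢
  push_cast at h
  linarith

lemma cylCoord_add_two_mul {r : ℝ} (hr : 0 < r) (b : Bool) (k : ℤ) (x : ℝ) (m : ℤ) :
    cylCoord r b k (x + 2 * m) =
      cylCoord r b k x + m * ((r + r⁻¹) * weight r b (2 * k + 1)) := by
  have hp : Function.Periodic (fun x => cylCoord r b k x -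
      x / 2 * ((r + r⁻¹) * weight r b (2 * k + 1))) 2 := fun x => by
    simp only [cylCoord_add_two hr]; ring
  have := hp.int_mul m x
  simp only [mul_comm (m : ℝ) 2] at this
  linarith

lemma cylCoord_not (r : ℝ) (b : Bool) (k : ℤ) (x : ℝ) :
    cylCoord r (!b) (-k) x = cylCoord r b k (x + 1) - weight r b (2 * k) := by
  have h := pl_shift (fun j => if Even j then weight r b (2 * k) else weight r b (2 * k + 2)) 1 x
  have e : (fun j : ℤ => if Even (j + 1) then weight r b (2 * k) else weight r b (2 * k + 2)) =
      fun j => if Even j then weight r (!b) (2 * -k) else weight r (!b) (2 * -k + 2) := by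
    funext j
    rw [weight_not, weight_not, show 2 - 2 * -k = 2 * k + 2 by ring,
      show 2 - (2 * -k + 2) = 2 * k by ring]
    by_cases hj : Even j <;> simp [hj]
  rw [e] at h
  rw [← cylCoord_one r b k]
  simpa [cylCoord] using h

lemma strictMono_cylCoord {r : ℝ} (hr : 0 < r) (b : Bool) (k : ℤ) : StrictMono (cylCoord r b k) :=
  strictMono_pl fun j => by split_ifs <;> exact weight_pos hr _ _

lemma continuous_cylCoord (r : ℝ) (b : Bool) (k : ℤ) : Continuous (cylCoord r b k) :=
  continuous_pl _

lemma circumference_pos {r : ℝ} (hr : 0 < r) (b : Bool) (n : ℤ) :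
    0 < (r + r⁻¹) * weight r b n :=
  mul_pos (by positivity) (weight_pos hr b n)

lemma surjective_cylCoord {r : ℝ} (hr : 0 < r) (b : Bool) (k : ℤ) :
    Function.Surjective (cylCoord r b k) := by
  have hw := circumference_pos hr b (2 * k + 1)
  have := surjective_of_add_two
    (f := fun x => cylCoord r b k x * (2 / ((r + r⁻¹) * weight r b (2 * k + 1))))
    ((continuous_cylCoord r b k).mul continuous_const) fun x => by
      rw [cylCoord_add_two hr, add_mul, mul_div_cancel₀ _ hw.ne']
  intro v
  obtain ⟨x, hx⟩ := this (v * (2 / ((r + r⁻¹) * weight r b (2 * k + 1))))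
  exact ⟨x, mul_right_cancel₀ (by positivity) hx⟩

lemma xCoord_add (r : ℝ) (b : Bool) (k : ℤ) {x : ℝ} (h0 : 0 ≤ x) (h2 : x ≤ 2) :
    xCoord r b (k + x) = xCoord r b k + cylCoord r b k x := by
  rw [xCoord, pl_int]
  rcases le_total x 1 with h | h
  · rw [pl_eq _ (k := k) (by linarith) (by linarith), cylCoord_eq_left r b k h0 h]
    ring
  · rw [pl_eq _ (k := k + 1) (by push_cast; linarith) (by push_cast; linarith), cum_add_one,
      cylCoord_eq_right r b k h h2, show 2 * (k + 1) = 2 * k + 2 by ring]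
    push_cast
    ring

lemma yCoord_add (r : ℝ) (b : Bool) (k : ℤ) {y : ℝ} (h0 : 0 ≤ y) (h1 : y ≤ 1) :
    yCoord r b (k + y) = yCoord r b k + weight r b (2 * k + 1) * y := by
  rw [yCoord, pl_int, pl_eq _ (k := k) (by linarith) (by linarith)]
  ring

/-- The chart on the copy `b` of the translation structure with parameter `r`. -/
def chart {r : ℝ} (hr : 0 < r) (b : Bool) : OpenPartialHomeomorph Surface ℂ :=
  (planar b).symm.trans ((isOpenEmbedding_coord hr b).toOpenPartialHomeomorph _)

lemma chart_source {r : ℝ} (hr : 0 < r) (b : Bool) : (chart hr b).source = pt b '' stair := by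
  simp [chart, planar_target]

lemma chart_pt {r : ℝ} (hr : 0 < r) (b : Bool) {z : ℝ × ℝ} (hz : z ∈ stair) :
    chart hr b (pt b z) = ⟨xCoord r b z.1, yCoord r b z.2⟩ := by
  change (fun z : ℝ × ℝ => (⟨xCoord r b z.1, yCoord r b z.2⟩ : ℂ)) ((planar b).symm (pt b z)) = _
  rw [planar_symm_pt b hz]

lemma pt_mem_chart_source {r : ℝ} (hr : 0 < r) (b : Bool) {z : ℝ × ℝ} (hz : z ∈ stair) :
    pt b z ∈ (chart hr b).source := by
  rw [chart_source]; exact ⟨z, hz, rfl⟩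

/-- The interior edges of one copy of the staircase are not in the other copy. -/
lemma vertical_edge_not_mem (b : Bool) {k : ℤ} {z : ℝ × ℝ} (hz : z ∈ row k) (h : z.1 = k + 1) :
    pt b z ∉ pt (!b) '' stair := by
  rintro ⟨w, hw, e⟩
  rw [pt_eq_iff hw (row_subset_stair k hz)] at e
  have key : ∀ l : ℤ, z ∉ col l := fun l hl => by
    have := (mem_col.1 hl).1
    rw [h] at this
    exact not_mem_Ioo_int (k := l) (l := k + 1) (by push_cast; linarith) (by push_cast; linarith)
  rcases e with ⟨e, -⟩ | ⟨-, e⟩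
  · simp at e
  · obtain ⟨l, ⟨⟨-, g⟩, -⟩ | ⟨⟨-, g⟩, -⟩⟩ := e.symm <;> exact key _ g

lemma horizontal_edge_not_mem (b : Bool) {j : ℤ} {x : ℝ} (h1 : j < x) (h2 : x < j + 1) :
    pt b (x, j) ∉ pt (!b) '' stair := by
  rintro ⟨w, hw, e⟩
  rw [pt_eq_iff hw (edge_mem_stair h1 h2)] at e
  have key : ∀ l : ℤ, (x, (j : ℝ)) ∉ row l := fun l hl => by
    have := (mem_row.1 hl).2
    exact not_mem_Ioo_int this.1 this.2
  rcases e with ⟨e, -⟩ | ⟨-, e⟩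
  · simp at e
  · obtain ⟨l, ⟨⟨g, -⟩, -⟩ | ⟨⟨g, -⟩, -⟩⟩ := e.symm <;> exact key _ g

/-- In cylinder coordinates, every chart is the chart of the universal cover of the cylinder, up
to a translation. -/
lemma chart_cyl {r : ℝ} (hr : 0 < r) (c : Bool) (k : ℤ) {x y : ℝ} (h0 : 0 < y) (h1 : y < 1)
    (hs : cyl false k (x, y) ∈ (chart hr c).source) :
    ∃ d : ℂ, ∀ᶠ w in 𝓝 (x, y), chart hr c (cyl false k w) =
      ⟨cylCoord r false k w.1, weight r false (2 * k + 1) * w.2⟩ + d := by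
  rw [chart_source] at hs
  have hx : ContinuousAt (fun w : ℝ × ℝ => w.1) (x, y) := by fun_prop
  have hy : ContinuousAt (fun w : ℝ × ℝ => w.2) (x, y) := by fun_prop
  cases c
  · obtain ⟨m, h2, h3⟩ : ∃ m : ℤ, 2 * m < x ∧ x < 2 * m + 2 := by
      rcases exists_int_Ioo x with h | ⟨m, h2, h3⟩
      · exact h
      rcases lt_trichotomy x (2 * m + 2) with h | h | h
      · exact ⟨m, by linarith, h⟩
      · rw [cyl_eq' _ _ m h2 h3 h0 h1] at hs
        refine absurd hs (vertical_edge_not_mem true (k := -k) (mem_row.2 ?_) ?_) <;>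
        push_cast
        · exact ⟨⟨by linarith, by linarith⟩, by linarith, by linarith⟩
        · linarith
      · exact ⟨m + 1, by push_cast; linarith, by push_cast; linarith⟩
    refine ⟨⟨xCoord r false k - m * ((r + r⁻¹) * weight r false (2 * k + 1)),
      yCoord r false k⟩, ?_⟩
    filter_upwards [hx.eventually (Ioo_mem_nhds h2 h3), hy.eventually (Ioo_mem_nhds h0 h1)]
      with w hw hw'
    rw [cyl_eq _ _ m hw.1 hw.2, chart_pt, xCoord_add, yCoord_add]
    · have e : w.1 - 2 * m = w.1 + 2 * ((-m : ℤ) : ℝ) := by push_cast; ring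
      rw [e, cylCoord_add_two_mul hr]
      apply Complex.ext
      · simp; ring
      · simp; ring
    · exact hw'.1.le
    · exact hw'.2.le
    · linarith [hw.1]
    · linarith [hw.2]
    · exact row_subset_stair k (mem_row_add.2 ⟨⟨by linarith [hw.1], by linarith [hw.2]⟩, hw'⟩)
  · obtain ⟨m, h2, h3⟩ : ∃ m : ℤ, 2 * m + 1 < x ∧ x < 2 * m + 3 := by
      rcases exists_int_Ioo x with ⟨m, h2, h3⟩ | h
      · rcases lt_trichotomy x (2 * m + 1) with h | h | h
        · exact ⟨m - 1, by push_cast; linarith, by push_cast; linarith⟩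
        · rw [cyl_eq _ _ m h2 h3] at hs
          refine absurd hs (vertical_edge_not_mem false (k := k) (mem_row.2 ?_) ?_)
          · exact ⟨⟨by linarith, by linarith⟩, by linarith, by linarith⟩
          · dsimp only; linarith
        · exact ⟨m, h, by linarith⟩
      · exact h
    refine ⟨⟨xCoord r true (-k : ℤ) - weight r false (2 * k) -
      m * ((r + r⁻¹) * weight r false (2 * k + 1)), yCoord r true (-k : ℤ)⟩, ?_⟩
    filter_upwards [hx.eventually (Ioo_mem_nhds h2 h3), hy.eventually (Ioo_mem_nhds h0 h1)]
      with w hw hw'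
    have e1 : (-k : ℝ) = ((-k : ℤ) : ℝ) := by push_cast; ring
    rw [cyl_eq' _ _ m hw.1 hw.2 hw'.1 hw'.2, Bool.not_false, e1, chart_pt, xCoord_add, yCoord_add]
    · have e : w.1 - 1 - 2 * m = w.1 + 2 * ((-m : ℤ) : ℝ) - 1 := by push_cast; ring
      have e2 := cylCoord_not r false k (w.1 - 1 - 2 * m)
      rw [e, sub_add_cancel, cylCoord_add_two_mul hr, Bool.not_false] at e2
      have e3 := weight_not r false (2 * -k + 1)
      rw [show 2 - (2 * -k + 1) = 2 * k + 1 by ring, Bool.not_false] at e3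
      rw [e, e2, e3]
      apply Complex.ext
      · simp; ring
      · simp; ring
    · exact hw'.1.le
    · exact hw'.2.le
    · linarith [hw.1]
    · linarith [hw.2]
    · exact row_subset_stair _ (mem_row_add.2 ⟨⟨by linarith [hw.1], by linarith [hw.2]⟩, hw'⟩)

/-- The translation structure with parameter `r`, obtained from the square-tiled one by stretching
the squares to rectangles, so that the cylinders, numbered consecutively along the staircase, have
heights `r ^ n`. All vertices of the staircase are punctures (in the completion they have infinite
cone angle), so there are no conical singularities. -/
def stretched {r : ℝ} (hr : 0 < r) : TranslationStructure Surface where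
  sing := ∅
  charts := range (chart hr)
  discrete := inferInstance
  source_subset := by simp
  cover x _ := by
    obtain ⟨b, z, hz, rfl⟩ := exists_pt x
    exact ⟨_, ⟨b, rfl⟩, pt_mem_chart_source hr b hz⟩
  translation := by
    rintro _ ⟨b, rfl⟩ _ ⟨b', rfl⟩ x ⟨hx, hx'⟩
    rcases cyl_or_edge x with ⟨k, u, v, h0, h1, rfl⟩ | ⟨c, j, u, h1, h2, rfl⟩
    · obtain ⟨d, hd⟩ := chart_cyl hr b k h0 h1 hx
      obtain ⟨d', hd'⟩ := chart_cyl hr b' k h0 h1 hx'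
      refine ⟨d' - d, ?_⟩
      rw [nhds_cyl false k h0 h1, eventually_map]
      filter_upwards [hd, hd'] with w e e'
      rw [e, e']
      ring
    · have h : ∀ b, pt c (u, j) ∈ (chart hr b).source → b = c := by
        intro b hb
        by_contra hne
        obtain rfl : b = !c := by revert hne; cases b <;> cases c <;> simp
        rw [chart_source] at hb
        exact horizontal_edge_not_mem c h1 h2 hb
      rw [h b hx, h b' hx']
      exact ⟨0, Eventually.of_forall fun y => by simp⟩
  conical := by simp

lemma stretched_sing {r : ℝ} (hr : 0 < r) : (stretched hr).sing = ∅ := rfl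

lemma stretched_hasDerivative {r : ℝ} {hr : 0 < r} {φ : Surface ≃ₜ Surface}
    {A : Matrix (Fin 2) (Fin 2) ℝ}
    (h : ∀ x, ∃ b b', x ∈ (chart hr b).source ∧ φ x ∈ (chart hr b').source ∧
      ∃ c : ℂ, ∀ᶠ y in 𝓝 x, chart hr b' (φ y) = planeMap A (chart hr b y) + c) :
    (stretched hr).HasDerivative φ A := by
  refine TranslationStructure.hasDerivative_of_local ?_ fun x _ => ?_
  · rw [stretched_sing, image_empty]
  · obtain ⟨b, b', h1, h2, h3⟩ := h x
    exact ⟨_, ⟨b, rfl⟩, _, ⟨b', rfl⟩, h1, h2, h3⟩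

lemma exists_chart {r : ℝ} (hr : 0 < r) (x : Surface) : ∃ b, x ∈ (chart hr b).source := by
  obtain ⟨b, z, hz, rfl⟩ := exists_pt x
  exact ⟨b, pt_mem_chart_source hr b hz⟩

/-- The derivative of the reflection is the exchange of the coordinates, scaled by `r`. -/
lemma hasDerivative_reflection {r : ℝ} (hr : 0 < r) :
    (stretched hr).HasDerivative reflection !![0, r; r, 0] := by
  refine stretched_hasDerivative fun x => ?_
  obtain ⟨b, z, hz, rfl⟩ := exists_pt x
  refine ⟨b, b, pt_mem_chart_source hr b hz, ?_, ?_⟩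
  · rw [reflection_pt b hz]; exact pt_mem_chart_source hr b (reflMap_mem hz)
  have h0 := hr.ne'
  have hx : ∃ c, ∀ y, xCoord r b (y + if b then 0 else 1) = r * yCoord r b y + c := by
    cases b
    · refine ⟨xCoord r false 1, fun y => ?_⟩
      have := pl_shift (fun k => weight r false (2 * k)) 1 y
      have e : (fun j => weight r false (2 * (j + 1))) =
          fun k => r * weight r false (2 * k + 1) := by
        funext j
        simp only [weight, Bool.false_eq_true, if_false]
        rw [show 2 * (j + 1) = 1 + (2 * j + 1) by ring, zpow_add₀ h0, zpow_one]
      rw [e, pl_smul] at this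
      push_cast at this
      simp only [xCoord, yCoord, Bool.false_eq_true, if_false]
      linarith
    · refine ⟨0, fun y => ?_⟩
      simp only [xCoord, yCoord, if_true, add_zero]
      rw [← pl_smul]
      congr 1
      funext j
      simp only [weight, if_true]
      rw [show 2 - 2 * j = 1 + (2 - (2 * j + 1)) by ring, zpow_add₀ h0, zpow_one]
  have hy : ∃ c, ∀ x, yCoord r b (x - if b then 1 else 0) = r * xCoord r b x + c := by
    cases b
    · refine ⟨0, fun y => ?_⟩
      simp only [xCoord, yCoord, Bool.false_eq_true, if_false, add_zero, sub_zero]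
      rw [← pl_smul]
      congr 1
      funext j
      simp only [weight, Bool.false_eq_true, if_false]
      rw [zpow_add₀ h0, zpow_one, mul_comm]
    · refine ⟨yCoord r true (-1), fun y => ?_⟩
      have := pl_shift (fun k => weight r true (2 * k + 1)) (-1) y
      have e : (fun j => weight r true (2 * (j + -1) + 1)) =
          fun k => r * weight r true (2 * k) := by
        funext j
        simp only [weight, if_true]
        rw [show 2 - (2 * (j + -1) + 1) = 1 + (2 - 2 * j) by ring, zpow_add₀ h0, zpow_one]
      rw [e, pl_smul] at this
      push_cast at this
      simp only [xCoord, yCoord, if_true, sub_eq_add_neg]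
      linarith
  obtain ⟨c, hc⟩ := hx
  obtain ⟨d, hd⟩ := hy
  refine ⟨⟨c, d⟩, ?_⟩
  rw [nhds_pt b hz, eventually_map]
  filter_upwards [eventually_stair hz] with w hw
  rw [reflection_pt b hw, chart_pt hr b (reflMap_mem hw), chart_pt hr b hw]
  have e : reflMap b w = (w.2 + if b then 0 else 1, w.1 - if b then 1 else 0) := by
    cases b <;> simp [reflMap]
  rw [e, hc, hd]
  apply Complex.ext <;> simp [planeMap]

/-! ### Affine twists -/

/-- The affine twist along the horizontal cylinders of the translation structure with parameter
`r`: a full turn of every cylinder. All of these cylinders have modulus `r + r⁻¹`. -/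
def affineTwist {r : ℝ} (hr : 0 < r) : LeafMap Unit where
  toFun _ k x y := (surjective_cylCoord hr false k
    (cylCoord r false k x + (r + r⁻¹) * weight r false (2 * k + 1) * y)).choose
  turns := 1
  continuous_toFun k := by
    have := continuous_inverse_family (Z := Unit) (F := fun _ => cylCoord r false k)
      (G := fun _ v => (surjective_cylCoord hr false k v).choose)
      ((continuous_cylCoord r false k).comp continuous_snd)
      (fun _ => strictMono_cylCoord hr false k)
      fun _ v => (surjective_cylCoord hr false k v).choose_spec
    refine this.comp (g := fun q : Unit × ℝ => (surjective_cylCoord hr false k q.2).choose)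
      (f := fun q : Unit × (ℝ × ℝ) => (q.1, cylCoord r false k q.2.1 +
        (r + r⁻¹) * weight r false (2 * k + 1) * q.2.2)) ?_
    have := continuous_cylCoord r false k
    fun_prop
  strictMono _ k y a b hab := by
    rw [← (strictMono_cylCoord hr false k).lt_iff_lt]
    simp only [(surjective_cylCoord hr false k _).choose_spec]
    linarith [strictMono_cylCoord hr false k hab]
  add_two _ k x y := by
    apply (strictMono_cylCoord hr false k).injective
    simp only [(surjective_cylCoord hr false k _).choose_spec, cylCoord_add_two hr]
    ring
  bot _ k x := by
    apply (strictMono_cylCoord hr false k).injective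
    rw [(surjective_cylCoord hr false k _).choose_spec, mul_zero, add_zero]
  top _ k x := by
    apply (strictMono_cylCoord hr false k).injective
    rw [(surjective_cylCoord hr false k _).choose_spec, Int.cast_one, mul_one, mul_one,
      cylCoord_add_two hr]

lemma cylCoord_affineTwist {r : ℝ} (hr : 0 < r) (k : ℤ) (x y : ℝ) :
    cylCoord r false k ((affineTwist hr).toFun () k x y) =
      cylCoord r false k x + (r + r⁻¹) * weight r false (2 * k + 1) * y :=
  (surjective_cylCoord hr false k _).choose_spec

lemma cylCoord_leafCopy {r : ℝ} (hr : 0 < r) (b : Bool) (k : ℤ) (x y : ℝ) :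
    cylCoord r b k (leafCopy b ((affineTwist hr).toFun ()) k x y) =
      cylCoord r b k x + (r + r⁻¹) * weight r b (2 * k + 1) * y := by
  cases b
  · exact cylCoord_affineTwist hr k x y
  · have e : ∀ t, cylCoord r true k t =
        cylCoord r false (-k) (t + 1) - weight r false (2 * -k) := fun t => by
      simpa using cylCoord_not r false (-k) t
    have e3 := weight_not r false (2 * k + 1)
    rw [show 2 - (2 * k + 1) = 2 * -k + 1 by ring, Bool.not_false] at e3
    rw [e, e, e3]
    simp only [leafCopy, if_true, sub_add_cancel, cylCoord_affineTwist]
    ring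

lemma hasDerivative_affineTwist {r : ℝ} (hr : 0 < r) :
    (stretched hr).HasDerivative ((affineTwist hr).twist ()) !![1, r + r⁻¹; 0, 1] := by
  refine stretched_hasDerivative fun p => ?_
  rcases cyl_or_edge p with ⟨k, x, y, h0, h1, rfl⟩ | ⟨b, j, x, h1, h2, rfl⟩
  · obtain ⟨b, hb⟩ := exists_chart hr (cyl false k (x, y))
    obtain ⟨b', hb'⟩ := exists_chart hr ((affineTwist hr).twist () (cyl false k (x, y)))
    refine ⟨b, b', hb, hb', ?_⟩
    rw [LeafMap.twist_cyl _ _ _ h0 h1] at hb'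
    obtain ⟨d, hd⟩ := chart_cyl hr b k h0 h1 hb
    obtain ⟨d', hd'⟩ := chart_cyl hr b' k h0 h1 hb'
    refine ⟨d' - planeMap !![1, r + r⁻¹; 0, 1] d, ?_⟩
    rw [nhds_cyl false k h0 h1, eventually_map]
    have hc : Continuous fun w : ℝ × ℝ => ((affineTwist hr).toFun () k w.1 w.2, w.2) := by
      have := ((affineTwist hr).continuous_toFun k).comp
        (by fun_prop : Continuous fun w : ℝ × ℝ => ((), w))
      exact this.prodMk continuous_snd
    have hy : ContinuousAt (fun w : ℝ × ℝ => w.2) (x, y) := by fun_prop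
    filter_upwards [hd, hc.continuousAt.eventually hd', hy.eventually (Ioo_mem_nhds h0 h1)]
      with w e e' hw
    rw [← Prod.mk.eta (p := w)] at e ⊢
    rw [LeafMap.twist_cyl _ _ _ hw.1 hw.2, e', e, planeMap_add, cylCoord_affineTwist]
    apply Complex.ext <;> simp [planeMap]
    ring
  · have hst := edge_mem_stair h1 h2
    refine ⟨b, b, pt_mem_chart_source hr b hst, ?_, ?_⟩
    · rw [LeafMap.twist_edge _ _ ⟨b, j, x, h1, h2, rfl⟩]
      exact pt_mem_chart_source hr b hst
    refine ⟨⟨-((r + r⁻¹) * yCoord r b j), 0⟩, ?_⟩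
    rw [nhds_pt b hst, eventually_map]
    have hp : Continuous fun w : ℝ × ℝ => ((() : Unit), w) := by fun_prop
    have hev := hp.continuousAt.eventually ((affineTwist hr).eventually_leafwise_edge b h1 h2 ())
    have hec := ((affineTwist hr).continuous_edgeCoord b j).comp hp
    have he := (affineTwist hr).edgeCoord_edge b j () x
    have hq1 : ContinuousAt (fun q : ℝ × ℝ => q.1) (x, (j : ℝ)) := by fun_prop
    have hq2 : ContinuousAt (fun q : ℝ × ℝ => q.2) (x, (j : ℝ)) := by fun_prop
    filter_upwards [hev, eventually_stair hst,
      hec.continuousAt.eventually (Ioo_mem_nhds (h1.trans_eq he.symm) (he.trans_lt h2)),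
      hq1.eventually (Ioo_mem_nhds h1 h2),
      hq2.eventually (Ioo_mem_nhds (show (j : ℝ) - 1 < j by linarith)
        (show (j : ℝ) < j + 1 by linarith))] with w hw hws hwe hw1 hw2
    dsimp only [Function.comp_apply] at hw hwe hw1 hw2
    rw [LeafMap.twist_apply, hw, chart_pt hr b hws, chart_pt hr b]
    · suffices h : xCoord r b ((affineTwist hr).edgeCoord b j () w) =
          xCoord r b w.1 + (r + r⁻¹) * (yCoord r b w.2 - yCoord r b j) by
        apply Complex.ext
        · simp [planeMap, h]; ring
        · simp [planeMap]
      rw [LeafMap.edgeCoord] at hwe ⊢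
      split_ifs at hwe ⊢ with hj
      · rw [xCoord_add r b j (by linarith [hwe.1]) (by linarith [hwe.2]), cylCoord_leafCopy]
        have e1 := xCoord_add r b j (x := w.1 - j) (by linarith [hw1.1]) (by linarith [hw1.2])
        have e2 := yCoord_add r b j (y := w.2 - j) (by linarith) (by linarith [hw2.2])
        rw [add_sub_cancel] at e1 e2
        rw [e1, e2]
        ring
      · set P := leafCopy b ((affineTwist hr).toFun ()) (j - 1) (w.1 - j + 1) (w.2 - j + 1) with hP
        have ht : ((affineTwist hr).turns : ℝ) = 1 := by simp [affineTwist]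
        rw [ht] at hwe ⊢
        have e0 : (j : ℝ) - 1 + P - 2 * 1 = ((j - 1 : ℤ) : ℝ) + (P + 2 * ((-1 : ℤ) : ℝ)) := by
          push_cast; ring
        have hy : (j : ℝ) = ((j - 1 : ℤ) : ℝ) + 1 := by push_cast; ring
        rw [e0, xCoord_add r b (j - 1) (by push_cast; linarith [hwe.1])
          (by push_cast; linarith [hwe.2]), cylCoord_add_two_mul hr, hP, cylCoord_leafCopy]
        have e1 := xCoord_add r b (j - 1) (x := w.1 - j + 1) (by linarith [hw1.1])
          (by linarith [hw1.2])
        have e2 := yCoord_add r b (j - 1) (y := w.2 - j + 1) (by linarith [hw2.1])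
          (by linarith)
        have e3 := yCoord_add r b (j - 1) (y := 1) (by linarith) (by linarith)
        rw [← hy] at e3
        rw [show ((j - 1 : ℤ) : ℝ) + (w.1 - j + 1) = w.1 by push_cast; ring] at e1
        rw [show ((j - 1 : ℤ) : ℝ) + (w.2 - j + 1) = w.2 by push_cast; ring] at e2
        rw [e1, e2, e3]
        push_cast
        ring
    · exact col_subset_stair j (mem_col.2 ⟨hwe, hw2⟩)

/-- The commutator of the affine twist and the reflection. It is affine, the product of the affine
twists along the horizontal and along the vertical cylinders. -/
def affineProduct {r : ℝ} (hr : 0 < r) : Surface ≃ₜ Surface :=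
  (affineTwist hr).twist () * (reflection * ((affineTwist hr).twist ())⁻¹ * reflection⁻¹)

lemma hasDerivative_affineProduct {r : ℝ} (hr : 0 < r) :
    (stretched hr).HasDerivative (affineProduct hr)
      !![1 - (r + r⁻¹) ^ 2, r + r⁻¹; -(r + r⁻¹), 1] := by
  have h0 := hr.ne'
  have hT := hasDerivative_affineTwist hr
  have hI := hasDerivative_reflection hr
  have hT' := hT.inv (B := !![1, -(r + r⁻¹); 0, 1]) (by
    ext i j; fin_cases i <;> fin_cases j <;> simp [Matrix.mul_apply, Fin.sum_univ_two])
  have hI' := hI.inv (B := !![0, r⁻¹; r⁻¹, 0]) (by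
    ext i j; fin_cases i <;> fin_cases j <;> simp [Matrix.mul_apply, Fin.sum_univ_two, h0])
  have := hT.mul ((hI.mul hT').mul hI')
  have e : (!![1 - (r + r⁻¹) ^ 2, r + r⁻¹; -(r + r⁻¹), 1] : Matrix (Fin 2) (Fin 2) ℝ) =
      !![1, r + r⁻¹; 0, 1] * (!![0, r; r, 0] * !![1, -(r + r⁻¹); 0, 1] * !![0, r⁻¹; r⁻¹, 0]) := by
    ext i j
    fin_cases i <;> fin_cases j <;> simp [Matrix.mul_apply, Fin.sum_univ_two] <;> field_simp; ring
  rw [e]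
  exact this

end Staircase

/-! ### Orientations -/

/-- A map that is locally a real-linear map `w ↦ a * w + b * conj w` with `‖b‖ < ‖a‖`, up to a
constant, preserves the orientation: the argument of
`a * exp (it) + b * exp (-it) = a * exp (it) * (1 + (b / a) * exp (-2it))` is continuous, and turns
once, since the last factor has positive real part. -/
lemma preservesOrientationAt_of_linear {g : ℂ → ℂ} {z a b c : ℂ} (hab : ‖b‖ < ‖a‖)
    (h : ∀ᶠ w in 𝓝 z, g w = a * w + b * (starRingEnd ℂ) w + c) : PreservesOrientationAt g z := by
  obtain ⟨ε, hε, hb⟩ := Metric.eventually_nhds_iff_ball.1 h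
  have ha : a ≠ 0 := by
    rintro rfl
    rw [norm_zero] at hab
    exact absurd (norm_nonneg b) hab.not_ge
  filter_upwards [Ioo_mem_nhdsGT hε] with r hr
  let κ : ℝ → ℂ := fun t => 1 + b / a * Complex.exp (-(2 * t * Complex.I))
  have hκ : ∀ t, κ t ∈ Complex.slitPlane := by
    intro t
    left
    have h1 : ‖b / a * Complex.exp (-(2 * t * Complex.I))‖ < 1 := by
      have : (-(2 * t * Complex.I) : ℂ) = ((-2 * t : ℝ) : ℂ) * Complex.I := by push_cast; ring
      rw [norm_mul, this, Complex.norm_exp_ofReal_mul_I, mul_one, norm_div,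
        div_lt_one (norm_pos_iff.2 ha)]
      exact hab
    have h2 := (abs_le.1 (Complex.abs_re_le_norm
      (b / a * Complex.exp (-(2 * t * Complex.I))))).1
    simp only [κ, Complex.add_re, Complex.one_re]
    linarith
  refine ⟨fun t => t + Complex.arg a + Complex.arg (κ t), ?_, fun t => ?_, ?_⟩
  · refine (continuous_id.add continuous_const).add ?_
    rw [continuous_iff_continuousAt]
    intro t
    exact (Complex.continuousAt_arg (hκ t)).comp (by fun_prop)
  · have hmem : z + r * Complex.exp (t * Complex.I) ∈ Metric.ball z ε := by
      rw [Metric.mem_ball, dist_eq_norm, add_sub_cancel_left, norm_mul,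
        Complex.norm_exp_ofReal_mul_I, mul_one, Complex.norm_real, Real.norm_of_nonneg hr.1.le]
      exact hr.2
    have e : g (z + r * Complex.exp (t * Complex.I)) - g z =
        r * (Complex.exp (t * Complex.I) * (a * κ t)) := by
      rw [hb _ hmem, hb z (Metric.mem_ball_self hε)]
      have hconj : (starRingEnd ℂ) (Complex.exp (t * Complex.I)) =
          Complex.exp (t * Complex.I) * Complex.exp (-(2 * t * Complex.I)) := by
        rw [← Complex.exp_conj, ← Complex.exp_add]
        congr 1
        simp
        ring
      simp only [map_add, map_mul, Complex.conj_ofReal, hconj, κ]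
      field_simp
      ring
    rw [e, norm_mul, norm_mul, Complex.norm_exp_ofReal_mul_I, norm_mul, Complex.norm_real,
      Real.norm_of_nonneg hr.1.le, one_mul]
    push_cast
    rw [add_mul, add_mul, Complex.exp_add, Complex.exp_add]
    conv_lhs => rw [← Complex.norm_mul_exp_arg_mul_I a, ← Complex.norm_mul_exp_arg_mul_I (κ t)]
    ring
  · have : κ (2 * Real.pi) = κ 0 := by
      simp only [κ]
      congr 2
      rw [show (-(2 * ((2 * Real.pi : ℝ) : ℂ) * Complex.I) : ℂ) =
        ((-2 : ℤ) : ℂ) * (2 * Real.pi * Complex.I) by push_cast; ring,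
        Complex.exp_int_mul_two_pi_mul_I]
      simp
    dsimp only
    rw [this]
    ring

lemma preservesOrientationAt_of_planeMap {g : ℂ → ℂ} {z c : ℂ} {A : Matrix (Fin 2) (Fin 2) ℝ}
    (hA : 0 < A 0 0 * A 1 1 - A 0 1 * A 1 0) (h : ∀ᶠ w in 𝓝 z, g w = planeMap A w + c) :
    PreservesOrientationAt g z := by
  refine preservesOrientationAt_of_linear (a := ⟨(A 0 0 + A 1 1) / 2, (A 1 0 - A 0 1) / 2⟩)
    (b := ⟨(A 0 0 - A 1 1) / 2, (A 1 0 + A 0 1) / 2⟩) (c := c) ?_ ?_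
  · rw [← sq_lt_sq₀ (norm_nonneg _) (norm_nonneg _), Complex.sq_norm, Complex.sq_norm,
      Complex.normSq_mk, Complex.normSq_mk]
    nlinarith
  · filter_upwards [h] with w hw
    rw [hw]
    congr 1
    apply Complex.ext <;> simp [planeMap] <;> ring

/-- The orientation of a surface that carries a translation structure without singularities. -/
def TranslationStructure.orientation {S : Type*} [TopologicalSpace S] (M : TranslationStructure S)
    (hM : M.sing = ∅) : SurfaceOrientation S where
  charts := M.charts
  cover x := M.cover x (by simp [hM])
  compatible e he e' he' x hx := by
    obtain ⟨c, hc⟩ := M.translation e he e' he' x hx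
    refine preservesOrientationAt_of_planeMap (A := 1) (c := c) (by simp) ?_
    have h1 := (e.continuousAt_symm (e.map_source hx.1)).eventually
      (p := fun y => e' y = e y + c) (by rwa [e.left_inv hx.1])
    filter_upwards [h1, e.open_target.mem_nhds (e.map_source hx.1)] with w hw hw'
    rw [hw, e.right_inv hw', planeMap_one]

lemma TranslationStructure.HasDerivative.isOrientationPreserving {S : Type*} [TopologicalSpace S]
    {M : TranslationStructure S} {hM : M.sing = ∅} {φ : S ≃ₜ S} {A : Matrix (Fin 2) (Fin 2) ℝ}
    (h : M.HasDerivative φ A) (hA : 0 < A 0 0 * A 1 1 - A 0 1 * A 1 0) :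
    IsOrientationPreserving (M.orientation hM) φ := by
  intro e he e' he' x hx hx'
  obtain ⟨c, hc⟩ := h.2 e he e' he' x hx hx'
  refine preservesOrientationAt_of_planeMap (c := c) hA ?_
  have h1 := (e.continuousAt_symm (e.map_source hx)).eventually
    (p := fun y => e' (φ y) = planeMap A (e y) + c) (by rwa [e.left_inv hx])
  filter_upwards [h1, e.open_target.mem_nhds (e.map_source hx)] with w hw hw'
  rw [hw, e.right_inv hw']

namespace Staircase

/-- The orientation of the staircase surface given by its square-tiled translation structure. -/
def orientation : SurfaceOrientation Surface := (stretched one_pos).orientation rfl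

/-! ### The cylinders as annuli -/

/-- The map from the line times an arbitrary space onto the circle times the space. -/
lemma isQuotientMap_exp_prod (X : Type*) [TopologicalSpace X] :
    IsQuotientMap fun q : ℝ × X => (Circle.exp q.1, q.2) := by
  have h1 : IsOpenMap Circle.exp := Circle.isCoveringMap_exp.isLocalHomeomorph.isOpenMap
  have h2 : IsOpenMap (Prod.map Circle.exp (id : X → X)) := h1.prodMap IsOpenMap.id
  refine h2.isQuotientMap (Circle.exp.continuous.prodMap continuous_id) ?_
  exact Function.Surjective.prodMap (fun z => ⟨_, Circle.exp_arg z⟩) Function.surjective_id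

lemma cyl_arg (k : ℤ) (s y : ℝ) :
    cyl false k (Complex.arg (Circle.exp s) / Real.pi, y) = cyl false k (s / Real.pi, y) := by
  have h := Circle.exp_arg (Circle.exp s)
  rw [Circle.exp_eq_exp] at h
  obtain ⟨m, hm⟩ := h
  have hpi := Real.pi_ne_zero
  rw [hm, ← cyl_add_int false k m (s / Real.pi)]
  congr 2
  field_simp

/-- The closed annulus with core curve the core of the `k`-th horizontal cylinder, of half the
height of the cylinder. -/
def annulus (k : ℤ) : C(Circle × unitInterval, Surface) where
  toFun q := cyl false k (Complex.arg q.1 / Real.pi, 1 / 4 + (q.2 : ℝ) / 2)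
  continuous_toFun := by
    rw [(isQuotientMap_exp_prod unitInterval).continuous_iff, continuous_iff_continuousAt]
    rintro ⟨s, t⟩
    have e : ((fun q : Circle × unitInterval =>
        cyl false k (Complex.arg q.1 / Real.pi, 1 / 4 + (q.2 : ℝ) / 2)) ∘
        fun q : ℝ × unitInterval => (Circle.exp q.1, q.2)) =
        fun q => cyl false k (q.1 / Real.pi, 1 / 4 + (q.2 : ℝ) / 2) :=
      funext fun q => cyl_arg k q.1 _
    rw [e]
    have h0 := t.2.1
    have h1 := t.2.2
    exact ContinuousAt.comp (g := cyl false k)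
      (f := fun q : ℝ × unitInterval => (q.1 / Real.pi, 1 / 4 + (q.2 : ℝ) / 2))
      (continuousAt_cyl false k (by linarith) (by linarith)) (by fun_prop)

lemma annulus_exp (k : ℤ) (s : ℝ) (t : unitInterval) :
    annulus k (Circle.exp s, t) = cyl false k (s / Real.pi, 1 / 4 + (t : ℝ) / 2) := cyl_arg k s _

lemma annulus_injective (k : ℤ) : Function.Injective (annulus k) := by
  rintro ⟨z, t⟩ ⟨z', t'⟩ h
  rw [← Circle.exp_arg z, ← Circle.exp_arg z', annulus_exp, annulus_exp] at h
  have h0 := t.2.1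
  have h1 := t.2.2
  have h0' := t'.2.1
  have h1' := t'.2.2
  obtain ⟨-, e, m, hm⟩ := cyl_inj (by linarith) (by linarith) (by linarith) (by linarith) h
  have hpi := Real.pi_ne_zero
  refine Prod.ext ?_ (Subtype.ext (by linarith))
  rw [← Circle.exp_arg z, ← Circle.exp_arg z']
  symm
  rw [Circle.exp_eq_exp]
  refine ⟨m, ?_⟩
  field_simp at hm
  linarith

lemma mem_range_annulus {k : ℤ} {p : Surface} : p ∈ range (annulus k) ↔
    ∃ x y : ℝ, 1 / 4 ≤ y ∧ y ≤ 3 / 4 ∧ p = cyl false k (x, y) := by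
  constructor
  · rintro ⟨⟨z, t⟩, rfl⟩
    rw [← Circle.exp_arg z, annulus_exp]
    exact ⟨_, _, by linarith [t.2.1], by linarith [t.2.2], rfl⟩
  · rintro ⟨x, y, h0, h1, rfl⟩
    refine ⟨(Circle.exp (x * Real.pi), ⟨2 * y - 1 / 2, by linarith, by linarith⟩), ?_⟩
    rw [annulus_exp, mul_div_cancel_right₀ _ Real.pi_ne_zero]
    congr 2
    dsimp only
    ring

lemma rowFun_ne_one_of_mem_annulus {k : ℤ} {p : Surface} (hp : p ∈ range (annulus k)) :
    rowFun k p ≠ 1 := by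
  obtain ⟨x, y, h0, h1, rfl⟩ := mem_range_annulus.1 hp
  rw [rowFun_cyl k k (by linarith) (by linarith), if_pos rfl]
  exact wrap_ne_one (by linarith) (by linarith)

lemma rowFun_unique {j k : ℤ} {p : Surface} (hj : rowFun j p ≠ 1) (hk : rowFun k p ≠ 1) :
    j = k := by
  rcases cyl_or_edge p with ⟨l, x, y, h0, h1, rfl⟩ | hp
  · rw [rowFun_cyl _ _ h0 h1] at hj hk
    by_contra h
    split_ifs at hj hk <;> first | exact hj rfl | exact hk rfl | omega
  · exact absurd (rowFun_edge j hp) hj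

lemma disjoint_annulus {j k : ℤ} (h : j ≠ k) : Disjoint (range (annulus j)) (range (annulus k)) :=
  Set.disjoint_left.2 fun _ hj hk =>
    h (rowFun_unique (rowFun_ne_one_of_mem_annulus hj) (rowFun_ne_one_of_mem_annulus hk))

lemma locallyFinite_annulus : LocallyFinite fun k => range (annulus k) := by
  intro p
  obtain ⟨b, z, hz, rfl⟩ := exists_pt p
  have hU : IsOpen (stair ∩ {w | z.2 - 1 < w.2 ∧ w.2 < z.2 + 1}) :=
    isOpen_stair.inter ((isOpen_lt continuous_const continuous_snd).inter
      (isOpen_lt continuous_snd continuous_const))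
  refine ⟨_, (isOpen_image_pt b hU inter_subset_left).mem_nhds
    ⟨z, ⟨hz, by linarith, by linarith⟩, rfl⟩, ?_⟩
  refine (finite_Icc (-⌈|z.2| + 2⌉) ⌈|z.2| + 2⌉).subset ?_
  rintro i ⟨_, hi, w, ⟨hw, hw1, hw2⟩, rfl⟩
  have h := rowFun_ne_one_of_mem_annulus hi
  rw [rowFun_pt i b hw] at h
  have h0 : 0 < w.2 - rowIdx b i := lt_of_not_ge fun h' => h (wrap_of_le_zero h')
  have h1 : w.2 - rowIdx b i < 1 := lt_of_not_ge fun h' => h (wrap_of_one_le h')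
  have hc := Int.le_ceil (|z.2| + 2)
  have ha := abs_le.1 (le_refl |z.2|)
  have key : |(rowIdx b i : ℝ)| ≤ ⌈|z.2| + 2⌉ := abs_le.2 ⟨by linarith, by linarith⟩
  have key2 : |rowIdx b i| ≤ ⌈|z.2| + 2⌉ := by exact_mod_cast key
  have key3 : |rowIdx b i| = |i| := by cases b <;> simp [rowIdx]
  rw [key3] at key2
  exact abs_le.1 key2

/-- The core curve of the `k`-th horizontal cylinder. -/
def core (k : ℤ) : SimpleClosedCurve Surface where
  toMap := ⟨fun z => annulus k (z, ⟨1 / 2, by norm_num, by norm_num⟩), by fun_prop⟩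
  injective z z' h := congrArg Prod.fst (annulus_injective k h)

lemma core_exp (k : ℤ) (s : ℝ) :
    (core k).toMap (Circle.exp s) = cyl false k (s / Real.pi, 1 / 2) := by
  refine (annulus_exp k s _).trans ?_
  norm_num

lemma core_image (k : ℤ) : (core k).image = annulus k '' {p | (p.2 : ℝ) = 1 / 2} := by
  ext p
  constructor
  · rintro ⟨z, rfl⟩
    exact ⟨_, rfl, rfl⟩
  · rintro ⟨⟨z, t⟩, ht, rfl⟩
    refine ⟨z, ?_⟩
    have : t = ⟨1 / 2, by norm_num, by norm_num⟩ := Subtype.ext ht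
    rw [this]
    rfl

/-- The Dehn twists along the cores of all horizontal cylinders, supported in the annuli of half
the height. -/
def dehnTwist : LeafMap Unit where
  toFun _ _ x y := x + 2 * clamp (2 * y - 1 / 2)
  turns := 1
  continuous_toFun k := by
    have := continuous_clamp
    fun_prop
  strictMono _ k y a b hab := by simpa using hab
  add_two _ k x y := by ring
  bot _ k x := by rw [clamp_of_le_zero (by norm_num)]; ring
  top _ k x := by rw [clamp_of_one_le (by norm_num)]; norm_num

lemma dehnTwist_annulus (k : ℤ) (z : Circle) (t : unitInterval) :
    dehnTwist.twist () (annulus k (z, t)) =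
      annulus k (z * Circle.exp (2 * Real.pi * (t : ℝ)), t) := by
  have h0 := t.2.1
  have h1 := t.2.2
  have hpi := Real.pi_ne_zero
  rw [← Circle.exp_arg z, ← Circle.exp_add, annulus_exp, annulus_exp,
    LeafMap.twist_cyl _ _ _ (by linarith) (by linarith)]
  simp only [dehnTwist]
  rw [show 2 * (1 / 4 + (t : ℝ) / 2) - 1 / 2 = t by ring, clamp_of_mem h0 h1]
  congr 2
  field_simp

lemma dehnTwist_of_not_mem {p : Surface} (hp : ∀ k, p ∉ range (annulus k)) :
    dehnTwist.twist () p = p := by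
  rcases cyl_or_edge p with ⟨k, x, y, h0, h1, rfl⟩ | hp
  · rw [LeafMap.twist_cyl _ _ _ h0 h1]
    simp only [dehnTwist]
    rcases lt_or_ge y (1 / 4) with h | h
    · rw [clamp_of_le_zero (by linarith), mul_zero, add_zero]
    rcases lt_or_ge (3 / 4) y with h' | h'
    · rw [clamp_of_one_le (by linarith), ← cyl_add_int false k 1 x y]
      norm_num
    · exact absurd (mem_range_annulus.2 ⟨x, y, h, h', rfl⟩) (hp k)
  · exact LeafMap.twist_edge _ _ hp

lemma weight_one (b : Bool) (n : ℤ) : weight 1 b n = 1 := by cases b <;> simp [weight]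

lemma cylCoord_of_one (b : Bool) (k : ℤ) (x : ℝ) : cylCoord 1 b k x = x := by
  have hc : ∀ m, cum (fun _ => (1 : ℝ)) m = (m : ℝ) := by
    apply int_fun_ext
    · rw [cum_zero, Int.cast_zero]
    · intro m
      rw [cum_add_one]
      push_cast
      ring
  simp only [cylCoord, weight_one, ite_self, pl, hc]
  ring

/-- The image of a horizontal annulus under an affine homeomorphism is positively oriented if the
signs of the derivative and of the parametrization agree. -/
lemma isPositiveAnnulus {φ : Surface ≃ₜ Surface} {A : Matrix (Fin 2) (Fin 2) ℝ}
    (hφ : (stretched one_pos).HasDerivative φ A) {σ : ℝ}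
    (hA : 0 < σ * (A 0 0 * A 1 1 - A 0 1 * A 1 0)) (k : ℤ) {j : C(Circle × unitInterval, Surface)}
    (hj : ∀ (x : ℝ) (t : unitInterval), j (Circle.exp (2 * Real.pi * x), t) =
      φ (cyl false k (σ * (2 * x), 1 / 4 + (t : ℝ) / 2))) : IsPositiveAnnulus orientation j := by
  intro z h0 h1 e he hz
  have hproj : ∀ y : ℝ, 0 < y → y < 1 → ((projIcc 0 1 zero_le_one y : unitInterval) : ℝ) = y :=
    fun y h h' => by rw [projIcc_of_mem _ ⟨h.le, h'.le⟩]
  rw [hj, hproj _ h0 h1] at hz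
  set p := cyl false k (σ * (2 * z.re), 1 / 4 + z.im / 2) with hp
  obtain ⟨b, hb⟩ := exists_chart one_pos p
  obtain ⟨c, hc⟩ := hφ.2 (chart one_pos b) ⟨b, rfl⟩ e he p hb hz
  obtain ⟨d, hd⟩ := chart_cyl one_pos b k (by linarith) (by linarith) hb
  refine preservesOrientationAt_of_planeMap (A := A * !![2 * σ, 0; 0, 1 / 2])
    (c := planeMap A (⟨0, 1 / 4⟩ + d) + c) ?_ ?_
  · simp [Matrix.mul_apply, Fin.sum_univ_two]
    linarith
  have hcont : ContinuousAt (fun w : ℂ => (σ * (2 * w.re), 1 / 4 + w.im / 2)) z := by fun_prop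
  have hcyl : ContinuousAt (fun w : ℂ => cyl false k (σ * (2 * w.re), 1 / 4 + w.im / 2)) z :=
    ContinuousAt.comp (g := cyl false k)
      (continuousAt_cyl false k (by linarith) (by linarith)) hcont
  filter_upwards [hcont.eventually hd, hcyl.eventually hc,
    Complex.continuous_im.continuousAt.eventually (Ioo_mem_nhds h0 h1)] with w e1 e2 e3
  rw [hj, hproj _ e3.1 e3.2, e2, e1, ← add_assoc, planeMap_mul, ← planeMap_add,
    cylCoord_of_one, weight_one]
  congr 2
  apply Complex.ext <;> simp [planeMap] <;> ring

lemma hasDerivative_one {r : ℝ} (hr : 0 < r) : (stretched hr).HasDerivative 1 1 := by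
  have := (hasDerivative_reflection hr).mul ((hasDerivative_reflection hr).inv
    (B := !![0, r⁻¹; r⁻¹, 0]) (by
      ext i j; fin_cases i <;> fin_cases j <;> simp [Matrix.mul_apply, Fin.sum_univ_two, hr.ne']))
  rw [mul_inv_cancel] at this
  convert this using 1
  ext i j
  fin_cases i <;> fin_cases j <;> simp [Matrix.mul_apply, Fin.sum_univ_two, hr.ne']

/-- The Dehn twists along the cores of the horizontal cylinders form a right multitwist. -/
lemma isRightMultitwist_core : IsRightMultitwist orientation core (dehnTwist.twist ()) := by
  refine ⟨annulus, annulus_injective, fun i j h => disjoint_annulus h, locallyFinite_annulus,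
    core_image, fun k => ?_, dehnTwist_annulus, fun p hp => dehnTwist_of_not_mem hp⟩
  refine isPositiveAnnulus (hasDerivative_one one_pos) (σ := 1) (by simp) k fun x t => ?_
  have hpi := Real.pi_ne_zero
  rw [annulus_exp, Homeomorph.one_apply]
  congr 2
  field_simp

/-- The twists along the vertical cylinders, conjugate by the reflection to left twists along the
horizontal cylinders. -/
def verticalTwist : Surface ≃ₜ Surface := reflection * (dehnTwist.twist ())⁻¹ * reflection⁻¹

/-- The reflection exchanges left and right twists. -/
lemma isRightMultitwist_map_core :
    IsRightMultitwist orientation (fun k => (core k).map reflection) verticalTwist := by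
  let j : ℤ → C(Circle × unitInterval, Surface) := fun k =>
    ⟨fun q => reflection (annulus k (q.1⁻¹, q.2)), by fun_prop⟩
  have hj : ∀ k q, j k q = reflection (annulus k (q.1⁻¹, q.2)) := fun k q => rfl
  have hrange : ∀ k, range (j k) = reflection.symm ⁻¹' range (annulus k) := by
    intro k
    ext p
    constructor
    · rintro ⟨q, rfl⟩
      exact ⟨(q.1⁻¹, q.2), by rw [hj, reflection.symm_apply_apply]⟩
    · rintro ⟨q, hq⟩
      refine ⟨(q.1⁻¹, q.2), ?_⟩
      rw [hj, inv_inv, Prod.mk.eta, hq, reflection.apply_symm_apply]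
  refine ⟨j, fun k q q' h => ?_, fun i k h => ?_, ?_, fun k => ?_, fun k => ?_, fun k z t => ?_,
    fun p hp => ?_⟩
  · have := annulus_injective k (reflection.injective h)
    simp only [Prod.mk.injEq, inv_inj] at this
    exact Prod.ext this.1 this.2
  · simp only [hrange]
    exact (disjoint_annulus h).preimage _
  · simp only [hrange]
    exact locallyFinite_annulus.preimage_continuous reflection.symm.continuous
  · have : ((core k).map reflection).image = reflection '' (core k).image :=
      range_comp reflection (core k).toMap
    rw [this, core_image, image_image]
    ext p
    constructor
    · rintro ⟨q, hq, rfl⟩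
      exact ⟨(q.1⁻¹, q.2), hq, by rw [hj, inv_inv]⟩
    · rintro ⟨q, hq, rfl⟩
      exact ⟨(q.1⁻¹, q.2), hq, rfl⟩
  · refine isPositiveAnnulus (hasDerivative_reflection one_pos) (σ := -1) (by simp) k fun x t => ?_
    have hpi := Real.pi_ne_zero
    rw [hj, ← Circle.exp_neg, annulus_exp]
    congr 3
    field_simp
  · have h := dehnTwist_annulus k (z⁻¹ * Circle.exp (-(2 * Real.pi * t))) t
    rw [mul_assoc z⁻¹, ← Circle.exp_add, neg_add_cancel, Circle.exp_zero, mul_one] at h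
    change reflection ((dehnTwist.twist ()).symm (reflection.symm (j k (z, t)))) = _
    rw [hj, hj, reflection.symm_apply_apply]
    dsimp only
    rw [← h, (dehnTwist.twist ()).symm_apply_apply, mul_inv, ← Circle.exp_neg]
  · have h : dehnTwist.twist () (reflection.symm p) = reflection.symm p :=
      dehnTwist_of_not_mem fun k hk => hp k (by rw [hrange]; exact hk)
    change reflection ((dehnTwist.twist ()).symm (reflection.symm p)) = p
    conv_lhs => rw [← h]
    rw [(dehnTwist.twist ()).symm_apply_apply, reflection.apply_symm_apply]

/-- The affine product of twists is isotopic to the product of the two Dehn multitwists. -/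
lemma mk_affineProduct {r : ℝ} (hr : 0 < r) :
    (QuotientGroup.mk (affineProduct hr) : MappingClass Surface) =
      QuotientGroup.mk (dehnTwist.twist ()) * QuotientGroup.mk verticalTwist := by
  have h : (QuotientGroup.mk ((affineTwist hr).twist ()) : MappingClass Surface) =
      QuotientGroup.mk (dehnTwist.twist ()) := LeafMap.mk_twist_eq _ _ rfl
  rw [affineProduct, verticalTwist]
  simp only [QuotientGroup.mk_mul, QuotientGroup.mk_inv, h]

end Staircase

/-! ### Maps to the circle -/

/-- Homotopic maps to the circle differ by the exponential of a real function. -/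
lemma exists_log_of_homotopic {X : Type*} [TopologicalSpace X] {g₀ g₁ : C(X, Circle)}
    (h : g₀.Homotopic g₁) : ∃ θ : C(X, ℝ), ∀ x, g₁ x = g₀ x * Circle.exp (θ x) := by
  obtain ⟨F⟩ := h
  let H : C(unitInterval × X, Circle) := ⟨fun q => F q * (g₀ q.2)⁻¹, by fun_prop⟩
  have H0 : ∀ x, H (0, x) = Circle.exp ((0 : C(X, ℝ)) x) := fun x => by
    change F (0, x) * (g₀ x)⁻¹ = _
    simp
  let Θ := Circle.isCoveringMap_exp.liftHomotopy H 0 H0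
  refine ⟨⟨fun x => Θ (1, x), by fun_prop⟩, fun x => ?_⟩
  have := congrFun (Circle.isCoveringMap_exp.liftHomotopy_lifts H 0 H0) (1, x)
  change Circle.exp (Θ (1, x)) = F (1, x) * (g₀ x)⁻¹ at this
  change _ = _ * Circle.exp (Θ (1, x))
  rw [this, F.apply_one, mul_comm, inv_mul_cancel_right]

/-- Two logarithms of the same map from an interval to the circle have the same increment. -/
lemma increment_eq_of_exp_eq {θ₀ θ₁ : ℝ → ℝ} (h0 : Continuous θ₀) (h1 : Continuous θ₁) {a b : ℝ}
    (hab : a ≤ b) (h : ∀ s ∈ Icc a b, Circle.exp (θ₀ s) = Circle.exp (θ₁ s)) :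
    θ₀ b - θ₀ a = θ₁ b - θ₁ a := by
  have ha : a ∈ Icc a b := left_mem_Icc.2 hab
  have hb : b ∈ Icc a b := right_mem_Icc.2 hab
  have key := Circle.isCoveringMap_exp.eqOn_of_comp_eqOn (s := Icc a b) isPreconnected_Icc
    (g₁ := fun s => θ₀ s - θ₁ s) (g₂ := fun _ => θ₀ a - θ₁ a)
    (h0.sub h1).continuousOn continuousOn_const (fun s hs => by
      simp only [Function.comp_apply, Circle.exp_sub, h s hs, h a ha, div_self']) ha rfl
  have := key hb
  simp only at this
  linarith

/-- Homotopic maps from the circle to itself have the same degree. -/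
lemma increment_eq_of_homotopic {g₀ g₁ : C(Circle, Circle)} (h : g₀.Homotopic g₁) {θ₀ θ₁ : ℝ → ℝ}
    (h0 : Continuous θ₀) (h1 : Continuous θ₁)
    (e0 : ∀ s ∈ Icc 0 (2 * Real.pi), g₀ (Circle.exp s) = Circle.exp (θ₀ s))
    (e1 : ∀ s ∈ Icc 0 (2 * Real.pi), g₁ (Circle.exp s) = Circle.exp (θ₁ s)) :
    θ₁ (2 * Real.pi) - θ₁ 0 = θ₀ (2 * Real.pi) - θ₀ 0 := by
  obtain ⟨θ, hθ⟩ := exists_log_of_homotopic h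
  have hc : Continuous fun s => θ (Circle.exp s) := by fun_prop
  have := increment_eq_of_exp_eq (θ₁ := fun s => θ₀ s + θ (Circle.exp s)) h1 (h0.add hc)
    Real.two_pi_pos.le fun s hs => by rw [← e1 s hs, hθ, e0 s hs, Circle.exp_add]
  simp only [Circle.exp_two_pi, Circle.exp_zero] at this
  linarith

namespace SimpleClosedCurve

variable {S : Type*} [TopologicalSpace S]

lemma IsEssential.map {c : SimpleClosedCurve S} (h : c.IsEssential) (φ : S ≃ₜ S) :
    (c.map φ).IsEssential := by
  intro h'
  apply h
  have := h'.comp_right (φ.symm : C(S, S))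
  convert this using 1
  ext z
  exact (φ.symm_apply_apply _).symm

lemma Isotopic.of_map {c c' : SimpleClosedCurve S} {φ : S ≃ₜ S}
    (h : (c.map φ).Isotopic (c'.map φ)) : c.Isotopic c' := by
  obtain ⟨H, h1, h2, h3⟩ := h
  refine ⟨(φ.symm : C(S, S)).comp H, fun t => φ.symm.injective.comp (h1 t), fun z => ?_, ?_⟩
  · rw [ContinuousMap.comp_apply, h2]
    exact φ.symm_apply_apply _
  · have e1 : range (fun z => ((φ.symm : C(S, S)).comp H) (1, z)) =
        φ.symm '' range fun z => H (1, z) := range_comp φ.symm fun z => H (1, z)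
    have e2 : (c'.map φ).image = φ '' c'.image := range_comp φ c'.toMap
    rw [e1, h3, e2]
    exact φ.toEquiv.symm_image_image _

end SimpleClosedCurve

lemma IsMulticurve.map {S : Type*} [TopologicalSpace S] {ι : Type*} {c : ι → SimpleClosedCurve S}
    (h : IsMulticurve c) (φ : S ≃ₜ S) : IsMulticurve fun i => (c i).map φ := by
  have e : ∀ i, ((c i).map φ).image = φ.symm ⁻¹' (c i).image := fun i => by
    rw [← φ.image_eq_preimage_symm]
    exact range_comp φ (c i).toMap
  refine ⟨fun i => (h.essential i).map φ, fun i j hij => ?_,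
    fun i j hij h' => h.nonIsotopic hij h'.of_map, ?_⟩
  · simp only [e]
    exact (h.disjoint hij).preimage _
  · simp only [e]
    exact h.locallyFinite.preimage_continuous φ.symm.continuous

namespace Staircase

lemma colFun_cyl (m k : ℤ) {x y : ℝ} (hx : 0 ≤ x) (hx' : x ≤ 2) (h0 : 0 < y) (h1 : y < 1) :
    colFun m (cyl false k (x, y)) = wrap (k - m + x) := by
  have hint : ∀ n : ℤ, wrap n = 1 := fun n => by
    rcases le_or_gt n 0 with h | h
    · exact wrap_of_le_zero (by exact_mod_cast h)
    · exact wrap_of_one_le (by exact_mod_cast h)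
  have edge : ∀ l : ℤ, colFun m (cyl false k (2 * l, y)) = 1 := by
    intro l
    rw [cyl_eq' false k (l - 1) (by push_cast; linarith) (by push_cast; linarith) h0 h1, colFun_pt]
    · have := hint (-k + 1 - (1 - m))
      push_cast at this
      simp only [colIdx, Bool.not_false, if_true]
      push_cast
      convert this using 2
      ring
    · refine row_subset_stair (-k) (mem_row.2 ?_)
      push_cast
      exact ⟨⟨by linarith, by linarith⟩, by linarith, by linarith⟩
  rcases hx.eq_or_lt with rfl | h
  · have := edge 0
    have e := hint (k - m)
    push_cast at this e
    rw [mul_zero] at this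
    rw [this, add_zero, e]
  rcases hx'.eq_or_lt with rfl | h'
  · have := edge 1
    have e := hint (k - m + 2)
    push_cast at this e
    rw [mul_one] at this
    rw [this, e]
  · rw [cyl_eq _ _ 0 (by simpa using h) (by simpa using h'), colFun_pt]
    · simp only [colIdx]
      congr 1
      push_cast
      ring
    · exact row_subset_stair k (mem_row_add.2
        ⟨⟨by push_cast; linarith, by push_cast; linarith⟩, h0, h1⟩)

/-- The horizontal circle at height `y` in the `k`-th horizontal cylinder. -/
def leaf (k : ℤ) (y : Ioo (0 : ℝ) 1) : C(Circle, Surface) where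
  toFun z := cyl false k (Complex.arg z / Real.pi, y)
  continuous_toFun := by
    have hq : IsQuotientMap Circle.exp :=
      Circle.isCoveringMap_exp.isLocalHomeomorph.isOpenMap.isQuotientMap Circle.exp.continuous
        fun z => ⟨_, Circle.exp_arg z⟩
    rw [hq.continuous_iff, continuous_iff_continuousAt]
    intro s
    have e : (fun z : Circle => cyl false k (Complex.arg z / Real.pi, y)) ∘ Circle.exp =
        fun s => cyl false k (s / Real.pi, y) := funext fun s => cyl_arg k s _
    rw [e]
    exact ContinuousAt.comp (g := cyl false k) (f := fun s : ℝ => (s / Real.pi, (y : ℝ)))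
      (continuousAt_cyl false k y.2.1 y.2.2) (by fun_prop)

lemma leaf_exp (k : ℤ) (y : Ioo (0 : ℝ) 1) (s : ℝ) :
    leaf k y (Circle.exp s) = cyl false k (s / Real.pi, y) := cyl_arg k s y

/-- The `k`-th column function as a bundled continuous map. -/
def colMap (k : ℤ) : C(Surface, Circle) := ⟨colFun k, continuous_colFun k⟩

/-- The `k`-th row function as a bundled continuous map. -/
def rowMap (k : ℤ) : C(Surface, Circle) := ⟨rowFun k, continuous_rowFun k⟩

/-- The horizontal circles in the cylinder `k` cross the columns `k` and `k + 1` once, and the other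
ones not at all. -/
lemma colMap_leaf (m k : ℤ) (y : Ioo (0 : ℝ) 1) {s : ℝ} (hs : s ∈ Icc 0 (2 * Real.pi)) :
    ((colMap m).comp (leaf k y)) (Circle.exp s) =
      Circle.exp (2 * Real.pi * clamp (k - m + s / Real.pi)) := by
  have hpi := Real.pi_pos
  change colFun m (leaf k y (Circle.exp s)) = _
  rw [leaf_exp, colFun_cyl]
  · rfl
  · exact div_nonneg hs.1 hpi.le
  · rw [div_le_iff₀ hpi]; exact hs.2
  · exact y.2.1
  · exact y.2.2

lemma continuous_colMap_leaf_log (m k : ℤ) :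
    Continuous fun s => 2 * Real.pi * clamp (k - m + s / Real.pi) :=
  continuous_const.mul (continuous_clamp.comp (by fun_prop))

lemma increment_colMap_leaf {m k : ℤ} (h : m = k ∨ m = k + 1) :
    2 * Real.pi * clamp (k - m + 2 * Real.pi / Real.pi) -
      2 * Real.pi * clamp (k - m + 0 / Real.pi) = 2 * Real.pi := by
  rw [mul_div_cancel_right₀ _ Real.pi_ne_zero, zero_div]
  rcases h with rfl | rfl
  · rw [clamp_of_one_le (by linarith), clamp_of_le_zero (by linarith)]; ring
  · rw [clamp_of_one_le (by push_cast; linarith), clamp_of_le_zero (by push_cast; linarith)]; ring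

/-- The column functions of the two columns that cross a cylinder are not homotopic to a constant
along the circles of the cylinder. -/
lemma not_homotopic_const {m k : ℤ} (h : m = k ∨ m = k + 1) (y : Ioo (0 : ℝ) 1)
    {g : C(Circle, Circle)} (hg : ((colMap m).comp (leaf k y)).Homotopic g) (w : Circle) :
    ∃ z, g z ≠ w := by
  by_contra! hw
  have := increment_eq_of_homotopic hg (continuous_colMap_leaf_log m k)
    (θ₁ := fun _ => Complex.arg w) continuous_const (fun s hs => colMap_leaf m k y hs)
    (fun s _ => by rw [hw, Circle.exp_arg])
  rw [increment_colMap_leaf h] at this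
  linarith [Real.pi_pos]

lemma core_toMap (k : ℤ) : (core k).toMap = leaf k ⟨1 / 2, by norm_num, by norm_num⟩ := by
  ext z
  rw [← Circle.exp_arg z, core_exp, leaf_exp]

lemma core_isEssential (k : ℤ) : (core k).IsEssential := by
  rintro ⟨p, hp⟩
  rw [core_toMap] at hp
  obtain ⟨z, hz⟩ := not_homotopic_const (.inl rfl) _
    ((ContinuousMap.Homotopic.refl (colMap k)).comp hp) (colFun k p)
  exact hz rfl

/-- A column function is constant on the horizontal cylinders that do not cross the column. -/
lemma colFun_cyl_eq_one {m k : ℤ} (h : m ≠ k) (h' : m ≠ k + 1) (x : ℝ) {y : ℝ} (h0 : 0 < y)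
    (h1 : y < 1) : colFun m (cyl false k (x, y)) = 1 := by
  rw [← cyl_add_int false k (-⌊x / 2⌋) x]
  have a := Int.floor_le (x / 2)
  have b := Int.lt_floor_add_one (x / 2)
  rw [colFun_cyl m k (by push_cast; linarith) (by push_cast; linarith) h0 h1]
  rcases lt_or_ge m k with hm | hm
  · have : (m : ℝ) + 1 ≤ k := by exact_mod_cast hm
    exact wrap_of_one_le (by push_cast; linarith)
  · have : (k : ℝ) + 2 ≤ m := by
      have : k + 2 ≤ m := by omega
      exact_mod_cast this
    exact wrap_of_le_zero (by push_cast; linarith)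

lemma isMulticurve_core : IsMulticurve core := by
  have hsub : ∀ k, (core k).image ⊆ range (annulus k) := fun k => by
    rw [core_image]; exact image_subset_range _ _
  refine ⟨core_isEssential, fun i j h => (disjoint_annulus h).mono (hsub i) (hsub j), ?_,
    locallyFinite_annulus.subset hsub⟩
  rintro j k hjk ⟨H, -, h2, h3⟩
  obtain ⟨m, hm, hmk, hmk'⟩ : ∃ m : ℤ, (m = j ∨ m = j + 1) ∧ m ≠ k ∧ m ≠ k + 1 := by
    by_cases h : j = k + 1
    · exact ⟨j + 1, .inr rfl, by omega, by omega⟩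
    · exact ⟨j, .inl rfl, hjk, h⟩
  have hH : (core j).toMap.Homotopic ⟨fun z => H (1, z), by fun_prop⟩ :=
    ⟨⟨H, h2, fun z => rfl⟩⟩
  rw [core_toMap] at hH
  obtain ⟨z, hz⟩ := not_homotopic_const hm _
    ((ContinuousMap.Homotopic.refl (colMap m)).comp hH) 1
  have hmem : H (1, z) ∈ (core k).image := by
    rw [← h3]
    exact ⟨z, rfl⟩
  obtain ⟨z', hz'⟩ := hmem
  refine hz ?_
  change colFun m (H (1, z)) = 1
  rw [← hz', ← Circle.exp_arg z', core_exp]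
  exact colFun_cyl_eq_one hmk hmk' _ (by norm_num) (by norm_num)

end Staircase

/-! ### Components and ends -/

section Components

variable {S : Type*} [TopologicalSpace S]

lemma connectedComponentIn_congr {U A : Set S} (hA : IsPreconnected A) (hAU : A ⊆ U) {x y : S}
    (hx : x ∈ A) (hy : y ∈ A) : connectedComponentIn U x = connectedComponentIn U y :=
  connectedComponentIn_eq (hA.subset_connectedComponentIn hx hAU hy)

lemma isConnected_of_connectedComponentIn_eq {U : Set S} {x₀ : S} (h₀ : x₀ ∈ U)
    (h : ∀ x ∈ U, connectedComponentIn U x = connectedComponentIn U x₀) : IsConnected U := by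
  have : U = connectedComponentIn U x₀ :=
    Subset.antisymm (fun x hx => h x hx ▸ mem_connectedComponentIn hx)
      (connectedComponentIn_subset _ _)
  rw [this]
  exact isConnected_connectedComponentIn_iff.2 h₀

/-- A space has exactly one end if the complement of every compact set has only one component that
is not contained in a compact set. -/
lemma existsUnique_isEnd (h : ∀ K : Compacts S, ∃ L : Compacts S, K ≤ L ∧ (L : Set S)ᶜ.Nonempty ∧
    ∀ p ∈ (L : Set S)ᶜ, ∀ q ∈ (L : Set S)ᶜ,
      connectedComponentIn (K : Set S)ᶜ p = connectedComponentIn (K : Set S)ᶜ q) :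
    ∃! e : Compacts S → Set S, IsEnd e := by
  choose L hKL hne hL using h
  choose x hx using hne
  refine ⟨fun K => connectedComponentIn (K : Set S)ᶜ (x K), ⟨fun K => ⟨x K, ?_, rfl⟩, ?_⟩, ?_⟩
  · exact fun h => hx K (hKL K h)
  · intro K K' hKK'
    obtain ⟨p, hp⟩ : ((L K ⊔ L K' : Compacts S) : Set S)ᶜ.Nonempty :=
      ⟨x (L K ⊔ L K'), fun h => hx _ (hKL _ h)⟩
    rw [Compacts.coe_sup, compl_union] at hp
    simp only
    rw [hL K _ (hx K) p hp.1, hL K' _ (hx K') p hp.2]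
    exact connectedComponentIn_mono _ (compl_subset_compl.2 hKK')
  · rintro e ⟨he, he'⟩
    funext K
    obtain ⟨y, hy, hey⟩ := he (L K)
    obtain ⟨y', hy', hey'⟩ := he K
    have h1 : y ∈ e K := he' K (L K) (hKL K) (hey ▸ mem_connectedComponentIn hy)
    rw [hey'] at h1
    rw [hey', connectedComponentIn_eq h1]
    exact hL K _ hy _ (hx K)

end Components

namespace Staircase

/-- Points in a planar region of the surface lie in the same component of every set that contains
the region. -/
lemma connectedComponentIn_pt {U : Set Surface} (b : Bool) {R : Set (ℝ × ℝ)} (hR : IsPreconnected R)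
    (hs : R ⊆ stair) (hU : ∀ z ∈ R, pt b z ∈ U) {z w : ℝ × ℝ} (hz : z ∈ R) (hw : w ∈ R) :
    connectedComponentIn U (pt b z) = connectedComponentIn U (pt b w) :=
  connectedComponentIn_congr (hR.image _ ((continuousOn_pt b).mono hs))
    (by rintro _ ⟨v, hv, rfl⟩; exact hU v hv) ⟨z, hz, rfl⟩ ⟨w, hw, rfl⟩

lemma isPreconnected_rect (a b c d : ℝ) : IsPreconnected (Ioo a b ×ˢ Ioo c d) :=
  isPreconnected_Ioo.prod isPreconnected_Ioo

/-- A function on the integers with period two that takes the same value at two consecutive integers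
is constant. -/
lemma const_of_add_two {T : Type*} {f : ℤ → T} (h : ∀ m, f (m + 2) = f m) {M : ℤ}
    (hM : f M = f (M + 1)) (m n : ℤ) : f m = f n := by
  have key : ∀ m j : ℤ, f (m + 2 * j) = f m := fun m j => by
    induction j with
    | zero => simp
    | succ i ih => rw [← ih, ← h (m + 2 * (i : ℤ))]; congr 1; ring
    | pred i ih => rw [← ih, ← h (m + 2 * (-(i : ℤ) - 1))]; congr 1; ring
  have all : ∀ m, f m = f M := fun m => by
    rcases Int.even_or_odd' (m - M) with ⟨j, hj | hj⟩
    · rw [← key M j]; congr 1; omega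
    · rw [hM, ← key (M + 1) j]; congr 1; omega
  rw [all m, all n]

/-! ### Infinite genus -/

lemma wrap_eq_half {t : ℝ} (h : wrap t = wrap (1 / 2)) : t = 1 / 2 := by
  have hne : wrap t ≠ 1 := h ▸ wrap_ne_one (by norm_num) (by norm_num)
  refine clamp_injOn_wrap ?_ ?_ (by norm_num) (by norm_num) h
  · by_contra h'; exact hne (wrap_of_le_zero (not_lt.1 h'))
  · by_contra h'; exact hne (wrap_of_one_le (not_lt.1 h'))

lemma core_image_iff {k : ℤ} {p : Surface} :
    p ∈ (core k).image ↔ rowFun k p = wrap (1 / 2) := by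
  constructor
  · rintro ⟨z, rfl⟩
    rw [← Circle.exp_arg z, core_exp, rowFun_cyl _ _ (by norm_num) (by norm_num), if_pos rfl]
  · intro h
    have hne : rowFun k p ≠ 1 := h ▸ wrap_ne_one (by norm_num) (by norm_num)
    rcases cyl_or_edge p with ⟨j, x, y, h0, h1, rfl⟩ | he
    · rw [rowFun_cyl _ _ h0 h1] at h hne
      split_ifs at h hne with hj
      · subst hj
        obtain rfl := wrap_eq_half h
        refine ⟨Circle.exp (Real.pi * x), ?_⟩
        rw [core_exp, mul_div_cancel_left₀ _ Real.pi_ne_zero]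
      · exact absurd rfl hne
    · exact absurd (rowFun_edge k he) hne

/-- The complement of the core curves of the horizontal cylinders `0, …, n - 1`. The lower (upper)
halves of the cylinders meet the middle parts of the columns to their left (right) in both copies
of the staircase, so that all these middle parts are connected to each other. -/
lemma isConnected_compl_cores (n : ℕ) : IsConnected (⋃ i : Fin n, (core (i : ℕ)).image)ᶜ := by
  set U : Set Surface := (⋃ i : Fin n, (core (i : ℕ)).image)ᶜ with hUdef
  have memU : ∀ p, p ∈ U ↔ ∀ i : ℕ, i < n → rowFun i p ≠ wrap (1 / 2) := fun p => by
    simp only [hUdef, mem_compl_iff, mem_iUnion, not_exists, core_image_iff]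
    exact ⟨fun h i hi => h ⟨i, hi⟩, fun h i => h i i.2⟩
  have ptU : ∀ b, ∀ z ∈ stair, (∀ j : ℤ, z.2 ≠ j + 1 / 2) → pt b z ∈ U := fun b z hz hj => by
    rw [memU]
    intro i _ h
    rw [rowFun_pt _ _ hz] at h
    exact hj (rowIdx b i) (by linarith [wrap_eq_half h])
  have not_half : ∀ (k : ℤ) (y : ℝ), k - 1 / 2 < y → y < k + 1 / 2 → ∀ j : ℤ, y ≠ j + 1 / 2 := by
    rintro k y h1 h2 j rfl
    have a : (k : ℝ) < j + 1 := by linarith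
    have b : (j : ℝ) < k := by linarith
    norm_cast at a b
    omega
  -- the middle parts of the columns
  set C : Bool → ℤ → Set Surface := fun b k => connectedComponentIn U (pt b (k + 1 / 2, k)) with hC
  have mid : ∀ b (k : ℤ) (z : ℝ × ℝ), k < z.1 → z.1 < k + 1 → k - 1 / 2 < z.2 → z.2 < k + 1 / 2 →
      connectedComponentIn U (pt b z) = C b k := fun b k z h1 h2 h3 h4 => by
    have hs : Ioo (k : ℝ) (k + 1) ×ˢ Ioo (k - 1 / 2 : ℝ) (k + 1 / 2) ⊆ stair := fun w hw =>
      col_subset_stair k (mem_col.2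
        ⟨hw.1, by linarith [hw.2.1], by linarith [hw.2.2]⟩)
    refine connectedComponentIn_pt b (isPreconnected_rect _ _ _ _) hs (fun w hw => ?_)
      ⟨⟨h1, h2⟩, h3, h4⟩ ⟨⟨by dsimp only; linarith, by dsimp only; linarith⟩,
        by dsimp only; linarith, by dsimp only; linarith⟩
    exact ptU b w (hs hw) (not_half k _ hw.2.1 hw.2.2)
  have low : ∀ b (k : ℤ) (z : ℝ × ℝ), z ∈ row k → z.2 < k + 1 / 2 →
      connectedComponentIn U (pt b z) = C b k := fun b k z hz h4 => by
    have hs : Ioo (k : ℝ) (k + 2) ×ˢ Ioo (k : ℝ) (k + 1 / 2) ⊆ stair := fun w hw =>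
      row_subset_stair k (mem_row.2 ⟨hw.1, hw.2.1, by linarith [hw.2.2]⟩)
    rw [mem_row] at hz
    rw [← mid b k (k + 1 / 2, k + 1 / 4) (by dsimp only; linarith) (by dsimp only; linarith)
      (by dsimp only; linarith) (by dsimp only; linarith)]
    refine connectedComponentIn_pt b (isPreconnected_rect _ _ _ _) hs (fun w hw => ?_)
      ⟨hz.1, hz.2.1, h4⟩ ⟨⟨by dsimp only; linarith, by dsimp only; linarith⟩,
        by dsimp only; linarith, by dsimp only; linarith⟩
    exact ptU b w (hs hw) (not_half k _ (by linarith [hw.2.1]) hw.2.2)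
  have upp : ∀ b (k : ℤ) (z : ℝ × ℝ), z ∈ row k → k + 1 / 2 < z.2 →
      connectedComponentIn U (pt b z) = C b (k + 1) := fun b k z hz h4 => by
    have hs : Ioo (k : ℝ) (k + 2) ×ˢ Ioo (k + 1 / 2 : ℝ) (k + 1) ⊆ stair := fun w hw =>
      row_subset_stair k (mem_row.2 ⟨hw.1, by linarith [hw.2.1], hw.2.2⟩)
    rw [mem_row] at hz
    rw [← mid b (k + 1) (k + 3 / 2, k + 3 / 4) (by push_cast; linarith) (by push_cast; linarith)
      (by push_cast; linarith) (by push_cast; linarith)]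
    refine connectedComponentIn_pt b (isPreconnected_rect _ _ _ _) hs (fun w hw => ?_)
      ⟨hz.1, h4, hz.2.2⟩ ⟨⟨by dsimp only; linarith, by dsimp only; linarith⟩,
        by dsimp only; linarith, by dsimp only; linarith⟩
    exact ptU b w (hs hw) (not_half (k + 1) _ (by push_cast; linarith [hw.2.1])
      (by push_cast; linarith [hw.2.2]))
  have e1 : ∀ b k, C b k = C (!b) (-k) := fun b k => by
    have hz : ((k + 3 / 2, k + 1 / 4) : ℝ × ℝ) ∈ row k ∩ col (k + 1) := by
      constructor
      · rw [mem_row]; constructor <;> constructor <;> linarith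
      · rw [mem_col]; push_cast; constructor <;> constructor <;> linarith
    rw [← low b k _ hz.1 (by dsimp only; linarith), pt_right hz]
    refine low _ _ _ ?_ (by push_cast; linarith)
    rw [mem_row]; push_cast; constructor <;> constructor <;> linarith
  have e2 : ∀ b k, C b (k + 1) = C (!b) (-k + 1) := fun b k => by
    have hz : ((k + 1 / 2, k + 3 / 4) : ℝ × ℝ) ∈ row k ∩ col k := by
      constructor
      · rw [mem_row]; constructor <;> constructor <;> linarith
      · rw [mem_col]; push_cast; constructor <;> constructor <;> linarith
    rw [← upp b k _ hz.1 (by dsimp only; linarith), pt_left hz]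
    refine upp _ _ _ ?_ (by push_cast; linarith)
    rw [mem_row]; push_cast; constructor <;> constructor <;> linarith
  have per : ∀ b k, C b (k + 2) = C b k := fun b k => by
    have h1 := e1 (!b) (-k)
    have h2 := e2 (!b) (-k - 1)
    rw [Bool.not_not] at h1 h2
    rw [neg_neg] at h1
    rw [show -k - 1 + 1 = -k by ring, show -(-k - 1) + 1 = k + 2 by ring] at h2
    rw [← h1, ← h2]
  -- the cylinder `n` is not cut
  have rowU : ∀ z ∈ row n, pt false z ∈ U := fun z hz => by
    rw [memU]
    intro i hi h
    rw [pt_eq_cyl _ hz, rowFun_cyl, if_neg] at h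
    · exact wrap_ne_one (t := 1 / 2) (by norm_num) (by norm_num) h.symm
    · exact_mod_cast hi.ne
    · have := (mem_row.1 hz).2.1; linarith
    · have := (mem_row.1 hz).2.2; linarith
  have step : C false n = C false (n + 1) := by
    have h1 : ((n + 1 / 2, n + 1 / 4) : ℝ × ℝ) ∈ row n := by
      rw [mem_row]; push_cast; constructor <;> constructor <;> linarith
    have h2 : ((n + 1 / 2, n + 3 / 4) : ℝ × ℝ) ∈ row n := by
      rw [mem_row]; push_cast; constructor <;> constructor <;> linarith
    rw [← low false n _ h1 (by push_cast; linarith), ← upp false n _ h2 (by push_cast; linarith)]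
    exact connectedComponentIn_pt _ (isPreconnected_row n) (row_subset_stair _) rowU h1 h2
  have all : ∀ b k, C b k = C false 0 := fun b k => by
    cases b
    · exact const_of_add_two (per false) step _ _
    · rw [e1]; exact const_of_add_two (per false) step _ _
  have h₀ : pt false ((0 : ℤ) + 1 / 2, (0 : ℤ)) ∈ U :=
    ptU _ _ (col_subset_stair 0 (by rw [mem_col]; norm_num))
      (not_half 0 _ (by norm_num) (by norm_num))
  refine isConnected_of_connectedComponentIn_eq h₀ fun p hp => ?_
  change _ = C false 0
  have hp' := hp
  obtain ⟨b, z, hz, rfl⟩ := exists_pt p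
  rcases pt_cases hz with ⟨k, hk⟩ | ⟨j, h1, h2, h3⟩
  · rcases lt_trichotomy z.2 (k + 1 / 2) with h | h | h
    · rw [low b k z hk h, all]
    · have key : ∀ w ∈ row k, pt b w ∈ U := fun w hw => by
        rw [memU] at hp ⊢
        intro i hi hw'
        refine hp i hi ?_
        have r1 := mem_row.1 hw
        rw [rowFun_pt _ _ (row_subset_stair k hw)] at hw'
        rw [rowFun_pt _ _ hz, h]
        have := wrap_eq_half hw'
        have hk : rowIdx b i = k := by
          refine int_eq_of_mem_Ioo (y := w.2) (by linarith) (by linarith) r1.2.1 r1.2.2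
        rw [hk]
        congr 1
        ring
      have h1 : ((k + 1 / 2, k + 1 / 4) : ℝ × ℝ) ∈ row k := by
        rw [mem_row]; push_cast; constructor <;> constructor <;> linarith
      rw [← all b k, ← low b k _ h1 (by dsimp only; linarith)]
      exact connectedComponentIn_pt _ (isPreconnected_row k) (row_subset_stair _) key hk h1
    · rw [upp b k z hk h, all]
  · rw [mid b j z h2 h3 (by linarith) (by linarith), all]

lemma genusAtLeast (n : ℕ) : GenusAtLeast Surface n := by
  refine ⟨fun i => core (i : ℕ), fun i j hij => ?_, isConnected_compl_cores n⟩
  exact isMulticurve_core.disjoint (by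
    intro h
    exact hij (Fin.ext (by exact_mod_cast h)))

/-! ### The end of the staircase surface -/

/-- The horizontal band of points at distance at least `δ` from the boundary of the `k`-th
horizontal cylinder. -/
def band (δ : ℝ) (k : ℤ) : Set Surface := cyl false k '' (univ ×ˢ Icc δ (1 - δ))

lemma isCompact_band {δ : ℝ} (hδ : 0 < δ) (k : ℤ) : IsCompact (band δ k) := by
  have : band δ k = cyl false k '' (Icc 0 2 ×ˢ Icc δ (1 - δ)) := by
    refine Subset.antisymm ?_ (image_mono (prod_mono_left (subset_univ _)))
    rintro _ ⟨⟨x, y⟩, ⟨-, hy⟩, rfl⟩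
    refine ⟨(x + 2 * (-⌊x / 2⌋ : ℤ), y), ⟨⟨?_, ?_⟩, hy⟩, cyl_add_int _ _ _ _ _⟩
    · push_cast; linarith [Int.floor_le (x / 2)]
    · push_cast; linarith [Int.lt_floor_add_one (x / 2)]
  rw [this]
  refine (isCompact_Icc.prod isCompact_Icc).image_of_continuousOn fun w hw => ?_
  exact (continuousAt_cyl _ _ (hδ.trans_le hw.2.1)
    (by linarith [hw.2.2])).continuousWithinAt

/-- The compact union of the horizontal and vertical bands with small index. -/
def block (δ : ℝ) (n : ℕ) : Set Surface :=
  ⋃ k ∈ Icc (-n : ℤ) n, (band δ k ∪ reflection '' band δ k)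

lemma isCompact_block {δ : ℝ} (hδ : 0 < δ) (n : ℕ) : IsCompact (block δ n) :=
  (finite_Icc _ _).isCompact_biUnion fun k _ =>
    (isCompact_band hδ k).union ((isCompact_band hδ k).image reflection.continuous)

lemma mem_interior_band {δ : ℝ} (hδ : 0 < δ) {k : ℤ} {x y : ℝ} (h0 : δ < y) (h1 : y < 1 - δ) :
    cyl false k (x, y) ∈ interior (band δ k) := by
  rw [mem_interior_iff_mem_nhds, nhds_cyl _ _ (hδ.trans h0) (by linarith)]
  exact image_mem_map (prod_mem_nhds univ_mem (Icc_mem_nhds h0 h1))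

lemma band_mono {δ δ' : ℝ} (h : δ' ≤ δ) (k : ℤ) : band δ k ⊆ band δ' k :=
  image_mono (prod_mono_right (Icc_subset_Icc h (by linarith)))

lemma block_mono {δ δ' : ℝ} (h : δ' ≤ δ) {n n' : ℕ} (hn : n ≤ n') : block δ n ⊆ block δ' n' := by
  refine biUnion_mono (Icc_subset_Icc (by omega) (by omega)) fun k _ => ?_
  exact union_subset_union (band_mono h k) (image_mono (band_mono h k))

lemma exists_cyl_of_row {b : Bool} {k : ℤ} {z : ℝ × ℝ} (h : z ∈ row k) :
    ∃ x, pt b z = cyl false (rowIdx b k) (x, z.2 - k) := by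
  have hr := mem_row.1 h
  rw [pt_eq_cyl b h]
  cases b
  · exact ⟨_, rfl⟩
  · have := cyl_not true k (x := z.1 - k - 1) (y := z.2 - k) (by linarith) (by linarith)
    rw [sub_add_cancel] at this
    exact ⟨_, this.symm⟩

lemma exists_reflection_cyl_of_col {b : Bool} {k : ℤ} {z : ℝ × ℝ} (h : z ∈ col k) :
    ∃ x, pt b z = reflection (cyl false (colIdx b k - 1) (x, z.1 - k)) := by
  have hs := col_subset_stair k h
  have e := reflection_symm_pt b hs
  rw [← reflection.apply_symm_apply (pt b z), e]
  cases b
  · have hr : reflMap (!false) z ∈ row (k - 1) := by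
      have := reflMap_col (b := !false) h
      simpa using this
    obtain ⟨x, hx⟩ := exists_cyl_of_row (b := false) hr
    refine ⟨x, ?_⟩
    rw [hx]
    simp [rowIdx, colIdx, reflMap]
  · have hr : reflMap (!true) z ∈ row k := by
      have := reflMap_col (b := !true) h
      simpa using this
    obtain ⟨x, hx⟩ := exists_cyl_of_row (b := true) hr
    refine ⟨x, ?_⟩
    rw [hx]
    simp [rowIdx, colIdx, reflMap]

lemma exists_subset_block {K : Set Surface} (hK : IsCompact K) :
    ∃ δ, 0 < δ ∧ δ < 1 / 2 ∧ ∃ n, K ⊆ block δ n := by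
  have anti : ∀ {m n : ℕ}, m ≤ n → (1 : ℝ) / (n + 3) ≤ 1 / (m + 3) := fun {m n} h => by
    have : (m : ℝ) ≤ n := by exact_mod_cast h
    exact one_div_le_one_div_of_le (by positivity) (by linarith)
  have small : ∀ t : ℝ, 0 < t → ∀ k : ℤ, ∃ n : ℕ, (1 : ℝ) / (n + 3) < t ∧ k ∈ Icc (-n : ℤ) n := by
    intro t ht k
    obtain ⟨m, hm⟩ := exists_nat_one_div_lt ht
    refine ⟨max m k.natAbs, lt_of_le_of_lt ?_ hm, ?_⟩
    · have : (m : ℝ) ≤ (max m k.natAbs : ℕ) := by exact_mod_cast le_max_left _ _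
      exact one_div_le_one_div_of_le (by positivity) (by linarith)
    · constructor <;> omega
  obtain ⟨n, hn⟩ := hK.elim_directed_cover (fun n : ℕ => interior (block (1 / (n + 3)) n))
    (fun n => isOpen_interior) (fun p _ => by
      have hcyl : ∀ (k : ℤ) (x y : ℝ), 0 < y → y < 1 → ∃ n : ℕ, k ∈ Icc (-n : ℤ) n ∧
          cyl false k (x, y) ∈ interior (band (1 / (n + 3)) k) := fun k x y h0 h1 => by
        obtain ⟨n, h2, h3⟩ := small (min y (1 - y)) (lt_min h0 (by linarith)) k
        rw [lt_min_iff] at h2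
        exact ⟨n, h3, mem_interior_band (by positivity) h2.1 (by linarith)⟩
      have hsub : ∀ (n : ℕ) (k : ℤ), k ∈ Icc (-n : ℤ) n →
          band (1 / (n + 3)) k ∪ reflection '' band (1 / (n + 3)) k ⊆ block (1 / (n + 3)) n :=
        fun n k hk => subset_biUnion_of_mem (u := fun k => band (1 / (n + 3)) k ∪
          reflection '' band (1 / (n + 3)) k) hk
      rw [mem_iUnion]
      rcases cyl_or_edge p with ⟨k, x, y, h0, h1, rfl⟩ | ⟨b, j, x, h0, h1, rfl⟩
      · obtain ⟨n, hk, hn⟩ := hcyl k x y h0 h1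
        exact ⟨n, interior_mono (subset_union_left.trans (hsub n k hk)) hn⟩
      · have hc : (x, (j : ℝ)) ∈ col j :=
          mem_col.2 ⟨⟨h0, h1⟩, by dsimp only; linarith, by dsimp only; linarith⟩
        obtain ⟨x', hx'⟩ := exists_reflection_cyl_of_col (b := b) hc
        obtain ⟨n, hk, hn⟩ := hcyl (colIdx b j - 1) x' (x - j) (by linarith) (by linarith)
        refine ⟨n, interior_mono (subset_union_right.trans (hsub n _ hk)) ?_⟩
        rw [hx', ← reflection.image_interior]
        exact ⟨_, hn, rfl⟩)
    (directed_of_isDirected_le fun m n h => interior_mono (block_mono (anti h) h))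
  refine ⟨1 / (n + 3), by positivity, ?_, n, hn.trans interior_subset⟩
  exact one_div_lt_one_div_of_lt (by norm_num) (by linarith [n.cast_nonneg (α := ℝ)])

/-- A coordinate at which a point is outside the bands of width `δ` and index at most `n`: it is
close to an integer or large. -/
def Outside (δ : ℝ) (n : ℕ) (s : ℝ) : Prop := (∃ j : ℤ, |s - j| < δ) ∨ n + 2 < |s|

lemma Outside.wrap_ne {δ : ℝ} {n : ℕ} {s : ℝ} (h : Outside δ n s) (hδ : 0 < δ) {k : ℤ}
    (hk : |(k : ℝ)| ≤ n + 1) {t : ℝ} (ht : t ∈ Icc δ (1 - δ)) : wrap (s - k) ≠ wrap t := by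
  intro he
  have hne : wrap (s - k) ≠ 1 := he ▸ wrap_ne_one (hδ.trans_le ht.1) (by linarith [ht.2])
  have h0 : 0 < s - k := by by_contra h'; exact hne (wrap_of_le_zero (not_lt.1 h'))
  have h1 : s - k < 1 := by by_contra h'; exact hne (wrap_of_one_le (not_lt.1 h'))
  have := clamp_injOn_wrap h0 h1 (hδ.trans_le ht.1) (by linarith [ht.2]) he
  rw [abs_le] at hk
  rcases h with ⟨j, hj⟩ | hs
  · rw [abs_lt] at hj
    obtain ⟨t0, t1⟩ := ht
    have a : (j : ℝ) < k + 1 := by linarith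
    have b : (k : ℝ) < j := by linarith
    norm_cast at a b
    omega
  · rw [lt_abs] at hs
    rcases hs with hs | hs <;> linarith

lemma rowFun_band {δ : ℝ} (hδ : 0 < δ) {k : ℤ} {p : Surface} (hp : p ∈ band δ k) :
    ∃ t ∈ Icc δ (1 - δ), rowFun k p = wrap t := by
  obtain ⟨⟨x, y⟩, ⟨-, hy⟩, rfl⟩ := hp
  refine ⟨y, hy, ?_⟩
  rw [rowFun_cyl _ _ (hδ.trans_le hy.1) (by linarith [hy.2]), if_pos rfl]

lemma colFun_reflection (k : ℤ) (p : Surface) : colFun (k + 1) (reflection p) = rowFun k p := by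
  obtain ⟨b, z, hz, rfl⟩ := exists_pt p
  rw [reflection_pt b hz, colFun_pt _ _ (reflMap_mem hz), rowFun_pt _ _ hz]
  cases b <;> simp [reflMap, rowIdx, colIdx]

lemma pt_not_mem_block {δ : ℝ} {n : ℕ} (hδ : 0 < δ) {b : Bool} {z : ℝ × ℝ} (hz : z ∈ stair)
    (h1 : Outside δ n z.1) (h2 : Outside δ n z.2) : pt b z ∉ block δ n := by
  intro h
  simp only [block, mem_iUnion] at h
  obtain ⟨k, ⟨hk0, hk1⟩, h | ⟨q, hq, hqz⟩⟩ := h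
  all_goals
    have hk0 : -(n : ℝ) ≤ k := by exact_mod_cast hk0
    have hk1 : (k : ℝ) ≤ n := by exact_mod_cast hk1
  · obtain ⟨t, ht, e⟩ := rowFun_band hδ h
    rw [rowFun_pt _ _ hz] at e
    refine h2.wrap_ne hδ ?_ ht e
    rw [abs_le]
    cases b <;> simp [rowIdx] <;> constructor <;> linarith
  · obtain ⟨t, ht, e⟩ := rowFun_band hδ hq
    rw [← colFun_reflection, hqz, colFun_pt _ _ hz] at e
    refine h1.wrap_ne hδ ?_ ht e
    rw [abs_le]
    cases b <;> simp [colIdx] <;> constructor <;> linarith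

lemma mem_block_of_row {δ : ℝ} {n : ℕ} {b : Bool} {k : ℤ} {z : ℝ × ℝ} (hz : z ∈ row k)
    (hk : |k| ≤ n) (h : z.2 - k ∈ Icc δ (1 - δ)) : pt b z ∈ block δ n := by
  obtain ⟨x, hx⟩ := exists_cyl_of_row (b := b) hz
  rw [hx]
  refine mem_biUnion (x := rowIdx b k) ?_ (.inl ⟨_, ⟨mem_univ _, h⟩, rfl⟩)
  rw [abs_le] at hk
  cases b <;> simp [rowIdx] <;> omega

lemma mem_block_of_col {δ : ℝ} {n : ℕ} {b : Bool} {k : ℤ} {z : ℝ × ℝ} (hz : z ∈ col k)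
    (hk : |k| + 1 ≤ n) (h : z.1 - k ∈ Icc δ (1 - δ)) : pt b z ∈ block δ n := by
  obtain ⟨x, hx⟩ := exists_reflection_cyl_of_col (b := b) hz
  rw [hx]
  refine mem_biUnion (x := colIdx b k - 1) ?_ (.inr ⟨_, ⟨_, ⟨mem_univ _, h⟩, rfl⟩, rfl⟩)
  have := abs_le.1 (show |k| ≤ n - 1 by omega)
  cases b <;> simp [colIdx] <;> omega

lemma stair_close {z : ℝ × ℝ} (hz : z ∈ stair) : |z.1 - z.2| < 2 := by
  rw [abs_lt]
  obtain ⟨k, h | h⟩ := mem_stair.1 hz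
  · rw [mem_row] at h; constructor <;> linarith
  · rw [mem_col] at h; constructor <;> linarith

/-- Outside a large block, a point lies near a corner of the squares or far away. -/
lemma corner_or_far {δ : ℝ} {n : ℕ} (hδ : 0 < δ) (hδ' : δ < 1 / 2) {b : Bool} {z : ℝ × ℝ}
    (hz : z ∈ stair)
    (h : pt b z ∉ block δ (n + 10)) :
    ((∃ i : ℤ, |z.1 - i| < δ) ∧ ∃ j : ℤ, |z.2 - j| < δ) ∨ (n + 6 < |z.1| ∧ n + 6 < |z.2|) := by
  have near : ∀ (k : ℤ) (s : ℝ), k < s → s < k + 1 → s - k ∉ Icc δ (1 - δ) →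
      ∃ j : ℤ, |s - j| < δ := fun k s h0 h1 hs => by
    simp only [mem_Icc, not_and_or, not_le] at hs
    rcases hs with hs | hs
    · exact ⟨k, by rw [abs_lt]; constructor <;> linarith⟩
    · exact ⟨k + 1, by rw [abs_lt]; push_cast; constructor <;> linarith⟩
  have far : ∀ (k : ℤ) (s : ℝ), (n + 10 : ℕ) < |k| + 1 → k < s → s < k + 1 → n + 8 < |s| := by
    intro k s hk h0 h1
    rw [lt_abs]
    rcases le_total 0 k with h | h
    · rw [abs_of_nonneg h] at hk
      have : (n : ℝ) + 10 ≤ k := by exact_mod_cast (by push_cast at hk; omega : (n : ℤ) + 10 ≤ k)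
      left; linarith
    · rw [abs_of_nonpos h] at hk
      have : (k : ℝ) ≤ -(n + 10) := by
        exact_mod_cast (by push_cast at hk; omega : k ≤ -((n : ℤ) + 10))
      right; linarith
  have h2 : (∃ j : ℤ, |z.2 - j| < δ) ∨ n + 8 < |z.2| := by
    rcases pt_cases hz with ⟨k, hk⟩ | ⟨j, h1, h2, h3⟩
    · have hr := mem_row.1 hk
      by_cases hkn : |k| ≤ (n + 10 : ℕ)
      · exact .inl (near k _ hr.2.1 hr.2.2 fun h' => h (mem_block_of_row hk hkn h'))
      · exact .inr (far k _ (by omega) hr.2.1 hr.2.2)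
    · exact .inl ⟨j, by rw [h1]; simpa using hδ⟩
  have h1 : (∃ j : ℤ, |z.1 - j| < δ) ∨ n + 8 < |z.1| := by
    have hc : (∃ k, z ∈ col k) ∨ ∃ j : ℤ, z.1 = j := by
      rcases stair_cases hz with ⟨k, h⟩ | ⟨k, h⟩ | ⟨k, h, -⟩ | ⟨k, h, h2, h3⟩
      · exact .inl ⟨k, h.2⟩
      · exact .inl ⟨_, h.2⟩
      · exact .inr ⟨k + 1, by push_cast; exact h⟩
      · exact .inl ⟨k, mem_col.2 ⟨⟨h2, h3⟩, by linarith, by linarith⟩⟩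
    rcases hc with ⟨k, hk⟩ | ⟨j, hj⟩
    · have hr := mem_col.1 hk
      by_cases hkn : |k| + 1 ≤ (n + 10 : ℕ)
      · exact .inl (near k _ hr.1.1 hr.1.2 fun h' => h (mem_block_of_col hk hkn h'))
      · exact .inr (far k _ (by omega) hr.1.1 hr.1.2)
    · exact .inl ⟨j, by rw [hj]; simpa using hδ⟩
  have hd := stair_close hz
  have t1 := abs_sub_abs_le_abs_sub z.1 z.2
  have t2 := abs_sub_abs_le_abs_sub z.2 z.1
  rw [abs_sub_comm] at t2
  rcases h1 with h1 | h1
  · rcases h2 with h2 | h2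
    · exact .inl ⟨h1, h2⟩
    · exact .inr ⟨by linarith, by linarith⟩
  · exact .inr ⟨by linarith, by linarith⟩

/-- The complement of a block is connected at infinity. Passing around the corners of the squares
one can move from every square to the squares four steps further in both directions; far away all
squares are joined. -/
lemma connectedComponentIn_compl_block {δ : ℝ} (hδ : 0 < δ) (hδ' : δ < 1 / 2) (n : ℕ) :
    ∃ C : Set Surface, ∀ p ∉ block δ (n + 10), connectedComponentIn (block δ n)ᶜ p = C := by
  set U : Set Surface := (block δ n)ᶜ with hUdef
  have near : ∀ (j : ℤ) (s : ℝ), j - δ < s → s < j + δ → Outside δ n s := fun j s h0 h1 =>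
    .inl ⟨j, by rw [abs_lt]; constructor <;> linarith⟩
  -- the regions around the two corners at the top of the right square of a row
  set v : Bool → ℤ → Set Surface :=
    fun b k => connectedComponentIn U (pt b (k + 1 + δ / 2, k + 1 - δ / 2)) with hv
  set w : Bool → ℤ → Set Surface :=
    fun b k => connectedComponentIn U (pt b (k + 2 - δ / 2, k + 1 + δ / 2)) with hw
  have region : ∀ (b : Bool) (i j : ℤ) {p q s t : ℝ}, Ioo p q ×ˢ Ioo s t ⊆ stair → i - δ ≤ p →
      q ≤ i + δ → j - δ ≤ s → t ≤ j + δ → ∀ z ∈ Ioo p q ×ˢ Ioo s t, ∀ z' ∈ Ioo p q ×ˢ Ioo s t,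
      connectedComponentIn U (pt b z) = connectedComponentIn U (pt b z') := by
    intro b i j p q s t hs h1 h2 h3 h4 z hz z' hz'
    refine connectedComponentIn_pt b (isPreconnected_rect _ _ _ _) hs (fun y hy => ?_) hz hz'
    exact pt_not_mem_block hδ (hs hy) (near i _ (h1.trans_lt hy.1.1) (hy.1.2.trans_le h2))
      (near j _ (h3.trans_lt hy.2.1) (hy.2.2.trans_le h4))
  have v1 : ∀ b (k : ℤ),
      ∀ z ∈ Ioo (k + 1 - δ) (k + 1 + δ) ×ˢ Ioo (k + 1 - δ) (k + 1 : ℝ),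
      connectedComponentIn U (pt b z) = v b k := fun b k z hz => by
    refine region b (k + 1) (k + 1) ?_ ?_ ?_ ?_ ?_ z hz _
      ⟨⟨by dsimp only; linarith, by dsimp only; linarith⟩,
        by dsimp only; linarith, by dsimp only; linarith⟩
    · rintro ⟨x, y⟩ ⟨⟨h0, h1⟩, h2, h3⟩
      dsimp only at h0 h1 h2 h3
      exact row_subset_stair (k) (mem_row.2 (by
        push_cast
        exact ⟨⟨by linarith, by linarith⟩, by linarith, by linarith⟩))
    all_goals push_cast; linarith
  have v2 : ∀ b (k : ℤ),
      ∀ z ∈ Ioo (k + 1 : ℝ) (k + 1 + δ) ×ˢ Ioo (k + 1 - δ) (k + 1 + δ),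
      connectedComponentIn U (pt b z) = v b k := fun b k z hz => by
    refine region b (k + 1) (k + 1) ?_ ?_ ?_ ?_ ?_ z hz _
      ⟨⟨by dsimp only; linarith, by dsimp only; linarith⟩,
        by dsimp only; linarith, by dsimp only; linarith⟩
    · rintro ⟨x, y⟩ ⟨⟨h0, h1⟩, h2, h3⟩
      dsimp only at h0 h1 h2 h3
      exact col_subset_stair (k + 1) (mem_col.2 (by
        push_cast
        exact ⟨⟨by linarith, by linarith⟩, by linarith, by linarith⟩))
    all_goals push_cast; linarith
  have w1 : ∀ b (k : ℤ),
      ∀ z ∈ Ioo (k + 2 - δ) (k + 2 + δ) ×ˢ Ioo (k + 1 : ℝ) (k + 1 + δ),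
      connectedComponentIn U (pt b z) = w b k := fun b k z hz => by
    refine region b (k + 2) (k + 1) ?_ ?_ ?_ ?_ ?_ z hz _
      ⟨⟨by dsimp only; linarith, by dsimp only; linarith⟩,
        by dsimp only; linarith, by dsimp only; linarith⟩
    · rintro ⟨x, y⟩ ⟨⟨h0, h1⟩, h2, h3⟩
      dsimp only at h0 h1 h2 h3
      exact row_subset_stair (k + 1) (mem_row.2 (by
        push_cast
        exact ⟨⟨by linarith, by linarith⟩, by linarith, by linarith⟩))
    all_goals push_cast; linarith
  have w2 : ∀ b (k : ℤ),
      ∀ z ∈ Ioo (k + 2 - δ) (k + 2 : ℝ) ×ˢ Ioo (k + 1 - δ) (k + 1 + δ),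
      connectedComponentIn U (pt b z) = w b k := fun b k z hz => by
    refine region b (k + 2) (k + 1) ?_ ?_ ?_ ?_ ?_ z hz _
      ⟨⟨by dsimp only; linarith, by dsimp only; linarith⟩,
        by dsimp only; linarith, by dsimp only; linarith⟩
    · rintro ⟨x, y⟩ ⟨⟨h0, h1⟩, h2, h3⟩
      dsimp only at h0 h1 h2 h3
      exact col_subset_stair (k + 1) (mem_col.2 (by
        push_cast
        exact ⟨⟨by linarith, by linarith⟩, by linarith, by linarith⟩))
    all_goals push_cast; linarith
  have left : ∀ {k : ℤ} {x y : ℝ}, k < x → x < k + 1 → k < y → y < k + 1 →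
      ((x, y) : ℝ × ℝ) ∈ row k ∩ col k := fun {k x y} h0 h1 h2 h3 => by
    constructor
    · rw [mem_row]; constructor <;> constructor <;> linarith
    · rw [mem_col]; constructor <;> constructor <;> linarith
  have right : ∀ {k : ℤ} {x y : ℝ}, k + 1 < x → x < k + 2 → k < y → y < k + 1 →
      ((x, y) : ℝ × ℝ) ∈ row k ∩ col (k + 1) := fun {k x y} h0 h1 h2 h3 => by
    constructor
    · rw [mem_row]; constructor <;> constructor <;> linarith
    · rw [mem_col]; push_cast; constructor <;> constructor <;> linarith
  have e1 : ∀ b k, v b k = w (!b) (-k) := fun b k => by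
    rw [← v1 b k (k + 1 - δ / 2, k + 1 - δ / 2) (by
        refine ⟨⟨?_, ?_⟩, ?_, ?_⟩ <;> dsimp only <;> linarith),
      pt_left (k := k) (left (by linarith) (by linarith) (by linarith) (by linarith))]
    refine w2 _ _ _ ?_
    refine ⟨⟨?_, ?_⟩, ?_, ?_⟩ <;> push_cast <;> linarith
  have e2 : ∀ b k, v b k = w (!b) (-k - 2) := fun b k => by
    rw [← v2 b k (k + 1 + δ / 2, k + 1 + δ / 2) (by
        refine ⟨⟨?_, ?_⟩, ?_, ?_⟩ <;> dsimp only <;> linarith),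
      pt_left (k := k + 1) (left (by push_cast; linarith) (by push_cast; linarith)
        (by push_cast; linarith) (by push_cast; linarith))]
    refine w1 _ _ _ ?_
    refine ⟨⟨?_, ?_⟩, ?_, ?_⟩ <;> push_cast <;> linarith
  have per : ∀ b m, w b (m + 2) = w b m := fun b m => by
    have h1 := e1 (!b) (-(m + 2))
    rw [e2, Bool.not_not] at h1
    rw [neg_neg, show m + 2 - 2 = m by ring] at h1
    exact h1.symm
  have farOut : ∀ (k : ℤ) (s : ℝ), n + 5 ≤ |k| → k - 1 ≤ s → s ≤ k + 2 → n + 2 < |s| := by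
    intro k s hk h0 h1
    rw [lt_abs]
    rcases le_total 0 k with h | h
    · rw [abs_of_nonneg h] at hk
      have : (n : ℝ) + 5 ≤ k := by exact_mod_cast hk
      left; linarith
    · rw [abs_of_nonpos h] at hk
      have : (n : ℝ) + 5 ≤ -k := by exact_mod_cast hk
      right; linarith
  have rowFar : ∀ b (k : ℤ), n + 5 ≤ |k| → ∀ z ∈ row k, ∀ z' ∈ row k,
      connectedComponentIn U (pt b z) = connectedComponentIn U (pt b z') := by
    intro b k hk z hz z' hz'
    refine connectedComponentIn_pt b (isPreconnected_row k) (row_subset_stair k) ?_ hz hz'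
    intro y hy
    have hr := mem_row.1 hy
    exact pt_not_mem_block hδ (row_subset_stair k hy)
      (.inr (farOut k _ hk (by linarith) (by linarith)))
      (.inr (farOut k _ hk (by linarith) (by linarith)))
  have colFar : ∀ b (k : ℤ), n + 5 ≤ |k| → ∀ z ∈ col k, ∀ z' ∈ col k,
      connectedComponentIn U (pt b z) = connectedComponentIn U (pt b z') := by
    intro b k hk z hz z' hz'
    refine connectedComponentIn_pt b (isPreconnected_col k) (col_subset_stair k) ?_ hz hz'
    intro y hy
    have hr := mem_col.1 hy
    exact pt_not_mem_block hδ (col_subset_stair k hy)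
      (.inr (farOut k _ hk (by linarith) (by linarith)))
      (.inr (farOut k _ hk (by linarith) (by linarith)))
  have e3 : ∀ b (k : ℤ), n + 5 ≤ |k + 1| → v b k = w b k := fun b k hk => by
    refine colFar b (k + 1) hk _ ?_ _ ?_ <;> rw [mem_col] <;> push_cast <;>
      constructor <;> constructor <;> linarith
  have e4 : ∀ b (k : ℤ), n + 5 ≤ |k + 1| → w b k = v b (k + 1) := fun b k hk => by
    refine rowFar b (k + 1) hk _ ?_ _ ?_ <;> rw [mem_row] <;> push_cast <;>
      constructor <;> constructor <;> linarith
  have hM : (n : ℤ) + 5 ≤ |(n + 5 : ℤ) + 1| := by rw [abs_of_nonneg (by positivity)]; omega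
  have hM' : (n : ℤ) + 5 ≤ |(n + 5 : ℤ) + 1 + 1| := by rw [abs_of_nonneg (by positivity)]; omega
  have hw' : ∀ b m m', w b m = w b m' := fun b => by
    refine const_of_add_two (per b) (M := n + 5) ?_
    rw [e4 b _ hM, e3 b _ hM']
  have hww : ∀ b m, w b m = w false 0 := fun b m => by
    cases b
    · exact hw' _ _ _
    · rw [hw' true m (n + 5), ← e3 true _ hM, e1]
      exact hw' _ _ _
  have hvv : ∀ b m, v b m = w false 0 := fun b m => by rw [e1, hww]
  refine ⟨w false 0, fun p hp => ?_⟩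
  obtain ⟨b, ⟨x, y⟩, hz, rfl⟩ := exists_pt p
  rcases corner_or_far hδ hδ' hz hp with ⟨⟨i, hi⟩, j, hj⟩ | ⟨hx, hy⟩
  · simp only [abs_lt] at hi hj
    rcases pt_cases hz with ⟨k, hk⟩ | ⟨l, h1, h2, h3⟩
    · simp only [mem_row] at hk
      obtain ⟨⟨a1, a2⟩, a3, a4⟩ := hk
      have hi' : i = k ∨ i = k + 1 ∨ i = k + 2 := by
        have r1 : (k : ℝ) < i + 1 := by linarith
        have r2 : (i : ℝ) < k + 3 := by linarith
        norm_cast at r1 r2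
        omega
      have hj' : j = k ∨ j = k + 1 := by
        have r1 : (k : ℝ) < j + 1 := by linarith
        have r2 : (j : ℝ) < k + 2 := by linarith
        norm_cast at r1 r2
        omega
      rcases hi' with rfl | rfl | rfl <;> rcases hj' with rfl | hj'
      · rw [← hvv b (j - 1)]
        refine v2 _ _ _ ⟨⟨?_, ?_⟩, ?_, ?_⟩ <;> push_cast <;> linarith
      · subst hj'
        push_cast at hj
        rw [pt_left (left a1 (by linarith) a3 a4), ← hvv (!b) (-i)]
        refine v1 _ _ _ ⟨⟨?_, ?_⟩, ?_, ?_⟩ <;> push_cast <;> linarith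
      · push_cast at hi
        rw [← hww b (j - 1)]
        refine w1 _ _ _ ⟨⟨?_, ?_⟩, ?_, ?_⟩ <;> push_cast <;> linarith
      · subst hj'
        push_cast at hi hj
        rw [← hvv b k]
        refine v1 _ _ _ ⟨⟨?_, ?_⟩, ?_, ?_⟩ <;> dsimp only <;> linarith
      · push_cast at hi
        rw [pt_right (right (by linarith) (by linarith) a3 a4), ← hww (!b) (-j - 1)]
        refine w2 _ _ _ ⟨⟨?_, ?_⟩, ?_, ?_⟩ <;> push_cast <;> linarith
      · subst hj'
        push_cast at hi hj
        rw [← hww b k]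
        refine w2 _ _ _ ⟨⟨?_, ?_⟩, ?_, ?_⟩ <;> dsimp only <;> linarith
    · simp only at h1 h2 h3
      subst h1
      have hi' : i = l ∨ i = l + 1 := by
        have r1 : (l : ℝ) < i + 1 := by linarith
        have r2 : (i : ℝ) < l + 2 := by linarith
        norm_cast at r1 r2
        omega
      rcases hi' with rfl | rfl
      · rw [← hvv b (i - 1)]
        refine v2 _ _ _ ⟨⟨?_, ?_⟩, ?_, ?_⟩ <;> push_cast <;> linarith
      · push_cast at hi
        rw [← hww b (l - 1)]
        refine w2 _ _ _ ⟨⟨?_, ?_⟩, ?_, ?_⟩ <;> push_cast <;> linarith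
  · have hk5 : ∀ k : ℤ, k ≤ y → y < k + 1 → n + 5 ≤ |k| := fun k h0 h1 => by
      dsimp only at hy
      rw [lt_abs] at hy
      rw [le_abs]
      rcases hy with hy | hy
      · left
        have : (n : ℝ) + 5 < k := by linarith
        exact_mod_cast this.le
      · right
        have : (n : ℝ) + 5 < -k := by linarith
        exact_mod_cast this.le
    rcases pt_cases hz with ⟨k, hk⟩ | ⟨l, h1, h2, h3⟩
    · have hr := mem_row.1 hk
      rw [← hvv b k]
      refine rowFar b k (hk5 k hr.2.1.le hr.2.2) _ hk _ ?_
      rw [mem_row]; constructor <;> constructor <;> linarith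
    · simp only at h1 h2 h3
      subst h1
      rw [← hvv b (l - 1)]
      refine colFar b l (hk5 l le_rfl (by linarith)) _ ?_ _ ?_ <;> rw [mem_col] <;> push_cast <;>
        constructor <;> constructor <;> linarith

lemma existsUnique_isEnd : ∃! e : Compacts Surface → Set Surface, IsEnd e := by
  refine FlatSurf.existsUnique_isEnd fun K => ?_
  obtain ⟨δ, hδ, hδ', n, hK⟩ := exists_subset_block K.isCompact
  obtain ⟨C, hC⟩ := connectedComponentIn_compl_block hδ hδ' n
  have comp : ∀ p ∉ block δ (n + 10), ∀ q ∉ block δ (n + 10),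
      connectedComponentIn (K : Set Surface)ᶜ p = connectedComponentIn (K : Set Surface)ᶜ q := by
    intro p hp q hq
    have hq' : q ∈ (block δ n)ᶜ := fun h => hq (block_mono le_rfl (by omega) h)
    refine (connectedComponentIn_eq ?_)
    refine connectedComponentIn_mono p (compl_subset_compl.2 hK) ?_
    rw [hC p hp, ← hC q hq]
    exact mem_connectedComponentIn hq'
  refine ⟨⟨block δ (n + 10), isCompact_block hδ _⟩, hK.trans (block_mono le_rfl (by omega)), ?_,
    comp⟩
  have hs : ((1 + δ / 2, 1 - δ / 2) : ℝ × ℝ) ∈ stair :=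
    row_subset_stair 0 (by rw [mem_row]; push_cast; constructor <;> constructor <;> linarith)
  refine ⟨pt false (1 + δ / 2, 1 - δ / 2), pt_not_mem_block hδ hs (.inl ⟨1, ?_⟩) (.inl ⟨1, ?_⟩)⟩ <;>
    rw [abs_lt] <;> push_cast <;> constructor <;> linarith

lemma isLochNessMonster : IsLochNessMonster Surface where
  t2 := inferInstance
  secondCountable := inferInstance
  connected := inferInstance
  locallyEuclidean x := by
    obtain ⟨b, hb⟩ := exists_chart one_pos x
    exact ⟨_, hb⟩
  orientable := ⟨orientation⟩
  infiniteGenus := genusAtLeast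
  oneEnd := existsUnique_isEnd

/-! ### Cutting along the diagonals -/

/-- A function whose zero set is the union of the diagonals, the open segments of slope one that
join two vertices; it is positive exactly on the diagonal strip `x - 1 < y < x` of the first copy of
the staircase, and negative on that of the second copy. -/
def side (p : Surface) : ℝ := (exists_torus_coordinates.choose p).2.im

lemma continuous_side : Continuous side :=
  Complex.continuous_im.comp (continuous_snd.comp exists_torus_coordinates.choose_spec.1)

lemma side_pt (b : Bool) {z : ℝ × ℝ} (hz : z ∈ stair) :
    side (pt b z) = sign b * Real.sin (Real.pi * (z.1 - z.2)) := by
  rw [side, exists_torus_coordinates.choose_spec.2 b z hz]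
  dsimp only
  rw [← Complex.ofReal_mul, Complex.im_ofReal_mul, Complex.exp_ofReal_mul_I_im]

lemma sin_pi_mul_pos {d : ℝ} (h0 : 0 < d) (h1 : d < 1) : 0 < Real.sin (Real.pi * d) :=
  Real.sin_pos_of_pos_of_lt_pi (by positivity) (by nlinarith [Real.pi_pos])

lemma sin_pi_mul_neg_left {d : ℝ} (h0 : -1 < d) (h1 : d < 0) : Real.sin (Real.pi * d) < 0 :=
  Real.sin_neg_of_neg_of_neg_pi_lt (by nlinarith [Real.pi_pos]) (by nlinarith [Real.pi_pos])

lemma sin_pi_mul_neg_right {d : ℝ} (h0 : 1 < d) (h1 : d < 2) : Real.sin (Real.pi * d) < 0 := by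
  have := sin_pi_mul_pos (d := d - 1) (by linarith) (by linarith)
  rw [mul_sub, mul_one, Real.sin_sub_pi] at this
  linarith

/-- The points on one side of the diagonals lie in the corresponding diagonal strip. -/
lemma exists_strip (c : Bool) {p : Surface} (hp : 0 ≤ sign c * side p) :
    ∃ z ∈ stair, p = pt c z ∧ 0 ≤ z.1 - z.2 ∧ z.1 - z.2 ≤ 1 := by
  obtain ⟨b, z, hz, rfl⟩ := exists_pt p
  have hd : -1 < z.1 - z.2 ∧ z.1 - z.2 < 2 := by
    obtain ⟨k, h | h⟩ := mem_stair.1 hz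
    · rw [mem_row] at h; constructor <;> linarith
    · rw [mem_col] at h; constructor <;> linarith
  rw [side_pt b hz] at hp
  have hsq : ∀ b, sign b * sign b = 1 := fun b => by cases b <;> simp [sign]
  by_cases hbc : b = c
  · subst hbc
    rw [← mul_assoc, hsq, one_mul] at hp
    refine ⟨z, hz, rfl, ?_, ?_⟩
    · by_contra! h; exact absurd hp (sin_pi_mul_neg_left hd.1 h).not_ge
    · by_contra! h; exact absurd hp (sin_pi_mul_neg_right h hd.2).not_ge
  · obtain rfl : c = !b := by cases b <;> cases c <;> simp_all
    rw [sign_not, ← mul_assoc, neg_mul, hsq, neg_mul, one_mul] at hp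
    by_cases h : z.1 - z.2 ≤ 0
    · obtain ⟨k, hk⟩ : ∃ k, z ∈ row k ∩ col k := by
        obtain ⟨k, h' | h'⟩ := mem_stair.1 hz
        · refine ⟨k, h', ?_⟩
          rw [mem_row] at h'; rw [mem_col]; constructor <;> constructor <;> linarith
        · refine ⟨k, ?_, h'⟩
          rw [mem_col] at h'; rw [mem_row]; constructor <;> constructor <;> linarith
      have hg : Glued z (z.1 + (1 - 2 * k), z.2 - 2 * k) := ⟨k, .inl ⟨hk, rfl⟩⟩
      exact ⟨_, hg.mem_stair', hg.pt_eq b, by dsimp only; linarith, by dsimp only; linarith⟩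
    · by_cases h' : z.1 - z.2 < 1
      · have := sin_pi_mul_pos (not_le.1 h) h'
        linarith
      · obtain ⟨k, hk⟩ : ∃ k : ℤ, z ∈ row k ∩ col (k + 1) := by
          obtain ⟨k, h' | h'⟩ := mem_stair.1 hz
          · refine ⟨k, h', ?_⟩
            rw [mem_row] at h'; rw [mem_col]; push_cast; constructor <;> constructor <;> linarith
          · refine ⟨k - 1, ?_, by rwa [sub_add_cancel]⟩
            rw [mem_col] at h'; rw [mem_row]; push_cast; constructor <;> constructor <;> linarith
        have hg : Glued z (z.1 - (1 + 2 * k), z.2 - 2 * k) := ⟨k, .inr ⟨hk, rfl⟩⟩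
        exact ⟨_, hg.mem_stair', hg.pt_eq b, by dsimp only; linarith, by dsimp only; linarith⟩

lemma strip_subset_stair {z : ℝ × ℝ} (h0 : 0 < z.1 - z.2) (h1 : z.1 - z.2 < 1) : z ∈ stair := by
  have a := Int.floor_le z.2
  have b := Int.lt_floor_add_one z.2
  rcases a.eq_or_lt with h | h
  · refine col_subset_stair ⌊z.2⌋ (mem_col.2 ?_)
    constructor <;> constructor <;> linarith
  · refine row_subset_stair ⌊z.2⌋ (mem_row.2 ?_)
    constructor <;> constructor <;> linarith

/-- The midpoint of the diagonal of the square `(0, 1)²` of the first copy, seen in both copies. -/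
def center (c : Bool) : ℝ × ℝ := if c then (3 / 2, 1 / 2) else (1 / 2, 1 / 2)

lemma center_mem (c : Bool) : center c ∈ stair :=
  row_subset_stair 0 (by cases c <;> simp [center, mem_row] <;> norm_num)

lemma pt_center (c : Bool) : pt c (center c) = pt false (1 / 2, 1 / 2) := by
  cases c
  · rfl
  · rw [pt_left half_mem_square]
    simp [center]
    norm_num

/-- The segment from a point of a diagonal strip to the center, in planar coordinates. -/
def toCenter (c : Bool) (t : ℝ) (z : ℝ × ℝ) : ℝ × ℝ := (1 - t) • z + t • center c

lemma toCenter_mem {c : Bool} {t : ℝ} {z : ℝ × ℝ} (ht : t ∈ Icc (0 : ℝ) 1) (hz : z ∈ stair)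
    (h0 : 0 ≤ z.1 - z.2) (h1 : z.1 - z.2 ≤ 1)
    (h : z.1 - z.2 = 0 ∨ z.1 - z.2 = 1 → t = 0 ∨ t = 1) : toCenter c t z ∈ stair := by
  by_cases ht1 : t = 1
  · simpa [toCenter, ht1] using center_mem c
  by_cases ht0 : t = 0
  · simpa [toCenter, ht0] using hz
  have hlt : t < 1 := lt_of_le_of_ne ht.2 ht1
  have hgt : 0 < t := lt_of_le_of_ne ht.1 (Ne.symm ht0)
  have h0' : 0 < z.1 - z.2 := h0.lt_of_ne fun e => by
    rcases h (.inl e.symm) with h | h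
    · exact ht0 h
    · exact ht1 h
  have h1' : z.1 - z.2 < 1 := h1.lt_of_ne fun e => by
    rcases h (.inr e) with h | h
    · exact ht0 h
    · exact ht1 h
  apply strip_subset_stair
  · cases c <;> simp [toCenter, center] <;> nlinarith
  · cases c <;> simp [toCenter, center] <;> nlinarith

/-- The contraction of each of the two diagonal strips to the center along straight segments. The
two contractions do not agree on the diagonals, except at the times zero and one. -/
def contract (t : ℝ) (p : Surface) : Surface :=
  if 0 ≤ side p then pt false (toCenter false t ((planar false).symm p))
  else pt true (toCenter true t ((planar true).symm p))

lemma contract_half {c : Bool} {X : Type*} [TopologicalSpace X] {g : X → ℝ} {G : X → Surface}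
    (hg : Continuous g) (hG : Continuous G) (h01 : ∀ x, g x ∈ Icc (0 : ℝ) 1)
    (hD : ∀ x, side (G x) = 0 → g x = 0 ∨ g x = 1) :
    ContinuousOn (fun x => pt c (toCenter c (g x) ((planar c).symm (G x))))
      {x | 0 ≤ sign c * side (G x)} := by
  refine (continuousOn_pt c).comp ?_ ?_
  · unfold toCenter
    have : ContinuousOn (fun x => (planar c).symm (G x)) {x | 0 ≤ sign c * side (G x)} := by
      refine (planar c).continuousOn_symm.comp hG.continuousOn fun x hx => ?_
      obtain ⟨z, hz, e, -⟩ := exists_strip c hx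
      rw [e]
      exact ⟨z, hz, rfl⟩
    exact ((continuous_const.sub hg).continuousOn.smul this).add
      (hg.continuousOn.smul continuousOn_const)
  · intro x hx
    obtain ⟨z, hz, e, h0, h1⟩ := exists_strip c hx
    dsimp only
    have hside := side_pt c hz
    rw [← e] at hside
    rw [e, planar_symm_pt c hz]
    refine toCenter_mem (h01 x) hz h0 h1 fun h => hD x ?_
    rw [hside]
    rcases h with h | h <;> simp [h]

lemma contract_zero (p : Surface) : contract 0 p = p := by
  have key : ∀ c, 0 ≤ sign c * side p → pt c (toCenter c 0 ((planar c).symm p)) = p := by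
    intro c hc
    obtain ⟨z, hz, e, -⟩ := exists_strip c hc
    rw [e, planar_symm_pt c hz]
    simp [toCenter]
  unfold contract
  split_ifs with h
  · exact key false (by simpa [sign] using h)
  · exact key true (by simpa [sign] using (not_le.1 h).le)

lemma contract_one (p : Surface) : contract 1 p = pt false (1 / 2, 1 / 2) := by
  unfold contract
  simp only [toCenter, sub_self, zero_smul, one_smul, zero_add, pt_center, ite_self]

lemma continuous_contract {X : Type*} [TopologicalSpace X] {g : X → ℝ} {G : X → Surface}
    (hg : Continuous g) (hG : Continuous G) (h01 : ∀ x, g x ∈ Icc (0 : ℝ) 1)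
    (hD : ∀ x, side (G x) = 0 → g x = 0 ∨ g x = 1) : Continuous fun x => contract (g x) (G x) := by
  unfold contract
  refine continuous_if_le continuous_const (continuous_side.comp hG) ?_ ?_ fun x hx => ?_
  · simpa [sign] using contract_half (c := false) hg hG h01 hD
  · simpa [sign] using contract_half (c := true) hg hG h01 hD
  · have key : ∀ c, pt c (toCenter c (g x) ((planar c).symm (G x))) =
        if g x = 0 then G x else pt false (1 / 2, 1 / 2) := by
      intro c
      obtain ⟨z, hz, e, -⟩ := exists_strip c (p := G x)
        (by rw [show side (G x) = 0 from hx.symm, mul_zero])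
      rcases hD x hx.symm with h | h
      · rw [h, if_pos rfl]
        conv_lhs => rw [e, planar_symm_pt c hz]
        rw [e]
        simp [toCenter]
      · rw [h, if_neg one_ne_zero, ← pt_center c]
        simp [toCenter]
    rw [key, key]

/-- The diagonal of the `k`-th square on the main diagonal of the copy `b`. These are the diagonals
of all squares of the surface. -/
def diagonal (b : Bool) (k : ℤ) : Set Surface := {p | ∃ x : ℝ, k < x ∧ x < k + 1 ∧ p = pt b (x, x)}

lemma diag_mem {k : ℤ} {x y : ℝ} (h0 : k < x) (h1 : x < k + 1) (h2 : k < y) (h3 : y < k + 1) :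
    ((x, y) : ℝ × ℝ) ∈ row k ∩ col k := by
  constructor
  · rw [mem_row]; constructor <;> constructor <;> linarith
  · rw [mem_col]; constructor <;> constructor <;> linarith

lemma side_diagonal {b : Bool} {k : ℤ} {p : Surface} (hp : p ∈ diagonal b k) : side p = 0 := by
  obtain ⟨x, h0, h1, rfl⟩ := hp
  rw [side_pt b (row_subset_stair k (diag_mem h0 h1 h0 h1).1)]
  simp

lemma exists_diagonal {p : Surface} (hp : side p = 0) : ∃ b k, p ∈ diagonal b k := by
  obtain ⟨⟨x, y⟩, hz, rfl, h0, h1⟩ := exists_strip false (p := p) (by rw [hp, mul_zero])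
  rw [side_pt _ hz] at hp
  dsimp only at h0 h1 hp
  rcases h0.eq_or_lt with h0 | h0
  · obtain rfl : x = y := by linarith
    obtain ⟨k, h | h⟩ := mem_stair.1 hz
    · rw [mem_row] at h
      exact ⟨false, k, x, h.2.1, h.2.2, rfl⟩
    · rw [mem_col] at h
      exact ⟨false, k, x, h.1.1, h.1.2, rfl⟩
  rcases h1.eq_or_lt with h1 | h1
  · obtain ⟨k, hk⟩ : ∃ k : ℤ, (x, y) ∈ row k ∩ col (k + 1) := by
      obtain ⟨k, h' | h'⟩ := mem_stair.1 hz
      · refine ⟨k, h', ?_⟩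
        rw [mem_row] at h'; rw [mem_col]; push_cast
        dsimp only at h' ⊢
        constructor <;> constructor <;> linarith
      · refine ⟨k - 1, ?_, by rwa [sub_add_cancel]⟩
        rw [mem_col] at h'; rw [mem_row]; push_cast
        dsimp only at h' ⊢
        constructor <;> constructor <;> linarith
    refine ⟨true, -k, y - 2 * k, ?_, ?_, ?_⟩
    · have := (mem_row.1 hk.1).2.1; push_cast; linarith
    · have := (mem_row.1 hk.1).2.2; push_cast; linarith
    · rw [pt_right hk]
      dsimp only
      rw [show x - (1 + 2 * (k : ℝ)) = y - 2 * k by linarith]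
      rfl
  · have := sin_pi_mul_pos h0 h1
    simp [sign] at hp
    linarith

/-- In the square that contains a diagonal there are no points of other diagonals. -/
lemma diagonal_unique {b b' : Bool} {k k' : ℤ} {z : ℝ × ℝ} (hz : z ∈ row k ∩ col k)
    (h : pt b z ∈ diagonal b' k') : b = b' ∧ k = k' := by
  obtain ⟨x, h0, h1, e⟩ := h
  have hx := diag_mem h0 h1 h0 h1
  rw [pt_eq_iff (row_subset_stair k hz.1) (row_subset_stair k' hx.1)] at e
  rcases e with ⟨rfl, rfl⟩ | ⟨-, l, ⟨h2, h3⟩ | ⟨h2, -⟩⟩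
  · exact ⟨rfl, row_unique hz.1 hx.1⟩
  · obtain rfl := row_unique hz.1 h2.1
    have r1 := mem_row.1 hz.1
    have r2 := mem_col.1 hz.2
    rw [Prod.mk.injEq] at h3
    linarith [h3.1, h3.2]
  · obtain rfl := row_unique hz.1 h2.1
    have := col_unique hz.2 h2.2
    omega

lemma isClosed_iUnion_diagonal (J : Set (Bool × ℤ)) : IsClosed (⋃ i ∈ J, diagonal i.1 i.2) := by
  rw [← isOpen_compl_iff, isOpen_iff_mem_nhds]
  intro p hp
  by_cases hs : side p = 0
  · obtain ⟨b, k, x, h0, h1, rfl⟩ := exists_diagonal hs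
    have hx := diag_mem h0 h1 h0 h1
    have ho : IsOpen (row k ∩ col k) := (isOpen_row k).inter (isOpen_col k)
    refine mem_of_superset ((isOpen_image_pt b ho fun z hz => row_subset_stair k hz.1).mem_nhds
      ⟨_, hx, rfl⟩) ?_
    rintro _ ⟨z, hz, rfl⟩ hq
    simp only [mem_iUnion] at hq
    obtain ⟨⟨b', k'⟩, hi, hq⟩ := hq
    obtain ⟨rfl, rfl⟩ := diagonal_unique hz hq
    exact hp (mem_biUnion hi ⟨x, h0, h1, rfl⟩)
  · refine mem_of_superset ((continuous_side.isOpen_preimage _ isOpen_compl_singleton).mem_nhds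
      (show p ∈ side ⁻¹' {0}ᶜ from hs)) fun q hq hq' => ?_
    simp only [mem_iUnion] at hq'
    obtain ⟨i, -, hi⟩ := hq'
    exact hq (side_diagonal hi)

/-- The diagonals with small index. -/
def innerDiagonals (n : ℕ) : Set Surface := ⋃ i ∈ {i : Bool × ℤ | |i.2| ≤ n}, diagonal i.1 i.2

/-- The diagonals with large index. -/
def outerDiagonals (n : ℕ) : Set Surface := ⋃ i ∈ {i : Bool × ℤ | n < |i.2|}, diagonal i.1 i.2

lemma disjoint_diagonals (n : ℕ) : Disjoint (innerDiagonals n) (outerDiagonals n) := by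
  rw [disjoint_left]
  intro p h h'
  simp only [innerDiagonals, outerDiagonals, mem_iUnion] at h h'
  obtain ⟨⟨b, k⟩, hk, x, h0, h1, rfl⟩ := h
  obtain ⟨⟨b', k'⟩, hk', h'⟩ := h'
  obtain ⟨rfl, rfl⟩ := diagonal_unique (diag_mem h0 h1 h0 h1) h'
  exact not_le.2 (show (n : ℤ) < |k| from hk') hk

lemma side_eq_zero {p : Surface} (n : ℕ) (hp : side p = 0) :
    p ∈ innerDiagonals n ∨ p ∈ outerDiagonals n := by
  obtain ⟨b, k, hk⟩ := exists_diagonal hp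
  rcases le_or_gt |k| (n : ℤ) with h | h
  · exact .inl (mem_biUnion (x := (b, k)) h hk)
  · exact .inr (mem_biUnion (x := (b, k)) h hk)

lemma exists_disjoint_outerDiagonals {K : Set Surface} (hK : IsCompact K) :
    ∃ n, Disjoint K (outerDiagonals n) := by
  obtain ⟨n, hn⟩ := hK.elim_directed_cover (fun n => (outerDiagonals n)ᶜ)
    (fun n => (isClosed_iUnion_diagonal _).isOpen_compl) (fun p _ => by
      rw [mem_iUnion]
      by_cases hs : side p = 0
      · obtain ⟨b, k, hk⟩ := exists_diagonal hs
        refine ⟨k.natAbs, fun h => ?_⟩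
        refine disjoint_left.1 (disjoint_diagonals k.natAbs) ?_ h
        exact mem_biUnion (x := (b, k)) (show |k| ≤ (k.natAbs : ℤ) by simp) hk
      · refine ⟨0, fun h => ?_⟩
        simp only [outerDiagonals, mem_iUnion] at h
        obtain ⟨i, -, hi⟩ := h
        exact hs (side_diagonal hi))
    (directed_of_isDirected_le fun m n h => compl_subset_compl.2
      (biUnion_mono (fun i (hi : (n : ℤ) < |i.2|) => show (m : ℤ) < |i.2| from
        lt_of_le_of_lt (by exact_mod_cast h) hi) fun _ _ => Subset.rfl))
  exact ⟨n, disjoint_left.2 fun p hp h => hn hp h⟩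

instance : WeaklyLocallyCompactSpace Surface where
  exists_compact_mem_nhds p := by
    obtain ⟨b, z, hz, rfl⟩ := exists_pt p
    obtain ⟨K, hK, hzK, hs⟩ := exists_compact_subset isOpen_stair hz
    refine ⟨pt b '' K, hK.image_of_continuousOn ((continuousOn_pt b).mono hs), ?_⟩
    rw [nhds_pt b hz]
    exact image_mem_map (mem_interior_iff_mem_nhds.1 hzK)

/-- If a closed curve avoids all diagonals outside of a finite collection, and is homotopic to a
curve that avoids this collection, then it is homotopic to a point. -/
lemma nullhomotopic_of_avoids {X : Type*} [TopologicalSpace X] {c c' : C(X, Surface)} (n : ℕ)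
    (h : c.Homotopic c')
    (hc : ∀ z, c z ∉ outerDiagonals n) (hc' : ∀ z, c' z ∉ innerDiagonals n) :
    c.Nullhomotopic := by
  obtain ⟨τ, τ0, τ1, τ01⟩ := exists_continuous_zero_one_of_isClosed
    (isClosed_iUnion_diagonal _) (isClosed_iUnion_diagonal _) (disjoint_diagonals n)
  have hD : ∀ p, side p = 0 → τ p = 0 ∨ τ p = 1 := fun p hp =>
    (side_eq_zero n hp).imp (fun h => τ0 h) (fun h => τ1 h)
  obtain ⟨H⟩ := h
  let k : C(X, Surface) := ⟨fun z => contract (τ (c z)) (c z),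
    continuous_contract (by fun_prop) (by fun_prop) (fun _ => τ01 _) fun _ => hD _⟩
  let k' : C(X, Surface) := ⟨fun z => contract (τ (c' z)) (c' z),
    continuous_contract (by fun_prop) (by fun_prop) (fun _ => τ01 _) fun _ => hD _⟩
  have h1 : c.Homotopic k := by
    refine ⟨⟨⟨fun q => contract (q.1 * τ (c q.2)) (c q.2), continuous_contract (by fun_prop)
      (by fun_prop) (fun q => ?_) fun q hq => .inl ?_⟩, fun z => ?_, fun z => ?_⟩⟩
    · exact ⟨mul_nonneg q.1.2.1 (τ01 _).1, mul_le_one₀ q.1.2.2 (τ01 _).1 (τ01 _).2⟩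
    · have := τ0 ((side_eq_zero n hq).resolve_right (hc q.2))
      rw [this, Pi.zero_apply, mul_zero]
    · simp [contract_zero]
    · simp [k]
  have h2 : k.Homotopic k' :=
    ⟨⟨⟨fun q => contract (τ (H q)) (H q), continuous_contract (by fun_prop) (by fun_prop)
      (fun _ => τ01 _) fun _ => hD _⟩, fun z => by simp [k], fun z => by simp [k']⟩⟩
  have h3 : k'.Homotopic (ContinuousMap.const X (pt false (1 / 2, 1 / 2))) := by
    refine ⟨⟨⟨fun q => contract (q.1 + (1 - q.1) * τ (c' q.2)) (c' q.2),
      continuous_contract (by fun_prop)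
      (by fun_prop) (fun q => ?_) fun q hq => .inr ?_⟩, fun z => ?_, fun z => ?_⟩⟩
    · have a := q.1.2
      have b := τ01 (c' q.2)
      constructor
      · nlinarith [a.1, a.2, b.1, b.2]
      · nlinarith [a.1, a.2, b.1, b.2]
    · have := τ1 ((side_eq_zero n hq).resolve_left (hc' q.2))
      rw [this, Pi.one_apply]
      ring
    · simp [k']
    · simp [contract_one]
  exact ⟨_, (h1.trans h2).trans h3⟩

end Staircase

/-! ### Curves fixed by a mapping class -/

section Fixes

variable {S : Type*} [TopologicalSpace S]

/-- If a homeomorphism is isotopic to one that moves a simple closed curve to an isotopic one, then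
it moves the curve, up to homotopy, to a reparametrization of the curve. -/
lemma exists_reparametrization [T2Space S] {F : S ≃ₜ S} {c : SimpleClosedCurve S}
    (h : MappingClass.Fixes (QuotientGroup.mk F) c) :
    ∃ h : C(Circle, Circle), ((F : C(S, S)).comp c.toMap).Homotopic (c.toMap.comp h) := by
  obtain ⟨φ, hφ, H, -, H0, H1⟩ := h
  obtain ⟨Φ, h1, h2, h3⟩ := QuotientGroup.eq.1 hφ
  have e1 : ((F : C(S, S)).comp c.toMap).Homotopic ((φ : C(S, S)).comp c.toMap) := by
    refine .symm ⟨⟨⟨fun q => φ (Φ (q.1, c.toMap q.2)).2, by fun_prop⟩, fun z => ?_, fun z => ?_⟩⟩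
    · change φ (Φ (0, c.toMap z)).2 = φ (c.toMap z)
      rw [h2]
    · change φ (Φ (1, c.toMap z)).2 = F (c.toMap z)
      rw [h3]
      exact φ.apply_symm_apply _
  have hcont : Continuous fun z => H (1, z) := by fun_prop
  have e2 : ((φ : C(S, S)).comp c.toMap).Homotopic ⟨fun z => H (1, z), hcont⟩ :=
    ⟨⟨H, H0, fun z => rfl⟩⟩
  have emb := (c.toMap.continuous.isClosedEmbedding c.injective).isEmbedding
  have hmem : ∀ z, H (1, z) ∈ range c.toMap := fun z => by
    change _ ∈ c.image
    rw [← H1]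
    exact ⟨z, rfl⟩
  refine ⟨⟨fun z => emb.toHomeomorph.symm ⟨H (1, z), hmem z⟩, by fun_prop⟩, ?_⟩
  convert e1.trans e2 using 1
  ext z
  exact congrArg Subtype.val (emb.toHomeomorph.apply_symm_apply ⟨H (1, z), hmem z⟩)

/-- A homeomorphism that moves a curve to a reparametrization of it, up to homotopy, does so with
all its powers. -/
lemma exists_reparametrization_pow {F : S ≃ₜ S} {c : C(Circle, S)} {h : C(Circle, Circle)}
    (hF : ((F : C(S, S)).comp c).Homotopic (c.comp h)) (m : ℕ) :
    ∃ h : C(Circle, Circle), (((F ^ m : S ≃ₜ S) : C(S, S)).comp c).Homotopic (c.comp h) := by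
  induction m with
  | zero => exact ⟨ContinuousMap.id _, .refl _⟩
  | succ m ih =>
    obtain ⟨g, hg⟩ := ih
    refine ⟨h.comp g, ?_⟩
    rw [pow_succ']
    exact ((ContinuousMap.Homotopic.refl (F : C(S, S))).comp hg).trans
      (hF.comp (ContinuousMap.Homotopic.refl g))

end Fixes

namespace Staircase

/-! ### The multitwist product shifts the diagonals -/

lemma affineTwist_one_cyl (b : Bool) (k : ℤ) {x y : ℝ} (h0 : 0 < y) (h1 : y < 1) :
    (affineTwist one_pos).twist () (cyl b k (x, y)) = cyl b k (x + 2 * y, y) := by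
  rw [LeafMap.twist_apply, leafwise_cyl_copy ((affineTwist one_pos).add_two ()) b k h0 h1]
  have := cylCoord_leafCopy one_pos b k x y
  rw [cylCoord_of_one, cylCoord_of_one, weight_one] at this
  rw [this]
  congr 3
  norm_num

lemma affineTwist_one_symm_cyl (b : Bool) (k : ℤ) {x y : ℝ} (h0 : 0 < y) (h1 : y < 1) :
    ((affineTwist one_pos).twist ())⁻¹ (cyl b k (x, y)) = cyl b k (x - 2 * y, y) := by
  have := affineTwist_one_cyl b k (x := x - 2 * y) h0 h1
  rw [sub_add_cancel] at this
  rw [← this]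
  exact Homeomorph.symm_apply_apply _ _

/-- The affine product for the square-tiled structure reverses the direction `(1, 1)`, and moves
every diagonal to the preceding one. -/
lemma affineProduct_diagonal (b : Bool) {k : ℤ} {x : ℝ} (h0 : k < x) (h1 : x < k + 1) :
    affineProduct one_pos (pt b (x, x)) = pt b (2 * k - x, 2 * k - x) := by
  have e1 : reflection (((affineTwist one_pos).twist ())⁻¹ (reflection⁻¹ (pt b (x, x)))) =
      pt b (x, 2 * k - x) := by
    have : reflection⁻¹ (pt b (x, x)) = _ :=
      reflection_symm_pt b (row_subset_stair k (diag_mem h0 h1 h0 h1).1)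
    rw [this]
    cases b
    · have hr : ((x, x - 1) : ℝ × ℝ) ∈ row (k - 1) := by
        rw [mem_row]; push_cast; constructor <;> constructor <;> linarith
      have hr' : ((2 * k - x, x - 1) : ℝ × ℝ) ∈ row (k - 1) := by
        rw [mem_row]; push_cast; constructor <;> constructor <;> linarith
      change reflection (((affineTwist one_pos).twist ())⁻¹ (pt false (x, x - 1))) = _
      rw [pt_eq_cyl _ hr, affineTwist_one_symm_cyl _ _ (by push_cast; linarith)
        (by push_cast; linarith), cyl_eq _ _ 0 (by push_cast; linarith) (by push_cast; linarith)]
      have : (((k - 1 : ℤ) : ℝ) + (((x, x - 1) : ℝ × ℝ).1 - ((k - 1 : ℤ) : ℝ) -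
          2 * (((x, x - 1) : ℝ × ℝ).2 - ((k - 1 : ℤ) : ℝ)) - 2 * ((0 : ℤ) : ℝ)),
          ((k - 1 : ℤ) : ℝ) + (((x, x - 1) : ℝ × ℝ).2 - ((k - 1 : ℤ) : ℝ))) =
          ((2 * k - x, x - 1) : ℝ × ℝ) := by
        ext <;> push_cast <;> ring
      rw [this, reflection_pt _ (row_subset_stair _ hr')]
      simp [reflMap]
    · have hr : ((x + 1, x) : ℝ × ℝ) ∈ row k := by
        rw [mem_row]; constructor <;> constructor <;> linarith
      have hr' : ((2 * k + 1 - x, x) : ℝ × ℝ) ∈ row k := by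
        rw [mem_row]; constructor <;> constructor <;> linarith
      change reflection (((affineTwist one_pos).twist ())⁻¹ (pt true (x + 1, x))) = _
      rw [pt_eq_cyl _ hr, affineTwist_one_symm_cyl _ _ (by dsimp only; linarith)
        (by dsimp only; linarith), cyl_eq _ _ 0 (by push_cast; linarith) (by push_cast; linarith)]
      have : ((k : ℝ) + (((x + 1, x) : ℝ × ℝ).1 - k -
          2 * (((x + 1, x) : ℝ × ℝ).2 - k) - 2 * ((0 : ℤ) : ℝ)),
          (k : ℝ) + (((x + 1, x) : ℝ × ℝ).2 - k)) =
          ((2 * k + 1 - x, x) : ℝ × ℝ) := by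
        ext <;> push_cast <;> ring
      rw [this, reflection_pt _ (row_subset_stair _ hr')]
      simp [reflMap]
      ring_nf
  change (affineTwist one_pos).twist ()
    (reflection (((affineTwist one_pos).twist ())⁻¹ (reflection⁻¹ (pt b (x, x))))) = _
  have hr : ((x, 2 * k - x) : ℝ × ℝ) ∈ row (k - 1) := by
    rw [mem_row]; push_cast; constructor <;> constructor <;> linarith
  rw [e1, pt_eq_cyl _ hr, affineTwist_one_cyl _ _ (by push_cast; linarith)
    (by push_cast; linarith), cyl_eq _ _ 1 (by push_cast; linarith) (by push_cast; linarith)]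
  congr 1
  ext <;> push_cast <;> ring

lemma affineProduct_mem_diagonal {b : Bool} {k : ℤ} {p : Surface} :
    affineProduct one_pos p ∈ diagonal b k ↔ p ∈ diagonal b (k + 1) := by
  constructor
  · rintro ⟨x, h0, h1, e⟩
    have := affineProduct_diagonal b (k := k + 1) (x := 2 * (k + 1) - x) (by push_cast; linarith)
      (by push_cast; linarith)
    push_cast at this
    rw [sub_sub_cancel, ← e] at this
    refine ⟨2 * (k + 1) - x, by push_cast; linarith, by push_cast; linarith, ?_⟩
    exact ((affineProduct one_pos).injective this).symm
  · rintro ⟨x, h0, h1, rfl⟩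
    rw [affineProduct_diagonal b h0 h1]
    push_cast at h0 h1 ⊢
    exact ⟨_, by linarith, by linarith, rfl⟩

lemma affineProduct_pow_mem_diagonal {b : Bool} {k : ℤ} (m : ℕ) {p : Surface} :
    ((affineProduct one_pos) ^ m : Surface ≃ₜ Surface) p ∈ diagonal b k ↔
      p ∈ diagonal b (k + m) := by
  induction m generalizing p with
  | zero => simp
  | succ m ih =>
    rw [pow_succ, Homeomorph.mul_apply, ih, affineProduct_mem_diagonal]
    push_cast
    rw [add_assoc]

/-- No power of the product of the multitwists fixes an essential curve: a large multiple of the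
power moves the curve off the finitely many diagonals that it meets. -/
lemma not_fixes {k : ℕ} (hk : 1 ≤ k) {c : SimpleClosedCurve Surface} (hc : c.IsEssential) :
    ¬ MappingClass.Fixes
      ((QuotientGroup.mk (affineProduct one_pos) : MappingClass Surface) ^ k) c := by
  intro h
  rw [← QuotientGroup.mk_pow] at h
  obtain ⟨h₁, hh₁⟩ := exists_reparametrization h
  obtain ⟨n, hn⟩ := exists_disjoint_outerDiagonals (isCompact_range c.toMap.continuous)
  obtain ⟨g, hg⟩ := exists_reparametrization_pow hh₁ (2 * n + 1)
  set G : Surface ≃ₜ Surface := ((affineProduct one_pos) ^ k) ^ (2 * n + 1) with hG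
  have key : (c.toMap.comp g).Nullhomotopic := by
    refine nullhomotopic_of_avoids n hg.symm (fun z => disjoint_left.1 hn ⟨g z, rfl⟩)
      fun z hz => disjoint_left.1 hn ⟨z, rfl⟩ ?_
    simp only [innerDiagonals, mem_iUnion] at hz
    obtain ⟨⟨b, j⟩, hj, hz⟩ := hz
    change G (c.toMap z) ∈ diagonal b j at hz
    rw [hG, ← pow_mul, affineProduct_pow_mem_diagonal] at hz
    refine mem_biUnion (x := (b, j + (k * (2 * n + 1) : ℕ))) ?_ hz
    change (n : ℤ) < |j + (k * (2 * n + 1) : ℕ)|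
    have hj' : |j| ≤ (n : ℤ) := hj
    rw [abs_le] at hj'
    have : 1 * (2 * n + 1) ≤ k * (2 * n + 1) := Nat.mul_le_mul_right _ hk
    rw [lt_abs]
    left
    omega
  obtain ⟨p, hp⟩ := key
  have null : (((G : C(Surface, Surface)).comp c.toMap)).Nullhomotopic := ⟨p, hg.trans hp⟩
  apply hc
  have := null.comp_right (G.symm : C(Surface, Surface))
  convert this using 1
  ext z
  exact (G.symm_apply_apply _).symm

end Staircase

/-! ### Affine automorphisms that are isotopic to the identity -/

lemma exp_eq_of_abs_lt {s t : ℝ} (h : Circle.exp s = Circle.exp t) (hs : |s| < Real.pi)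
    (ht : |t| < Real.pi) : s = t := by
  rw [abs_lt] at hs ht
  rw [← Circle.arg_exp hs.1 hs.2.le, h, Circle.arg_exp ht.1 ht.2.le]

/-- If a map to the circle has, near every point, a logarithm that increases to the right of the
point, then every logarithm of the map increases. -/
lemma le_of_local_log {θ : ℝ → ℝ} (hθ : Continuous θ) {a b : ℝ} (hab : a ≤ b)
    (h : ∀ s₀ ∈ Ico a b, ∃ u : ℝ → ℝ, ContinuousAt u s₀ ∧ Circle.exp (θ s₀) = Circle.exp (u s₀) ∧
      ∀ᶠ s in 𝓝[>] s₀, Circle.exp (θ s) = Circle.exp (u s) ∧ u s₀ ≤ u s) : θ a ≤ θ b := by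
  have hc : IsClosed ({s | θ a ≤ θ s} ∩ Icc a b) :=
    (isClosed_le continuous_const hθ).inter isClosed_Icc
  refine hc.Icc_subset_of_forall_mem_nhdsWithin (le_refl (θ a)) (fun s₀ hs₀ => ?_)
    (right_mem_Icc.2 hab)
  obtain ⟨u, hu, e0, hev⟩ := h s₀ hs₀.2
  have c1 : ∀ᶠ s in 𝓝[>] s₀, |θ s - θ s₀| < Real.pi :=
    (((hθ.sub continuous_const).abs.continuousAt (x := s₀)).eventually_lt continuousAt_const
      (by simp [Real.pi_pos])).filter_mono nhdsWithin_le_nhds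
  have c2 : ∀ᶠ s in 𝓝[>] s₀, |u s - u s₀| < Real.pi :=
    (((hu.sub continuousAt_const).abs).eventually_lt continuousAt_const
      (by simp [Real.pi_pos])).filter_mono nhdsWithin_le_nhds
  filter_upwards [hev, c1, c2] with s hs h1 h2
  have := exp_eq_of_abs_lt (by rw [Circle.exp_sub, Circle.exp_sub, hs.1, e0]) h1 h2
  have h0 : θ a ≤ θ s₀ := hs₀.1
  change θ a ≤ θ s
  linarith [hs.2]

namespace Staircase

section Affine

variable {r : ℝ} {hr : 0 < r} {φ : Surface ≃ₜ Surface} {A : Matrix (Fin 2) (Fin 2) ℝ}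

/-- An affine automorphism maps the horizontal circles locally to line segments. -/
lemma exists_segment (hφ : (stretched hr).HasDerivative φ A) (k : ℤ) {y : ℝ} (h0 : 0 < y)
    (h1 : y < 1) (s₀ : ℝ) : ∃ b, ∃ w : ℝ → ℝ × ℝ, ∃ c : ℂ, ContinuousAt w s₀ ∧ ∀ᶠ s in 𝓝 s₀,
      w s ∈ stair ∧ φ (cyl false k (s / Real.pi, y)) = pt b (w s) ∧
      xCoord r b (w s).1 = A 0 0 * cylCoord r false k (s / Real.pi) + c.re ∧
      yCoord r b (w s).2 = A 1 0 * cylCoord r false k (s / Real.pi) + c.im := by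
  set x₀ := cyl false k (s₀ / Real.pi, y) with hx₀
  obtain ⟨b₀, hb₀⟩ := exists_chart hr x₀
  obtain ⟨b, hb⟩ := exists_chart hr (φ x₀)
  obtain ⟨c, hc⟩ := hφ.2 _ ⟨b₀, rfl⟩ _ ⟨b, rfl⟩ x₀ hb₀ hb
  obtain ⟨d, hd⟩ := chart_cyl hr b₀ k h0 h1 hb₀
  have hpath : Tendsto (fun s : ℝ => (s / Real.pi, y)) (𝓝 s₀) (𝓝 (s₀ / Real.pi, y)) :=
    (by fun_prop : Continuous fun s : ℝ => (s / Real.pi, y)).tendsto s₀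
  have hcyl : Tendsto (fun s : ℝ => cyl false k (s / Real.pi, y)) (𝓝 s₀) (𝓝 x₀) :=
    (continuousAt_cyl false k h0 h1).tendsto.comp hpath
  have himg : Tendsto (fun s : ℝ => φ (cyl false k (s / Real.pi, y))) (𝓝 s₀) (𝓝 (φ x₀)) :=
    (φ.continuous.tendsto x₀).comp hcyl
  rw [chart_source] at hb
  have hcont : ContinuousAt (planar b).symm (φ x₀) :=
    (planar b).continuousAt_symm hb
  refine ⟨b, fun s => (planar b).symm (φ (cyl false k (s / Real.pi, y))),
    planeMap A (⟨0, weight r false (2 * k + 1) * y⟩ + d) + c, hcont.tendsto.comp himg, ?_⟩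
  filter_upwards [hpath.eventually hd, hcyl.eventually hc,
    himg.eventually ((isOpen_range_pt b).mem_nhds hb)] with s e1 e2 e3
  obtain ⟨z, hz, e⟩ := e3
  rw [← e, planar_symm_pt b hz]
  rw [← e, chart_pt hr b hz, e1] at e2
  refine ⟨hz, rfl, ?_, ?_⟩
  · have := congrArg Complex.re e2
    simp only [planeMap, Complex.add_re, Complex.add_im] at this ⊢
    rw [this]
    ring
  · have := congrArg Complex.im e2
    simp only [planeMap, Complex.add_re, Complex.add_im] at this ⊢
    rw [this]
    ring

lemma cylCoord_div_pi_lt (hr : 0 < r) (k : ℤ) {s t : ℝ} (h : s < t) :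
    cylCoord r false k (s / Real.pi) < cylCoord r false k (t / Real.pi) :=
  strictMono_cylCoord hr false k (div_lt_div_of_pos_right h Real.pi_pos)

lemma strictMono_xCoord (hr : 0 < r) (b : Bool) : StrictMono (xCoord r b) :=
  strictMono_pl fun _ => weight_pos hr b _

lemma strictMono_yCoord (hr : 0 < r) (b : Bool) : StrictMono (yCoord r b) :=
  strictMono_pl fun _ => weight_pos hr b _

lemma exp_sign_mul {ε s t : ℝ} (hε : ε = 1 ∨ ε = -1) (h : Circle.exp s = Circle.exp t) :
    Circle.exp (ε * s) = Circle.exp (ε * t) := by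
  rcases hε with rfl | rfl
  · rw [one_mul, one_mul, h]
  · rw [neg_one_mul, neg_one_mul, Circle.exp_neg, Circle.exp_neg, h]

lemma sign_mul_clamp_le {ε s t : ℝ} (hε : ε = 1 ∨ ε = -1) (j : ℝ) (h : ε * s ≤ ε * t) :
    ε * (2 * Real.pi * clamp (s - j)) ≤ ε * (2 * Real.pi * clamp (t - j)) := by
  have hpi := Real.two_pi_pos
  rcases hε with rfl | rfl
  · rw [one_mul, one_mul] at h ⊢
    exact mul_le_mul_of_nonneg_left (monotone_clamp (by linarith)) hpi.le
  · have : clamp (t - j) ≤ clamp (s - j) := monotone_clamp (by linarith)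
    nlinarith

lemma sign_mul_le_of_strictMono {f : ℝ → ℝ} (hf : StrictMono f) {ε s t : ℝ} (hε : ε = 1 ∨ ε = -1)
    (h : ε * f s ≤ ε * f t) : ε * s ≤ ε * t := by
  rcases hε with rfl | rfl
  · rw [one_mul, one_mul] at h ⊢
    exact hf.le_iff_le.1 h
  · have : t ≤ s := hf.le_iff_le.1 (by linarith)
    linarith

/-- The row functions vary monotonically along the image of a horizontal circle. -/
lemma rowFun_log_le (hφ : (stretched hr).HasDerivative φ A) (k j : ℤ) {y : ℝ} (h0 : 0 < y)
    (h1 : y < 1) {ε : ℝ} (hε : ε = 1 ∨ ε = -1) (hA : 0 ≤ ε * A 1 0) {θ : ℝ → ℝ} (hθ : Continuous θ)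
    {a b : ℝ} (hab : a ≤ b)
    (h : ∀ s ∈ Icc a b, rowFun j (φ (cyl false k (s / Real.pi, y))) = Circle.exp (θ s)) :
    ε * θ a ≤ ε * θ b := by
  refine le_of_local_log (θ := fun s => ε * θ s) (by fun_prop) hab fun s₀ hs₀ => ?_
  obtain ⟨c, w, d, hw, hev⟩ := exists_segment hφ k h0 h1 s₀
  have hrow : ∀ s, w s ∈ stair → φ (cyl false k (s / Real.pi, y)) = pt c (w s) → s ∈ Icc a b →
      Circle.exp (ε * θ s) = Circle.exp (ε * (2 * Real.pi * clamp ((w s).2 - rowIdx c j))) :=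
    fun s hs e hsab => by
      refine exp_sign_mul hε ?_
      rw [← h s hsab, e, rowFun_pt _ _ hs]
      rfl
  have ev0 := hev.self_of_nhds
  refine ⟨fun s => ε * (2 * Real.pi * clamp ((w s).2 - rowIdx c j)), ?_,
    hrow s₀ ev0.1 ev0.2.1 (Ico_subset_Icc_self hs₀), ?_⟩
  · exact continuousAt_const.mul (continuousAt_const.mul (continuous_clamp.continuousAt.comp
      ((continuous_snd.continuousAt.comp hw).sub continuousAt_const)))
  · filter_upwards [hev.filter_mono nhdsWithin_le_nhds, Ioo_mem_nhdsGT hs₀.2] with s hs hsI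
    refine ⟨hrow s hs.1 hs.2.1 ⟨hs₀.1.trans hsI.1.le, hsI.2.le⟩, ?_⟩
    refine sign_mul_clamp_le hε _ (sign_mul_le_of_strictMono (strictMono_yCoord hr c) hε ?_)
    rw [hs.2.2.2, ev0.2.2.2]
    have := mul_le_mul_of_nonneg_left (cylCoord_div_pi_lt hr k hsI.1).le hA
    linarith

/-- The column functions vary monotonically along the image of a horizontal circle. -/
lemma colFun_log_le (hφ : (stretched hr).HasDerivative φ A) (k j : ℤ) {y : ℝ} (h0 : 0 < y)
    (h1 : y < 1) {ε : ℝ} (hε : ε = 1 ∨ ε = -1) (hA : 0 ≤ ε * A 0 0) {θ : ℝ → ℝ} (hθ : Continuous θ)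
    {a b : ℝ} (hab : a ≤ b)
    (h : ∀ s ∈ Icc a b, colFun j (φ (cyl false k (s / Real.pi, y))) = Circle.exp (θ s)) :
    ε * θ a ≤ ε * θ b := by
  refine le_of_local_log (θ := fun s => ε * θ s) (by fun_prop) hab fun s₀ hs₀ => ?_
  obtain ⟨c, w, d, hw, hev⟩ := exists_segment hφ k h0 h1 s₀
  have hcol : ∀ s, w s ∈ stair → φ (cyl false k (s / Real.pi, y)) = pt c (w s) → s ∈ Icc a b →
      Circle.exp (ε * θ s) = Circle.exp (ε * (2 * Real.pi * clamp ((w s).1 - colIdx c j))) :=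
    fun s hs e hsab => by
      refine exp_sign_mul hε ?_
      rw [← h s hsab, e, colFun_pt _ _ hs]
      rfl
  have ev0 := hev.self_of_nhds
  refine ⟨fun s => ε * (2 * Real.pi * clamp ((w s).1 - colIdx c j)), ?_,
    hcol s₀ ev0.1 ev0.2.1 (Ico_subset_Icc_self hs₀), ?_⟩
  · exact continuousAt_const.mul (continuousAt_const.mul (continuous_clamp.continuousAt.comp
      ((continuous_fst.continuousAt.comp hw).sub continuousAt_const)))
  · filter_upwards [hev.filter_mono nhdsWithin_le_nhds, Ioo_mem_nhdsGT hs₀.2] with s hs hsI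
    refine ⟨hcol s hs.1 hs.2.1 ⟨hs₀.1.trans hsI.1.le, hsI.2.le⟩, ?_⟩
    refine sign_mul_clamp_le hε _ (sign_mul_le_of_strictMono (strictMono_xCoord hr c) hε ?_)
    rw [hs.2.2.1, ev0.2.2.1]
    have := mul_le_mul_of_nonneg_left (cylCoord_div_pi_lt hr k hsI.1).le hA
    linarith

lemma homotopic_comp (hid : ((φ : C(Surface, Surface))).Homotopic (ContinuousMap.id Surface))
    (g : C(Surface, Circle)) (c : C(Circle, Surface)) :
    (g.comp c).Homotopic (g.comp ((φ : C(Surface, Surface)).comp c)) := by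
  have := ((ContinuousMap.Homotopic.refl g).comp (hid.comp (.refl c))).symm
  rwa [ContinuousMap.id_comp] at this

/-- The row functions are constant along the images of the horizontal circles: their logarithms
are both periodic and monotone. -/
lemma rowFun_image_leaf (hφ : (stretched hr).HasDerivative φ A)
    (hid : ((φ : C(Surface, Surface))).Homotopic (ContinuousMap.id Surface)) (j k : ℤ) {y : ℝ}
    (h0 : 0 < y) (h1 : y < 1) (x : ℝ) :
    rowFun j (φ (cyl false k (x, y))) = rowFun j (φ (cyl false k (0, y))) := by
  obtain ⟨θ, hθ⟩ := exists_log_of_homotopic (homotopic_comp hid (rowMap j) (leaf k ⟨y, h0, h1⟩))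
  obtain ⟨t, ht⟩ : ∃ t, ∀ s,
      ((rowMap j).comp (leaf k ⟨y, h0, h1⟩)) (Circle.exp s) = Circle.exp t := by
    refine ⟨Complex.arg (if j = k then wrap y else 1 : Circle), fun s => ?_⟩
    rw [Circle.exp_arg]
    change rowFun j (leaf k _ (Circle.exp s)) = _
    rw [leaf_exp]
    exact rowFun_cyl j k h0 h1
  have hlog : ∀ s, rowFun j (φ (cyl false k (s / Real.pi, y))) =
      Circle.exp (t + θ (Circle.exp s)) := fun s => by
    have := hθ (Circle.exp s)
    rw [ht, ← Circle.exp_add] at this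
    rw [← this]
    change _ = rowFun j (φ (leaf k ⟨y, h0, h1⟩ (Circle.exp s)))
    rw [leaf_exp]
  obtain ⟨ε, hε, hA⟩ : ∃ ε : ℝ, (ε = 1 ∨ ε = -1) ∧ 0 ≤ ε * A 1 0 := by
    rcases le_total 0 (A 1 0) with h | h
    · exact ⟨1, .inl rfl, by linarith⟩
    · exact ⟨-1, .inr rfl, by linarith⟩
  have mono : ∀ a b, a ≤ b → ε * (t + θ (Circle.exp a)) ≤ ε * (t + θ (Circle.exp b)) :=
    fun a b hab => rowFun_log_le hφ k j h0 h1 hε hA (θ := fun s => t + θ (Circle.exp s))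
      (by fun_prop) hab fun s _ => hlog s
  have le : ∀ a b, ε * (t + θ (Circle.exp a)) ≤ ε * (t + θ (Circle.exp b)) := fun a b => by
    obtain ⟨n, hn⟩ := exists_nat_ge ((a - b) / (2 * Real.pi))
    rw [div_le_iff₀ Real.two_pi_pos] at hn
    have e : Circle.exp (b + n * (2 * Real.pi)) = Circle.exp b :=
      Circle.exp_eq_exp.2 ⟨n, by push_cast; ring⟩
    rw [← e]
    exact mono _ _ (by linarith)
  have const : ∀ a b, t + θ (Circle.exp a) = t + θ (Circle.exp b) := fun a b => by
    have := le_antisymm (le a b) (le b a)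
    rcases hε with rfl | rfl
    · linarith
    · linarith
  have e1 := hlog (x * Real.pi)
  have e2 := hlog 0
  rw [mul_div_cancel_right₀ _ Real.pi_ne_zero] at e1
  rw [zero_div] at e2
  rw [e1, e2, const]

/-- An affine automorphism that is homotopic to the identity preserves the horizontal direction. -/
lemma derivative_lower_left (hφ : (stretched hr).HasDerivative φ A)
    (hid : ((φ : C(Surface, Surface))).Homotopic (ContinuousMap.id Surface)) : A 1 0 = 0 := by
  by_contra hA
  have h0 : (0 : ℝ) < 1 / 2 := by norm_num
  have h1 : (1 / 2 : ℝ) < 1 := by norm_num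
  obtain ⟨b, w, c, hw, hev⟩ := exists_segment hφ 0 h0 h1 0
  have ev0 := hev.self_of_nhds
  -- the side of the base point on which the image of the circle goes up
  obtain ⟨l, hl, hne, hup⟩ : ∃ l ≤ 𝓝 (0 : ℝ), l.NeBot ∧ ∀ᶠ s in l, (w 0).2 < (w s).2 := by
    rcases lt_or_gt_of_ne hA with h | h
    · refine ⟨𝓝[<] 0, nhdsWithin_le_nhds, inferInstance, ?_⟩
      filter_upwards [hev.filter_mono nhdsWithin_le_nhds, self_mem_nhdsWithin] with s hs hs0
      rw [← (strictMono_yCoord hr b).lt_iff_lt, hs.2.2.2, ev0.2.2.2]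
      have := cylCoord_div_pi_lt hr 0 (show s < 0 from hs0)
      nlinarith
    · refine ⟨𝓝[>] 0, nhdsWithin_le_nhds, inferInstance, ?_⟩
      filter_upwards [hev.filter_mono nhdsWithin_le_nhds, self_mem_nhdsWithin] with s hs hs0
      rw [← (strictMono_yCoord hr b).lt_iff_lt, hs.2.2.2, ev0.2.2.2]
      have := cylCoord_div_pi_lt hr 0 (show 0 < s from hs0)
      nlinarith
  have hlim : Tendsto (fun s => (w s).2) l (𝓝 (w 0).2) :=
    (continuous_snd.continuousAt.comp hw).tendsto.mono_left hl
  set k := ⌊(w 0).2⌋ with hk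
  have hband : ∀ᶠ s in l, k < (w s).2 ∧ (w s).2 < k + 1 ∧
      wrap ((w s).2 - k) = rowFun (rowIdx b k) (φ (cyl false 0 (0, 1 / 2))) := by
    filter_upwards [hup, hlim.eventually_lt_const (Int.lt_floor_add_one (w 0).2), hl hev] with
      s hs1 hs2 hs3
    refine ⟨(Int.floor_le _).trans_lt hs1, hs2, ?_⟩
    rw [← rowFun_image_leaf hφ hid _ 0 h0 h1 (s / Real.pi), hs3.2.1, rowFun_pt _ _ hs3.1]
    cases b <;> simp [rowIdx]
  obtain ⟨s₁, hs₁, hs₁'⟩ := (hband.and hup).exists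
  have hconst : ∀ᶠ s in l, (w s).2 = (w s₁).2 := by
    filter_upwards [hband] with s hs
    have := clamp_injOn_wrap (s := (w s).2 - k) (t := (w s₁).2 - k) (by linarith) (by linarith)
      (by linarith) (by linarith) (hs.2.2.trans hs₁.2.2.symm)
    linarith
  have := tendsto_nhds_unique hlim (tendsto_const_nhds.congr' (hconst.mono fun s hs => hs.symm))
  linarith

/-- An affine automorphism that is homotopic to the identity does not flip the horizontal
direction. -/
lemma derivative_upper_left (hφ : (stretched hr).HasDerivative φ A)
    (hid : ((φ : C(Surface, Surface))).Homotopic (ContinuousMap.id Surface)) : 0 < A 0 0 := by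
  by_contra! hA
  have hpi := Real.two_pi_pos
  have h0 : (0 : ℝ) < 1 / 2 := by norm_num
  have h1 : (1 / 2 : ℝ) < 1 := by norm_num
  have hh := homotopic_comp hid (colMap 0) (leaf 0 ⟨1 / 2, h0, h1⟩)
  obtain ⟨θ, hθ⟩ := exists_log_of_homotopic hh
  set Θ : ℝ → ℝ := fun s => 2 * Real.pi * clamp ((0 : ℤ) - (0 : ℤ) + s / Real.pi) +
    θ (Circle.exp s) with hΘ
  have hc : Continuous Θ := (continuous_colMap_leaf_log 0 0).add (by fun_prop)
  have e1 : ∀ s ∈ Icc 0 (2 * Real.pi),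
      ((colMap 0).comp ((φ : C(Surface, Surface)).comp (leaf 0 ⟨1 / 2, h0, h1⟩))) (Circle.exp s) =
        Circle.exp (Θ s) := fun s hs => by
    rw [hθ, colMap_leaf 0 0 _ hs, ← Circle.exp_add]
  have inc := increment_eq_of_homotopic hh (continuous_colMap_leaf_log 0 0) hc
    (fun s hs => colMap_leaf 0 0 _ hs) e1
  rw [increment_colMap_leaf (.inl rfl)] at inc
  have := colFun_log_le hφ 0 0 h0 h1 (ε := -1) (.inr rfl) (by linarith) hc hpi.le fun s hs => by
    rw [← e1 s hs]
    change _ = colFun 0 (φ (leaf 0 _ (Circle.exp s)))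
    rw [leaf_exp]
  linarith

end Affine

end Staircase

lemma homotopic_id_of_mem {S : Type*} [TopologicalSpace S] {φ : S ≃ₜ S}
    (h : φ ∈ isotopicToId S) : (φ : C(S, S)).Homotopic (ContinuousMap.id S) := by
  obtain ⟨Φ, -, h2, h3⟩ := h
  exact .symm ⟨⟨⟨fun q => (Φ q).2, by fun_prop⟩, h2, h3⟩⟩

/-- An increasing affine map of a unit interval into itself does not expand, and is the identity if
it does not contract either. -/
lemma affine_unit_interval {k a e : ℝ} (ha : 0 < a)
    (h : ∀ t, k < t → t < k + 1 → k < a * t + e ∧ a * t + e < k + 1) : a ≤ 1 ∧ (a = 1 → e = 0) := by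
  constructor
  · by_contra! h1
    have hinv : a * a⁻¹ = 1 := mul_inv_cancel₀ ha.ne'
    have hpos : 0 < a⁻¹ := inv_pos.2 ha
    have hlt : a⁻¹ < 1 := inv_lt_one_of_one_lt₀ h1
    have l := h (k + (1 - a⁻¹) / 2) (by linarith) (by linarith)
    have u := h (k + 1 - (1 - a⁻¹) / 2) (by linarith) (by linarith)
    nlinarith
  · rintro rfl
    rcases lt_trichotomy e 0 with he | he | he
    · have := (h (k + min (-e) (1 / 2)) (by simp [he]) (by linarith [min_le_right (-e) (1 / 2)])).1
      linarith [min_le_left (-e) (1 / 2)]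
    · exact he
    · have := (h (k + 1 - min e (1 / 2)) (by linarith [min_le_right e (1 / 2)]) (by simp [he])).2
      linarith [min_le_left e (1 / 2)]

namespace Staircase

lemma exists_cyl_of_rowFun_ne_one {k : ℤ} {p : Surface} (h : rowFun k p ≠ 1) :
    ∃ x y : ℝ, 0 < y ∧ y < 1 ∧ p = cyl false k (x, y) := by
  rcases cyl_or_edge p with ⟨j, x, y, h0, h1, rfl⟩ | he
  · rw [rowFun_cyl _ _ h0 h1] at h
    by_cases hjk : k = j
    · exact ⟨x, y, h0, h1, by rw [hjk]⟩
    · rw [if_neg hjk] at h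
      exact absurd rfl h
  · exact absurd (rowFun_edge k he) h

lemma mem_Ioo_of_wrap_ne_one {t : ℝ} (h : wrap t ≠ 1) : 0 < t ∧ t < 1 := by
  constructor
  · by_contra h'; exact h (wrap_of_le_zero (not_lt.1 h'))
  · by_contra h'; exact h (wrap_of_one_le (not_lt.1 h'))

/-- An open horizontal edge lies in exactly one open column. -/
lemma exists_column_of_edge {p : Surface} (hp : IsEdge p) :
    ∃ m, colFun m p ≠ 1 ∧ ∀ m', colFun m' p ≠ 1 → m' = m := by
  obtain ⟨b, j, x, h0, h1, rfl⟩ := hp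
  have hs := edge_mem_stair h0 h1
  refine ⟨colIdx b j, ?_, fun m' hm' => ?_⟩
  · rw [colFun_pt _ _ hs]
    refine wrap_ne_one ?_ ?_ <;> cases b <;> simp [colIdx] <;> linarith
  · rw [colFun_pt _ _ hs] at hm'
    have := mem_Ioo_of_wrap_ne_one hm'
    dsimp only at this
    have e : colIdx b m' = j :=
      int_eq_of_mem_Ioo (y := x) (by linarith) (by linarith) (by linarith) (by linarith)
    rw [← e]
    cases b <;> simp [colIdx]

/-! ### Preservation of the squares -/

section Kernel

variable {r : ℝ} {hr : 0 < r} {φ : Surface ≃ₜ Surface} {A : Matrix (Fin 2) (Fin 2) ℝ}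

/-- An affine automorphism that is homotopic to the identity preserves every horizontal cylinder:
the images of the horizontal circles lie in a cylinder or in the horizontal edges, and cross the
same columns as the circles themselves. -/
lemma rowFun_image_ne_one (hφ : (stretched hr).HasDerivative φ A)
    (hid : ((φ : C(Surface, Surface))).Homotopic (ContinuousMap.id Surface)) {k : ℤ} {p : Surface}
    (hp : rowFun k p ≠ 1) : rowFun k (φ p) ≠ 1 := by
  obtain ⟨x, y, h0, h1, rfl⟩ := exists_cyl_of_rowFun_ne_one hp
  rw [rowFun_image_leaf hφ hid k k h0 h1]
  set q := φ (cyl false k (0, y)) with hq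
  have row : ∀ j z, rowFun j (φ (leaf k ⟨y, h0, h1⟩ z)) = rowFun j q := fun j z => by
    rw [← Circle.exp_arg z, leaf_exp]
    exact rowFun_image_leaf hφ hid j k h0 h1 _
  have cross : ∀ m, m = k ∨ m = k + 1 → ∃ z, colFun m (φ (leaf k ⟨y, h0, h1⟩ z)) ≠ 1 :=
    fun m hm => not_homotopic_const hm _ (homotopic_comp hid (colMap m) (leaf k ⟨y, h0, h1⟩)) 1
  rcases cyl_or_edge q with ⟨j, x', y', h0', h1', e⟩ | hedge
  · by_cases hjk : j = k
    · rw [e, hjk, rowFun_cyl _ _ h0' h1', if_pos rfl]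
      exact wrap_ne_one h0' h1'
    exfalso
    obtain ⟨m, hm, hmj, hmj'⟩ : ∃ m : ℤ, (m = k ∨ m = k + 1) ∧ m ≠ j ∧ m ≠ j + 1 := by
      by_cases h : k = j + 1
      · exact ⟨k + 1, .inr rfl, by omega, by omega⟩
      · exact ⟨k, .inl rfl, Ne.symm hjk, h⟩
    obtain ⟨z, hz⟩ := cross m hm
    have hj : rowFun j (φ (leaf k ⟨y, h0, h1⟩ z)) ≠ 1 := by
      rw [row, e, rowFun_cyl _ _ h0' h1', if_pos rfl]
      exact wrap_ne_one h0' h1'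
    obtain ⟨x'', y'', h0'', h1'', e'⟩ := exists_cyl_of_rowFun_ne_one hj
    rw [e'] at hz
    exact hz (colFun_cyl_eq_one hmj hmj' _ h0'' h1'')
  · exfalso
    have edges : ∀ z, IsEdge (φ (leaf k ⟨y, h0, h1⟩ z)) := fun z => by
      rcases cyl_or_edge (φ (leaf k ⟨y, h0, h1⟩ z)) with ⟨j, x', y', h0', h1', e⟩ | h
      · have := row j z
        rw [e, rowFun_cyl _ _ h0' h1', if_pos rfl, rowFun_edge j hedge] at this
        exact absurd this (wrap_ne_one h0' h1')
      · exact h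
    set U : ℤ → Set Circle := fun m => {z | colFun m (φ (leaf k ⟨y, h0, h1⟩ z)) ≠ 1} with hU
    have hopen : ∀ m, IsOpen (U m) := fun m =>
      isOpen_compl_singleton.preimage ((continuous_colFun m).comp
        (φ.continuous.comp (leaf k ⟨y, h0, h1⟩).continuous))
    have hcompl : (U k)ᶜ = ⋃ m ∈ {m | m ≠ k}, U m := by
      ext z
      obtain ⟨m, hm, hm'⟩ := exists_column_of_edge (edges z)
      rw [mem_iUnion₂]
      constructor
      · intro hz
        refine ⟨m, ?_, hm⟩
        rintro rfl
        exact hz hm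
      · rintro ⟨m', hne, hm''⟩ hz
        exact hne ((hm' m' hm'').trans (hm' k hz).symm)
    have hclopen : IsClopen (U k) := by
      refine ⟨?_, hopen k⟩
      rw [← isOpen_compl_iff, hcompl]
      exact isOpen_biUnion fun m _ => hopen m
    obtain ⟨z, hz⟩ := cross k (.inl rfl)
    obtain ⟨z', hz'⟩ := cross (k + 1) (.inr rfl)
    have hz'' : z' ∈ U k := by
      rw [hclopen.eq_univ ⟨z, hz⟩]
      exact mem_univ _
    obtain ⟨m, -, hm'⟩ := exists_column_of_edge (edges z')
    have := (hm' _ hz').trans (hm' _ hz'').symm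
    omega

lemma hasDerivative_conj_reflection (hφ : (stretched hr).HasDerivative φ A) :
    (stretched hr).HasDerivative (reflection⁻¹ * φ * reflection)
      !![A 1 1, A 1 0; A 0 1, A 0 0] := by
  have h0 := hr.ne'
  have hI := hasDerivative_reflection hr
  have hI' := hI.inv (B := !![0, r⁻¹; r⁻¹, 0]) (by
    ext i j; fin_cases i <;> fin_cases j <;> simp [Matrix.mul_apply, Fin.sum_univ_two, h0])
  convert (hI'.mul hφ).mul hI using 1
  conv_rhs => rw [Matrix.eta_fin_two A]
  ext i j
  fin_cases i <;> fin_cases j <;> simp [Matrix.mul_apply, Fin.sum_univ_two] <;> field_simp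

lemma conj_reflection_mem (h : φ ∈ isotopicToId Surface) :
    reflection⁻¹ * φ * reflection ∈ isotopicToId Surface := by
  simpa using Subgroup.Normal.conj_mem inferInstance φ h reflection⁻¹

/-- An affine automorphism that is isotopic to the identity preserves every vertical cylinder. -/
lemma colFun_image_ne_one (hφ : (stretched hr).HasDerivative φ A) (hm : φ ∈ isotopicToId Surface)
    {k : ℤ} {p : Surface} (hp : colFun k p ≠ 1) : colFun k (φ p) ≠ 1 := by
  have key := rowFun_image_ne_one (hasDerivative_conj_reflection hφ)
    (homotopic_id_of_mem (conj_reflection_mem hm)) (k := k - 1) (p := reflection.symm p)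
  have e : φ p = reflection ((reflection⁻¹ * φ * reflection : Surface ≃ₜ Surface)
      (reflection.symm p)) := by
    change φ p = reflection (reflection.symm (φ (reflection (reflection.symm p))))
    rw [reflection.apply_symm_apply, reflection.apply_symm_apply]
  rw [← colFun_reflection, ← colFun_reflection, reflection.apply_symm_apply, sub_add_cancel,
    ← e] at key
  exact key hp

lemma exists_square {b : Bool} {k : ℤ} {q : Surface} (h : rowFun (rowIdx b k) q ≠ 1)
    (h' : colFun (colIdx b k) q ≠ 1) : ∃ w ∈ row k ∩ col k, q = pt b w := by
  obtain ⟨b', w, hw, rfl⟩ := exists_pt q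
  rw [rowFun_pt _ _ hw] at h
  rw [colFun_pt _ _ hw] at h'
  have h := mem_Ioo_of_wrap_ne_one h
  have h' := mem_Ioo_of_wrap_ne_one h'
  by_cases hb : b' = b
  · subst hb
    have e1 : rowIdx b' (rowIdx b' k) = k := by cases b' <;> simp [rowIdx]
    have e2 : colIdx b' (colIdx b' k) = k := by cases b' <;> simp [colIdx]
    rw [e1] at h
    rw [e2] at h'
    exact ⟨w, diag_mem (by linarith) (by linarith) (by linarith) (by linarith), rfl⟩
  · obtain rfl : b' = !b := by cases b <;> cases b' <;> simp_all
    have e1 : rowIdx (!b) (rowIdx b k) = -k := by cases b <;> simp [rowIdx]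
    have e2 : colIdx (!b) (colIdx b k) = 1 - k := by cases b <;> simp [colIdx]
    rw [e1] at h
    rw [e2] at h'
    push_cast at h h'
    have hsq : w ∈ row (-k) ∩ col (-k + 1) := by
      constructor
      · rw [mem_row]; push_cast; constructor <;> constructor <;> linarith
      · rw [mem_col]; push_cast; constructor <;> constructor <;> linarith
    rw [pt_right hsq, Bool.not_not]
    refine ⟨_, ?_, rfl⟩
    apply diag_mem <;> push_cast <;> linarith

lemma square_ne_one {b : Bool} {k : ℤ} {z : ℝ × ℝ} (hz : z ∈ row k ∩ col k) :
    rowFun (rowIdx b k) (pt b z) ≠ 1 ∧ colFun (colIdx b k) (pt b z) ≠ 1 := by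
  have hs := row_subset_stair k hz.1
  have r1 := mem_row.1 hz.1
  have r2 := mem_col.1 hz.2
  rw [rowFun_pt _ _ hs, colFun_pt _ _ hs]
  have e1 : rowIdx b (rowIdx b k) = k := by cases b <;> simp [rowIdx]
  have e2 : colIdx b (colIdx b k) = k := by cases b <;> simp [colIdx]
  rw [e1, e2]
  exact ⟨wrap_ne_one (by linarith) (by linarith), wrap_ne_one (by linarith) (by linarith)⟩

lemma isPreconnected_square (k : ℤ) : IsPreconnected (row k ∩ col k) := by
  have : row k ∩ col k = Ioo (k : ℝ) (k + 1) ×ˢ Ioo (k : ℝ) (k + 1) := by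
    ext z
    constructor
    · rintro ⟨h, h'⟩
      rw [mem_row] at h
      rw [mem_col] at h'
      exact ⟨h'.1, h.2⟩
    · rintro ⟨h, h'⟩
      exact diag_mem h.1 h.2 h'.1 h'.2
  rw [this]
  exact isPreconnected_rect _ _ _ _

lemma xCoord_eq (r : ℝ) (b : Bool) {k : ℤ} {x : ℝ} (h0 : k ≤ x) (h1 : x ≤ k + 1) :
    xCoord r b x = xCoord r b k + weight r b (2 * k) * (x - k) := by
  rw [xCoord, pl_eq _ h0 h1, pl_int]

lemma yCoord_eq (r : ℝ) (b : Bool) {k : ℤ} {x : ℝ} (h0 : k ≤ x) (h1 : x ≤ k + 1) :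
    yCoord r b x = yCoord r b k + weight r b (2 * k + 1) * (x - k) := by
  rw [yCoord, pl_eq _ h0 h1, pl_int]

/-- An affine automorphism with diagonal derivative that preserves a square is an affine map in the
coordinates of the square. -/
lemma exists_affine_on_square (hφ : (stretched hr).HasDerivative φ A) (h10 : A 1 0 = 0)
    (h01 : A 0 1 = 0) {b : Bool} {k : ℤ}
    (h : ∀ z ∈ row k ∩ col k, ∃ w ∈ row k ∩ col k, φ (pt b z) = pt b w) :
    ∃ c d : ℝ, ∀ z ∈ row k ∩ col k, (A 0 0 * z.1 + c, A 1 1 * z.2 + d) ∈ row k ∩ col k ∧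
      φ (pt b z) = pt b (A 0 0 * z.1 + c, A 1 1 * z.2 + d) := by
  choose! w hw hw' using h
  set Q : Set (ℝ × ℝ) := row k ∩ col k with hQ
  have hQs : ∀ z ∈ Q, z ∈ stair := fun z hz => row_subset_stair k hz.1
  have hQo : IsOpen Q := (isOpen_row k).inter (isOpen_col k)
  let G : Q → ℝ × ℝ := fun z => ((w z).1 - A 0 0 * (z : ℝ × ℝ).1, (w z).2 - A 1 1 * (z : ℝ × ℝ).2)
  have hG : IsLocallyConstant G := by
    rw [IsLocallyConstant.iff_eventually_eq]
    rintro ⟨z₀, hz₀⟩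
    obtain ⟨c, hc⟩ := hφ.2 _ ⟨b, rfl⟩ _ ⟨b, rfl⟩ (pt b z₀) (pt_mem_chart_source hr b (hQs _ hz₀))
      (by rw [hw' _ hz₀]; exact pt_mem_chart_source hr b (hQs _ (hw _ hz₀)))
    rw [nhds_pt b (hQs _ hz₀), eventually_map] at hc
    have coords : ∀ z ∈ Q, (∀ᶠ z' in 𝓝 z, z' ∈ Q) := fun z hz => hQo.mem_nhds hz
    have loc : ∀ z ∈ Q, chart hr b (φ (pt b z)) = planeMap A (chart hr b (pt b z)) + c →
        weight r b (2 * k) * ((w z).1 - A 0 0 * z.1) = A 0 0 * (xCoord r b k -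
          weight r b (2 * k) * k) - xCoord r b k + weight r b (2 * k) * k + c.re ∧
        weight r b (2 * k + 1) * ((w z).2 - A 1 1 * z.2) = A 1 1 * (yCoord r b k -
          weight r b (2 * k + 1) * k) - yCoord r b k + weight r b (2 * k + 1) * k + c.im := by
      intro z hz e
      rw [hw' z hz, chart_pt hr b (hQs _ (hw z hz)), chart_pt hr b (hQs z hz)] at e
      have r1 := mem_row.1 hz.1
      have r2 := mem_col.1 hz.2
      have s1 := mem_row.1 (hw z hz).1
      have s2 := mem_col.1 (hw z hz).2
      have e1 := congrArg Complex.re e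
      have e2 := congrArg Complex.im e
      simp only [planeMap, Complex.add_re, Complex.add_im, h10, h01, zero_mul, add_zero,
        zero_add] at e1 e2
      rw [xCoord_eq r b s2.1.1.le s2.1.2.le, xCoord_eq r b r2.1.1.le r2.1.2.le] at e1
      rw [yCoord_eq r b s1.2.1.le s1.2.2.le, yCoord_eq r b r1.2.1.le r1.2.2.le] at e2
      constructor
      · linarith
      · linarith
    have l0 := loc z₀ hz₀ hc.self_of_nhds
    have hc' : ∀ᶠ z : Q in 𝓝 ⟨z₀, hz₀⟩, chart hr b (φ (pt b z)) =
        planeMap A (chart hr b (pt b z)) + c :=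
      (continuous_subtype_val.tendsto (⟨z₀, hz₀⟩ : Q)).eventually hc
    filter_upwards [hc'] with z hz
    have l1 := loc z z.2 hz
    refine Prod.ext ?_ ?_
    · exact mul_left_cancel₀ (weight_pos hr b _).ne' (l1.1.trans l0.1.symm)
    · exact mul_left_cancel₀ (weight_pos hr b _).ne' (l1.2.trans l0.2.symm)
  have hpre : PreconnectedSpace Q := Subtype.preconnectedSpace (isPreconnected_square k)
  have hmid : ((k + 1 / 2, k + 1 / 2) : ℝ × ℝ) ∈ Q :=
    diag_mem (by linarith) (by linarith) (by linarith) (by linarith)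
  refine ⟨(G ⟨_, hmid⟩).1, (G ⟨_, hmid⟩).2, fun z hz => ?_⟩
  have e : w z = (A 0 0 * z.1 + (G ⟨_, hmid⟩).1, A 1 1 * z.2 + (G ⟨_, hmid⟩).2) := by
    rw [← hG.apply_eq_of_preconnectedSpace ⟨z, hz⟩]
    ext <;> simp [G]
  rw [← e]
  exact ⟨hw z hz, hw' z hz⟩

/-- The affine form on the squares of an affine automorphism that is isotopic to the identity. -/
lemma affine_of_mem_isotopicToId (hφ : (stretched hr).HasDerivative φ A)
    (hm : φ ∈ isotopicToId Surface) : A 1 0 = 0 ∧ A 0 1 = 0 ∧ A 0 0 ≤ 1 ∧ A 1 1 ≤ 1 ∧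
      (A 0 0 = 1 → A 1 1 = 1 → ∀ b k, ∀ z ∈ row k ∩ col k, φ (pt b z) = pt b z) := by
  have hid := homotopic_id_of_mem hm
  have hφ' := hasDerivative_conj_reflection hφ
  have hid' := homotopic_id_of_mem (conj_reflection_mem hm)
  have h10 := derivative_lower_left hφ hid
  have h00 := derivative_upper_left hφ hid
  have h01 : A 0 1 = 0 := by simpa using derivative_lower_left hφ' hid'
  have h11 : 0 < A 1 1 := by simpa using derivative_upper_left hφ' hid'
  have sq : ∀ (b : Bool) (k : ℤ), ∃ c d : ℝ, (∀ z ∈ row k ∩ col k, φ (pt b z) =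
      pt b (A 0 0 * z.1 + c, A 1 1 * z.2 + d)) ∧ (A 0 0 ≤ 1 ∧ (A 0 0 = 1 → c = 0)) ∧
      A 1 1 ≤ 1 ∧ (A 1 1 = 1 → d = 0) := fun b k => by
    obtain ⟨c, d, hcd⟩ := exists_affine_on_square hφ h10 h01 (b := b) (k := k) fun z hz =>
      exists_square (rowFun_image_ne_one hφ hid (square_ne_one hz).1)
        (colFun_image_ne_one hφ hm (square_ne_one hz).2)
    refine ⟨c, d, fun z hz => (hcd z hz).2, ?_, ?_⟩
    · refine affine_unit_interval (k := k) h00 fun t ht ht' => ?_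
      exact (mem_col.1 (hcd (t, t) (diag_mem ht ht' ht ht')).1.2).1
    · refine affine_unit_interval (k := k) h11 fun t ht ht' => ?_
      exact (mem_row.1 (hcd (t, t) (diag_mem ht ht' ht ht')).1.1).2
  obtain ⟨_, _, _, h, h'⟩ := sq false 0
  refine ⟨h10, h01, h.1, h'.1, fun e1 e2 b k z hz => ?_⟩
  obtain ⟨c, d, hcd, hc, hd⟩ := sq b k
  rw [hcd z hz, hc.2 e1, hd.2 e2, e1, e2, one_mul, one_mul, add_zero, add_zero]

/-- The open squares are dense. -/
lemma dense_squares : Dense {p | ∃ b k, ∃ z ∈ row k ∩ col k, p = pt b z} := by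
  intro p
  obtain ⟨b, z, hz, rfl⟩ := exists_pt p
  have hlim : Tendsto (fun t : ℝ => (z.1 + t, z.2 + t)) (𝓝[>] 0) (𝓝 z) := by
    have : Tendsto (fun t : ℝ => (z.1 + t, z.2 + t)) (𝓝 0) (𝓝 (z.1 + 0, z.2 + 0)) :=
      (by fun_prop : Continuous fun t : ℝ => (z.1 + t, z.2 + t)).tendsto 0
    rw [add_zero, add_zero] at this
    exact this.mono_left nhdsWithin_le_nhds
  have hpt : Tendsto (fun t : ℝ => pt b (z.1 + t, z.2 + t)) (𝓝[>] 0) (𝓝 (pt b z)) := by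
    rw [nhds_pt b hz]
    exact tendsto_map.comp hlim
  refine mem_closure_of_tendsto hpt ?_
  have f1 : ∀ s : ℝ, ∀ᶠ t in 𝓝[>] (0 : ℝ), ∀ k : ℤ, s + t ≠ k := fun s => by
    have hpos : 0 < ⌊s⌋ + 1 - s := by linarith [Int.lt_floor_add_one s]
    filter_upwards [Ioo_mem_nhdsGT hpos] with t ht k hk
    refine not_mem_Ioo_int (k := ⌊s⌋) (l := k) ?_ ?_
    · rw [← hk]; linarith [Int.floor_le s, ht.1]
    · rw [← hk]; linarith [ht.2]
  filter_upwards [hlim.eventually (eventually_stair hz), f1 z.1, f1 z.2] with t ht h1 h2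
  rcases stair_cases ht with ⟨k, hk⟩ | ⟨k, hk⟩ | ⟨k, hk, -⟩ | ⟨k, hk, -⟩
  · exact ⟨b, k, _, hk, rfl⟩
  · refine ⟨!b, -k, _, ?_, pt_right hk⟩
    have r1 := mem_row.1 hk.1
    have r2 := mem_col.1 hk.2
    push_cast at r2
    apply diag_mem <;> push_cast <;> linarith
  · exact absurd (by push_cast; exact hk) (h1 (k + 1))
  · exact absurd hk (h2 k)

end Kernel

/-- Distinct affine automorphisms are not isotopic. -/
lemma toMappingClass_injective {r : ℝ} (hr : 0 < r) :
    Function.Injective (stretched hr).toMappingClass := by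
  rw [injective_iff_map_eq_one]
  rintro ⟨φ, A, hA⟩ h
  have hm : φ ∈ isotopicToId Surface := (QuotientGroup.eq_one_iff φ).1 h
  have hB := hA.inv (B := ((A⁻¹ : GL (Fin 2) ℝ) : Matrix (Fin 2) (Fin 2) ℝ)) (by
    rw [← Units.val_mul, inv_mul_cancel, Units.val_one])
  obtain ⟨a10, a01, a00, a11, ha⟩ := affine_of_mem_isotopicToId hA hm
  obtain ⟨b10, b01, b00, b11, -⟩ := affine_of_mem_isotopicToId hB (inv_mem hm)
  have hmul : ((A⁻¹ : GL (Fin 2) ℝ) : Matrix (Fin 2) (Fin 2) ℝ) * A = 1 := by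
    rw [← Units.val_mul, inv_mul_cancel, Units.val_one]
  have m0 := congrFun (congrFun hmul 0) 0
  have m1 := congrFun (congrFun hmul 1) 1
  rw [Matrix.mul_apply, Fin.sum_univ_two, a10, mul_zero, add_zero, Matrix.one_apply_eq] at m0
  rw [Matrix.mul_apply, Fin.sum_univ_two, a01, mul_zero, zero_add, Matrix.one_apply_eq] at m1
  have p0 := derivative_upper_left hA (homotopic_id_of_mem hm)
  have p1 : 0 < (A : Matrix (Fin 2) (Fin 2) ℝ) 1 1 := by
    simpa using derivative_upper_left (hasDerivative_conj_reflection hA)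
      (homotopic_id_of_mem (conj_reflection_mem hm))
  have e0 : (A : Matrix (Fin 2) (Fin 2) ℝ) 0 0 = 1 := le_antisymm a00 (by nlinarith)
  have e1 : (A : Matrix (Fin 2) (Fin 2) ℝ) 1 1 = 1 := le_antisymm a11 (by nlinarith)
  have key : (φ : Surface → Surface) = id := by
    refine φ.continuous.ext_on dense_squares continuous_id ?_
    rintro _ ⟨b, k, z, hz, rfl⟩
    exact ha e0 e1 b k z hz
  exact Subtype.ext (Homeomorph.ext fun p => congrFun key p)

/-! ### The family of translation structures -/

/-- The larger solution `r` of `r + r⁻¹ = l`. -/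
def ratio (l : ℝ) : ℝ := (l + √(l ^ 2 - 4)) / 2

lemma ratio_pos {l : ℝ} (h : 2 ≤ l) : 0 < ratio l := by
  have := Real.sqrt_nonneg (l ^ 2 - 4)
  unfold ratio
  linarith

lemma ratio_add_inv {l : ℝ} (h : 2 ≤ l) : ratio l + (ratio l)⁻¹ = l := by
  have h0 := (ratio_pos h).ne'
  have hs : √(l ^ 2 - 4) ^ 2 = l ^ 2 - 4 := Real.sq_sqrt (by nlinarith)
  have : ratio l ^ 2 + 1 = l * ratio l := by
    unfold ratio
    linear_combination hs / 4
  field_simp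
  linarith

/-- The derivative of the product of the affine multitwists. -/
def derivative (l : ℝ) : Matrix.SpecialLinearGroup (Fin 2) ℝ :=
  ⟨!![1 - l ^ 2, l; -l, 1], by rw [Matrix.det_fin_two_of]; ring⟩

lemma hasDerivative_ratio {l : ℝ} (h : 2 ≤ l) :
    (stretched (ratio_pos h)).HasDerivative (affineProduct (ratio_pos h))
      (derivative l : Matrix (Fin 2) (Fin 2) ℝ) := by
  have := hasDerivative_affineProduct (ratio_pos h)
  rw [ratio_add_inv h] at this
  exact this

lemma discr_derivative (l : ℝ) :
    (derivative l : Matrix (Fin 2) (Fin 2) ℝ).discr = l ^ 2 * (l ^ 2 - 4) := by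
  rw [Matrix.discr_fin_two, Matrix.trace_fin_two, Matrix.det_fin_two]
  simp [derivative]
  ring

lemma isParabolic_derivative : (derivative 2 : Matrix (Fin 2) (Fin 2) ℝ).IsParabolic := by
  refine ⟨?_, by rw [discr_derivative]; norm_num⟩
  rintro ⟨a, ha⟩
  have := congrFun (congrFun ha 0) 1
  simp [derivative] at this

lemma isHyperbolic_derivative {l : ℝ} (h : 2 < l) :
    (derivative l : Matrix (Fin 2) (Fin 2) ℝ).IsHyperbolic := by
  rw [Matrix.IsHyperbolic, discr_derivative]
  have : 0 < l ^ 2 - 4 := by nlinarith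
  positivity

lemma orientationPreserving_product : MappingClass.OrientationPreserving orientation
    (QuotientGroup.mk (dehnTwist.twist ()) * QuotientGroup.mk verticalTwist) := by
  refine ⟨affineProduct one_pos, mk_affineProduct one_pos, ?_⟩
  refine (hasDerivative_affineProduct one_pos).isOrientationPreserving ?_
  norm_num

end Staircase

end FlatSurf

end

open FlatSurf.Staircase

theorem theorem1p5 :
    ∃ (S : Type) (_ : TopologicalSpace S) (_ : FlatSurf.IsLochNessMonster S)
      (O : FlatSurf.SurfaceOrientation S)
      (M : Set.Ici (2 : ℝ) → FlatSurf.TranslationStructure S)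
      (ι κ : Type) (α : ι → FlatSurf.SimpleClosedCurve S) (β : κ → FlatSurf.SimpleClosedCurve S)
      (Tα Tβ : S ≃ₜ S) (f : FlatSurf.MappingClass S),
      FlatSurf.IsMulticurve α ∧ FlatSurf.IsMulticurve β ∧
      FlatSurf.IsRightMultitwist O α Tα ∧ FlatSurf.IsRightMultitwist O β Tβ ∧
      f = QuotientGroup.mk Tα * QuotientGroup.mk Tβ ∧
      FlatSurf.MappingClass.OrientationPreserving O f ∧
      (∀ k : ℕ, 1 ≤ k → ∀ c : FlatSurf.SimpleClosedCurve S, c.IsEssential →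
        ¬ FlatSurf.MappingClass.Fixes (f ^ k) c) ∧
      ∀ l : Set.Ici (2 : ℝ),
        Function.Injective (M l).toMappingClass ∧
        ∃ φ : (M l).Aff, (M l).toMappingClass φ = f ∧
          ∃ A : Matrix.SpecialLinearGroup (Fin 2) ℝ,
            (M l).HasDerivative (φ : S ≃ₜ S) (A : Matrix (Fin 2) (Fin 2) ℝ) ∧
            ((l : ℝ) = 2 → (A : Matrix (Fin 2) (Fin 2) ℝ).IsParabolic) ∧
            (2 < (l : ℝ) → (A : Matrix (Fin 2) (Fin 2) ℝ).IsHyperbolic) := by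
  refine ⟨Surface, inferInstance, isLochNessMonster, orientation,
    fun l => stretched (ratio_pos l.2), ℤ, ℤ, core, fun k => (core k).map reflection,
    dehnTwist.twist (), verticalTwist, _, isMulticurve_core, isMulticurve_core.map reflection,
    isRightMultitwist_core, isRightMultitwist_map_core, rfl, orientationPreserving_product,
    fun k hk c hc => ?_, fun l => ⟨toMappingClass_injective _, ?_⟩⟩
  · rw [← mk_affineProduct one_pos]
    exact not_fixes hk hc
  · have hd := hasDerivative_ratio l.2
    refine ⟨⟨affineProduct (ratio_pos l.2), (derivative (l : ℝ)).toGL, hd⟩, mk_affineProduct _,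
      derivative l, hd, fun h => ?_, isHyperbolic_derivative⟩
    rw [h]
    exact isParabolic_derivative
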